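/- Let $\Theta\subset\mathbb R^d$, let $\mu:\mathbb R^d\to\mathbb R^m$, let $\Sigma(\cdot)$ be a map from $\mathbb R^d$ to the $m\times m$ matrices, positive definite on $\Theta$, and consider the Gaussian model $\{\mathcal N(\mu(\theta),\Sigma(\theta)):\theta\in\Theta\}$. Let $g:\mathbb R^d\to\mathbb R^r$, $\Theta_0=\{\theta\in\Theta: g(\theta)=0\}$, $G(\theta)=\partial g^T(\theta)/\partial\theta$ (a $d\times r$ matrix), and let $\tau\ge 0$. For observations $Y_1,\dots,Y_n$ put, with $q_i(\theta)=(Y_i-\mu(\theta))^T\Sigma(\theta)^{-1}(Y_i-\mu(\theta))$, $$H_n^\tau(\theta)=\frac{\tau+1}{\tau(2\pi)^{m\tau/2}}|\Sigma(\theta)|^{-\tau/2}\Big[\frac1n\sum_{i=1}^n e^{-\frac{\tau}{2}q_i(\theta)}-\frac{\tau}{(1+\tau)^{m/2+1}}\Big]-\frac1\tau\quad(\tau>0),$$ $$H_n^0(\theta)=\lim_{\tau\to0}H_n^\tau(\theta)=-\frac m2\log 2\pi-\frac12\log|\Sigma(\theta)|-\frac1{2n}\sum_{i=1}^n q_i(\theta).$$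 The restricted minimum density power divergence Gaussian estimator (RMDPDGE) $\tilde\theta_n$ is a maximizer of $H_n^\tau$ over $\Theta_0$. With $\Delta^i_\tau=\frac\tau2\operatorname{tr}(\Sigma^{-1}\partial_i\Sigma)$ and all quantities on the right evaluated at $\theta$, define the $d\times d$ matrices $$J_\tau^{ij}=\Big(\frac{1}{(2\pi)^{m/2}|\Sigma|^{1/2}}\Big)^{\tau}\frac{1}{(1+\tau)^{m/2+2}}\Big[(\tau+1)\operatorname{tr}\big(\Sigma^{-1}\partial_i\mu\,(\partial_j\mu)^T\big)+\Delta^i_\tau\Delta^j_\tau+\tfrac12\operatorname{tr}\big(\Sigma^{-1}\partial_j\Sigma\,\Sigma^{-1}\partial_i\Sigma\big)\Big],$$ $$K_\tau^{ij}=\Big(\frac{1}{(2\pi)^{m/2}|\Sigma|^{1/2}}\Big)^{2\tau}\Big\{\frac{1}{(1+2\tau)^{m/2+2}}\Big[\Delta^i_{2\tau}\Delta^j_{2\tau}+(1+2\tau)\operatorname{tr}\big(\Sigma^{-1}\partial_i\mu\,(\partial_j\mu)^T\big)+\tfrac12\operatorname{tr}\big(\Sigma^{-1}\partial_j\Sigma\,\Sigma^{-1}\partial_i\Sigma\big)\Big]-\frac{1}{(1+\tau)^{m+2}}\Delta^i_\tau\Delta^j_\tau\Big\}.$$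 Let $\theta\in\Theta_0$ be an interior point of $\Theta$ such that $\mu$ and $\Sigma$ are $C^2$ near $\theta$, $g$ is $C^1$ near $\theta$, $\operatorname{rank}G(\theta)=r$, $J_\tau(\theta)$ is nonsingular, and $\theta$ is identified by mean and covariance within $\Theta_0$: for every $\varepsilon>0$ there is $\delta>0$ such that every $\theta'\in\Theta_0$ with $\|\mu(\theta')-\mu(\theta)\|<\delta$ and $|\Sigma_{ab}(\theta')-\Sigma_{ab}(\theta)|<\delta$ for all $a,b$ satisfies $\|\theta'-\theta\|<\varepsilon$. Let $Y_1,Y_2,\dots$ be i.i.d. with law $\mathcal N(\mu(\theta),\Sigma(\theta))$, and let $\tilde\theta_n$ be measurable and, with probability tending to one, an RMDPDGE based on $Y_1,\dots,Y_n$. Then $G(\theta)^TJ_\tau(\theta)^{-1}G(\theta)$ is nonsingular and, with $$Q_\tau=J_\tau^{-1}G\,(G^TJ_\tau^{-1}G)^{-1},\qquad P^*_\tau=J_\tau^{-1}-Q_\tau G^TJ_\tau^{-1},\qquad M_\tau=P^*_\tau K_\tau (P^*_\tau)^T$$ at $\theta$, the matrix $M_\tau(\theta)$ is positive semidefinite and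 $$\sqrt n\,(\tilde\theta_n-\theta)\ \xrightarrow{\ \mathcal L\ }\ \mathcal N(0_d,M_\tau(\theta))\qquad(n\to\infty).$$ -/

import Mathlib

open MeasureTheory ProbabilityTheory Filter Topology
open scoped Matrix

namespace GaussianDPD

noncomputable section

/-- The squared Mahalanobis distance `(y - ν)ᵀ S⁻¹ (y - ν)`. -/
def mahalanobisSq {m : ℕ} (ν : EuclideanSpace ℝ (Fin m)) (S : Matrix (Fin m) (Fin m) ℝ)
    (y : EuclideanSpace ℝ (Fin m)) : ℝ :=
  (y - ν).ofLp ⬝ᵥ (S⁻¹ *ᵥ (y - ν).ofLp)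

/-- The Gaussian density power divergence objective `H_n^τ(θ)` of the first `n` observations
`y 0, …, y (n - 1)`, for the Gaussian model with mean `mu θ` and covariance `Sig θ`:
for `τ ≠ 0` it is
`a |Σ(θ)|^(-τ/2) ((1/n) ∑ exp(-(τ/2) (yᵢ - μ(θ))ᵀ Σ(θ)⁻¹ (yᵢ - μ(θ))) - b) - 1/τ` with
`a = (τ+1) / (τ (2π)^(mτ/2))` and `b = τ / (1+τ)^(m/2+1)`; for `τ = 0` it is the limit of this
expression as `τ → 0`, the averaged Gaussian log-likelihood. -/
def objective {m d : ℕ} (τ : ℝ) (mu : EuclideanSpace ℝ (Fin d) → EuclideanSpace ℝ (Fin m))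
    (Sig : EuclideanSpace ℝ (Fin d) → Matrix (Fin m) (Fin m) ℝ)
    (n : ℕ) (y : ℕ → EuclideanSpace ℝ (Fin m)) (θ : EuclideanSpace ℝ (Fin d)) : ℝ :=
  if τ = 0 then
    -((m : ℝ) / 2) * Real.log (2 * Real.pi) - (1 / 2) * Real.log (Sig θ).det
      - (1 / 2) * ((1 / (n : ℝ)) * ∑ i ∈ Finset.range n, mahalanobisSq (mu θ) (Sig θ) (y i))
  else
    (τ + 1) / (τ * (2 * Real.pi) ^ ((m : ℝ) * τ / 2)) * (Sig θ).det ^ (-(τ / 2)) *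
      ((1 / (n : ℝ)) *
          ∑ i ∈ Finset.range n, Real.exp (-(τ / 2) * mahalanobisSq (mu θ) (Sig θ) (y i))
        - τ / (1 + τ) ^ ((m : ℝ) / 2 + 1))
      - 1 / τ

/-- The restricted parameter space `Θ₀ = {θ ∈ Θ | g(θ) = 0}`. -/
def restrictedSpace {d r : ℕ} (Θ : Set (EuclideanSpace ℝ (Fin d)))
    (g : EuclideanSpace ℝ (Fin d) → EuclideanSpace ℝ (Fin r)) :
    Set (EuclideanSpace ℝ (Fin d)) :=
  {θ | θ ∈ Θ ∧ g θ = 0}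

/-- `t` is a value of the restricted minimum density power divergence Gaussian estimator for the
sample `y 0, …, y (n - 1)`: a global maximizer of `H_n^τ` over `Θ₀`. -/
def IsRMDPDGE {m d r : ℕ} (τ : ℝ) (mu : EuclideanSpace ℝ (Fin d) → EuclideanSpace ℝ (Fin m))
    (Sig : EuclideanSpace ℝ (Fin d) → Matrix (Fin m) (Fin m) ℝ)
    (Θ : Set (EuclideanSpace ℝ (Fin d)))
    (g : EuclideanSpace ℝ (Fin d) → EuclideanSpace ℝ (Fin r))
    (n : ℕ) (y : ℕ → EuclideanSpace ℝ (Fin m)) (t : EuclideanSpace ℝ (Fin d)) : Prop :=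
  t ∈ restrictedSpace Θ g ∧ IsMaxOn (objective τ mu Sig n y) (restrictedSpace Θ g) t

/-- The parameter `θ` is identified, over the set `T`, by the mean vector and the covariance
matrix: parameters of `T` whose mean and covariance are close to those of `θ` are close to `θ`. -/
def IdentifiedAt {m d : ℕ} (mu : EuclideanSpace ℝ (Fin d) → EuclideanSpace ℝ (Fin m))
    (Sig : EuclideanSpace ℝ (Fin d) → Matrix (Fin m) (Fin m) ℝ)
    (T : Set (EuclideanSpace ℝ (Fin d))) (θ : EuclideanSpace ℝ (Fin d)) : Prop :=
  ∀ ε > 0, ∃ δ > 0, ∀ θ' ∈ T, ‖mu θ' - mu θ‖ < δ → (∀ a b, |Sig θ' a b - Sig θ a b| < δ) →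
    ‖θ' - θ‖ < ε

/-- `∂μ(θ)/∂θ_i`. -/
def dMu {m d : ℕ} (mu : EuclideanSpace ℝ (Fin d) → EuclideanSpace ℝ (Fin m))
    (θ : EuclideanSpace ℝ (Fin d)) (i : Fin d) : Fin m → ℝ :=
  (fderiv ℝ mu θ (EuclideanSpace.single i 1)).ofLp

/-- `∂Σ(θ)/∂θ_i`, entry by entry. -/
def dSig {m d : ℕ} (Sig : EuclideanSpace ℝ (Fin d) → Matrix (Fin m) (Fin m) ℝ)
    (θ : EuclideanSpace ℝ (Fin d)) (i : Fin d) : Matrix (Fin m) (Fin m) ℝ :=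
  Matrix.of fun a b => fderiv ℝ (fun t => Sig t a b) θ (EuclideanSpace.single i 1)

/-- The `d × r` matrix `G(θ) = ∂gᵀ(θ)/∂θ`, with entries `∂g_k/∂θ_i`. -/
def matG {d r : ℕ} (g : EuclideanSpace ℝ (Fin d) → EuclideanSpace ℝ (Fin r))
    (θ : EuclideanSpace ℝ (Fin d)) : Matrix (Fin d) (Fin r) ℝ :=
  Matrix.of fun i k => (fderiv ℝ g θ (EuclideanSpace.single i 1)) k

/-- `Δ_τ^i = (τ/2) trace(Σ(θ)⁻¹ ∂Σ(θ)/∂θ_i)`. -/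
def Delta {m d : ℕ} (τ : ℝ) (Sig : EuclideanSpace ℝ (Fin d) → Matrix (Fin m) (Fin m) ℝ)
    (θ : EuclideanSpace ℝ (Fin d)) (i : Fin d) : ℝ :=
  τ / 2 * ((Sig θ)⁻¹ * dSig Sig θ i).trace

/-- `trace(Σ(θ)⁻¹ (∂μ(θ)/∂θ_i) (∂μ(θ)/∂θ_j)ᵀ)`. -/
def meanTrace {m d : ℕ} (mu : EuclideanSpace ℝ (Fin d) → EuclideanSpace ℝ (Fin m))
    (Sig : EuclideanSpace ℝ (Fin d) → Matrix (Fin m) (Fin m) ℝ)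
    (θ : EuclideanSpace ℝ (Fin d)) (i j : Fin d) : ℝ :=
  ((Sig θ)⁻¹ * Matrix.vecMulVec (dMu mu θ i) (dMu mu θ j)).trace

/-- `trace(Σ(θ)⁻¹ (∂Σ(θ)/∂θ_j) Σ(θ)⁻¹ (∂Σ(θ)/∂θ_i))`. -/
def covTrace {m d : ℕ} (Sig : EuclideanSpace ℝ (Fin d) → Matrix (Fin m) (Fin m) ℝ)
    (θ : EuclideanSpace ℝ (Fin d)) (i j : Fin d) : ℝ :=
  ((Sig θ)⁻¹ * dSig Sig θ j * (Sig θ)⁻¹ * dSig Sig θ i).trace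

/-- The normalizing constant `1 / ((2π)^(m/2) |Σ(θ)|^(1/2))` of the Gaussian density. -/
def normConst {m d : ℕ} (Sig : EuclideanSpace ℝ (Fin d) → Matrix (Fin m) (Fin m) ℝ)
    (θ : EuclideanSpace ℝ (Fin d)) : ℝ :=
  1 / ((2 * Real.pi) ^ ((m : ℝ) / 2) * (Sig θ).det ^ ((1 : ℝ) / 2))

/-- The matrix `J_τ(θ)`. -/
def matJ {m d : ℕ} (τ : ℝ) (mu : EuclideanSpace ℝ (Fin d) → EuclideanSpace ℝ (Fin m))
    (Sig : EuclideanSpace ℝ (Fin d) → Matrix (Fin m) (Fin m) ℝ)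
    (θ : EuclideanSpace ℝ (Fin d)) : Matrix (Fin d) (Fin d) ℝ :=
  Matrix.of fun i j =>
    normConst Sig θ ^ τ * (1 / (1 + τ) ^ ((m : ℝ) / 2 + 2)) *
      ((τ + 1) * meanTrace mu Sig θ i j + Delta τ Sig θ i * Delta τ Sig θ j
        + 1 / 2 * covTrace Sig θ i j)

/-- The matrix `K_τ(θ)`. -/
def matK {m d : ℕ} (τ : ℝ) (mu : EuclideanSpace ℝ (Fin d) → EuclideanSpace ℝ (Fin m))
    (Sig : EuclideanSpace ℝ (Fin d) → Matrix (Fin m) (Fin m) ℝ)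
    (θ : EuclideanSpace ℝ (Fin d)) : Matrix (Fin d) (Fin d) ℝ :=
  Matrix.of fun i j =>
    normConst Sig θ ^ (2 * τ) * (1 / (1 + 2 * τ) ^ ((m : ℝ) / 2 + 2)) *
      (Delta (2 * τ) Sig θ i * Delta (2 * τ) Sig θ j
        + (1 + 2 * τ) * meanTrace mu Sig θ i j + 1 / 2 * covTrace Sig θ i j)
    - normConst Sig θ ^ (2 * τ) * (1 / (1 + τ) ^ ((m : ℝ) + 2)) *
      (Delta τ Sig θ i * Delta τ Sig θ j)

/-- `Q = J⁻¹ G (Gᵀ J⁻¹ G)⁻¹`. -/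
def matQ {d r : ℕ} (J : Matrix (Fin d) (Fin d) ℝ) (G : Matrix (Fin d) (Fin r) ℝ) :
    Matrix (Fin d) (Fin r) ℝ :=
  J⁻¹ * G * (Gᵀ * J⁻¹ * G)⁻¹

/-- `P* = J⁻¹ - Q Gᵀ J⁻¹`. -/
def matP {d r : ℕ} (J : Matrix (Fin d) (Fin d) ℝ) (G : Matrix (Fin d) (Fin r) ℝ) :
    Matrix (Fin d) (Fin d) ℝ :=
  J⁻¹ - matQ J G * Gᵀ * J⁻¹

/-- The asymptotic covariance matrix `M_τ(θ) = P*_τ(θ) K_τ(θ) P*_τ(θ)ᵀ`. -/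
def matM {m d r : ℕ} (τ : ℝ) (mu : EuclideanSpace ℝ (Fin d) → EuclideanSpace ℝ (Fin m))
    (Sig : EuclideanSpace ℝ (Fin d) → Matrix (Fin m) (Fin m) ℝ)
    (g : EuclideanSpace ℝ (Fin d) → EuclideanSpace ℝ (Fin r))
    (θ : EuclideanSpace ℝ (Fin d)) : Matrix (Fin d) (Fin d) ℝ :=
  matP (matJ τ mu Sig θ) (matG g θ) * matK τ mu Sig θ *
    (matP (matJ τ mu Sig θ) (matG g θ))ᵀ

end

end GaussianDPD

namespace GaussianDPD

noncomputable section

/-! The log-density of N(μ(t), Σ(t)) at `y` is linear in the coefficients of a quadratic polynomial: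
it is `suff y` applied to `natParam mu Sig t`. Up to an additive constant the objective is therefore
a sample mean of `dpd`, a power link of a linear statistic minus the partition function ∫ φ_t^(1+τ).
One formula covers τ = 0 and τ > 0, derivatives in `t` are exponential family derivatives, and since
φ^(1+τ) is a multiple of the Gaussian density with covariance Σ/(1+τ), the expectations needed are
Gaussian moments of order at most four. At the true parameter the gradient has mean zero and
covariance (1+τ)² K, and the expected Hessian is -(1+τ) J (`matJ_apply`, `matK_apply`,
`integral_dpdHess_apply`).

A consistent estimator is eventually a local extremum on a level set of `g`, so its gradient is a
Lagrange multiplier composed with the derivative of `g`. Linearizing the gradient at θ, with the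
Hessian controlled by a uniform law of large numbers, and applying P*, which satisfies P* G = 0 and
P* J = 1 - Q Gᵀ, eliminates the multiplier: √n (θ̃ - θ) is P* applied to the normalized score up to
o_P(1) (`holdsWHP_constrained_asymptotically_linear`). The central limit theorem and Slutsky's lemma
conclude.

Consistency is delicate because Θ need not be compact and μ, Σ need not be continuous away from θ.
The argument takes place in the space of all nondegenerate Gaussian laws, parametrized by
standardizing maps y ↦ By - c (`Rows`). With high probability no law with (B, c) large or |det B|
small does as well as the true one (`exists_holdsWHP_candidate_bounds`): for τ = 0 the mean squared
residual grows quadratically in (B, c) and log |det B| only linearly; for τ > 0 a large row rewards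
only observations near one hyperplane, and these are a small proportion of the sample. On the
remaining compact set the uniform law of large numbers applies, and the limit is maximized only by
the true mean and covariance, by the strict inequality `gap_pos`. Hence competitive parameters have
nearly the true mean and covariance (`holdsWHP_mean_cov_close`), and identification places them near
θ. -/

/-- The event `p n` has (outer) probability tending to one. -/
def HoldsWHP {Ω : Type*} [MeasurableSpace Ω] (P : Measure Ω) (p : ℕ → Ω → Prop) : Prop :=
  Tendsto (fun n => P {ω | ¬ p n ω}) atTop (𝓝 0)

/-! ### Events of probability tending to one, and limit theorems for i.i.d. sums -/

section WHP

variable {Ω : Type*} [MeasurableSpace Ω] {P : Measure Ω}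

lemma HoldsWHP.mono {p q : ℕ → Ω → Prop} (hp : HoldsWHP P p)
    (h : ∀ᶠ n in atTop, ∀ ω, p n ω → q n ω) : HoldsWHP P q := by
  refine tendsto_of_tendsto_of_tendsto_of_le_of_le' tendsto_const_nhds hp
    (Eventually.of_forall fun _ => zero_le) ?_
  filter_upwards [h] with n hn
  exact measure_mono fun ω hω hpω => hω (hn ω hpω)

lemma HoldsWHP.and {p q : ℕ → Ω → Prop} (hp : HoldsWHP P p) (hq : HoldsWHP P q) :
    HoldsWHP P (fun n ω => p n ω ∧ q n ω) := by
  have h := hp.add hq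
  rw [add_zero] at h
  refine tendsto_of_tendsto_of_tendsto_of_le_of_le tendsto_const_nhds h
    (fun _ => zero_le) fun n => ?_
  refine (measure_mono ?_).trans (measure_union_le _ _)
  intro ω hω
  by_cases h1 : p n ω
  · exact Or.inr fun h2 => hω ⟨h1, h2⟩
  · exact Or.inl h1

/-- If for every `ε > 0` the property `p` follows, with probability tending to one, from an
event which eventually has probability at least `1 - ε`, then `p` holds with probability tending
to one. -/
lemma holdsWHP_of_forall_eps {p : ℕ → Ω → Prop}
    (h : ∀ ε : ℝ, 0 < ε → ∃ q s : ℕ → Ω → Prop, HoldsWHP P q ∧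
      (∀ᶠ n in atTop, P {ω | ¬ s n ω} ≤ ENNReal.ofReal ε) ∧
      ∀ᶠ n in atTop, ∀ ω, q n ω → s n ω → p n ω) : HoldsWHP P p := by
  rw [HoldsWHP, ENNReal.tendsto_nhds_zero]
  intro ε hε
  by_cases hεt : ε = ⊤
  · simp [hεt]
  obtain ⟨δ, hδ, hδε⟩ : ∃ δ : ℝ, 0 < δ ∧ ENNReal.ofReal δ + ENNReal.ofReal δ ≤ ε := by
    refine ⟨ε.toReal / 2, by have := ENNReal.toReal_pos hε.ne' hεt; positivity, ?_⟩
    rw [← ENNReal.ofReal_add (by positivity) (by positivity), add_halves, ENNReal.ofReal_toReal hεt]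
  obtain ⟨q, s, hq, hs, hp⟩ := h δ hδ
  have hq' := (ENNReal.tendsto_nhds_zero.1 hq) (ENNReal.ofReal δ) (by simpa using hδ)
  filter_upwards [hq', hs, hp] with n h1 h2 h3
  refine le_trans (measure_mono (t := {ω | ¬ q n ω} ∪ {ω | ¬ s n ω}) ?_)
    ((measure_union_le _ _).trans ((add_le_add h1 h2).trans hδε))
  intro ω hω
  by_cases h1 : q n ω
  · exact Or.inr fun h2 => hω (h3 ω h1 h2)
  · exact Or.inl h1

variable [IsProbabilityMeasure P] {S : Type*} [MeasurableSpace S] {ν : Measure S}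
  {Y : ℕ → Ω → S}

/-- Weak law of large numbers in a Banach space, for a function of i.i.d. observations. -/
lemma holdsWHP_mean_close [TopologicalSpace S] [BorelSpace S] [SecondCountableTopology S]
    {B : Type*} [NormedAddCommGroup B]
    [NormedSpace ℝ B] [CompleteSpace B] (hindep : iIndepFun Y P)
    (hlaw : ∀ i, HasLaw (Y i) ν P) {f : S → B} (hf : Continuous f)
    (hint : Integrable f ν) {ε : ℝ} (hε : 0 < ε) :
    HoldsWHP P (fun n ω => ‖(n : ℝ)⁻¹ • ∑ i ∈ Finset.range n, f (Y i ω) - ∫ y, f y ∂ν‖ < ε) := by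
  borelize B
  have hY : ∀ i, AEMeasurable (Y i) P := fun i => (hlaw i).aemeasurable
  have hfm : Measurable f := hf.measurable
  have hfs : StronglyMeasurable f := hf.stronglyMeasurable
  have hident : ∀ i, IdentDistrib (fun ω => f (Y i ω)) (fun ω => f (Y 0 ω)) P P := fun i =>
    ((hlaw i).identDistrib (hlaw 0)).comp hfm
  have hint0 : Integrable (fun ω => f (Y 0 ω)) P := by
    rw [← (hlaw 0).map_eq] at hint
    exact (integrable_map_measure hfs.aestronglyMeasurable (hY 0)).1 hint
  -- The strong law is used in a general Banach space: with values in continuous functions on a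
  -- compact set it becomes a uniform law.
  have hlim := strong_law_ae (μ := P) (fun i ω => f (Y i ω)) hint0
    (fun i j hij => (hindep.indepFun hij).comp hfm hfm) hident
  have hmean : P[fun ω => f (Y 0 ω)] = ∫ y, f y ∂ν := by
    rw [← (hlaw 0).map_eq, integral_map (hY 0) hfs.aestronglyMeasurable]
  rw [hmean] at hlim
  have hm : ∀ n : ℕ, AEStronglyMeasurable
      (fun ω => (n : ℝ)⁻¹ • ∑ i ∈ Finset.range n, f (Y i ω)) P := fun n =>
    (Finset.aestronglyMeasurable_fun_sum _ fun i _ =>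
      hfs.aestronglyMeasurable.comp_aemeasurable (hY i)).const_smul _
  have := tendstoInMeasure_iff_norm.1 (tendstoInMeasure_of_tendsto_ae hm hlim) ε hε
  simpa only [HoldsWHP, not_lt] using this

/-- A normalized sum of centered square integrable real variables is bounded in probability. -/
lemma exists_bound_normalizedSum_real (hindep : iIndepFun Y P)
    (hlaw : ∀ i, HasLaw (Y i) ν P) {f : S → ℝ} (hf : Measurable f)
    (h2 : MemLp f 2 ν) (h0 : ∫ y, f y ∂ν = 0) {ε : ℝ} (hε : 0 < ε) :
    ∃ M : ℝ, 0 < M ∧ ∀ n : ℕ,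
      P {ω | ¬ |(Real.sqrt n)⁻¹ * ∑ i ∈ Finset.range n, f (Y i ω)| < M} ≤ ENNReal.ofReal ε := by
  have hY : ∀ i, AEMeasurable (Y i) P := fun i => (hlaw i).aemeasurable
  have hmem : ∀ i, MemLp (fun ω => f (Y i ω)) 2 P := fun i => by
    have := h2
    rw [← (hlaw i).map_eq] at this
    exact (memLp_map_measure_iff hf.aestronglyMeasurable (hY i)).1 this
  have hmean : ∀ i, P[fun ω => f (Y i ω)] = 0 := fun i => by
    rw [← h0, ← (hlaw i).map_eq, integral_map (hY i) hf.aestronglyMeasurable]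
  have hvar : ∀ i, Var[fun ω => f (Y i ω); P] = Var[f; ν] := fun i => by
    rw [← (hlaw i).map_eq, variance_map hf.aemeasurable (hY i)]; rfl
  set v := Var[f; ν] with hv
  have hv0 : 0 ≤ v := variance_nonneg _ _
  -- Chebyshev's bound is v / M² = ε v / (v + 1) ≤ ε. The `+ 1` keeps `M` positive when the variance
  -- vanishes.
  refine ⟨Real.sqrt ((v + 1) / ε), Real.sqrt_pos.2 (by positivity), fun n => ?_⟩
  set M := Real.sqrt ((v + 1) / ε) with hM
  have hMpos : 0 < M := Real.sqrt_pos.2 (by positivity)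
  have hM2 : M ^ 2 = (v + 1) / ε := Real.sq_sqrt (by positivity)
  set T : Ω → ℝ := fun ω => (Real.sqrt n)⁻¹ * ∑ i ∈ Finset.range n, f (Y i ω) with hT
  have hTmem : MemLp T 2 P := (memLp_finsetSum _ fun i _ => hmem i).const_mul _
  have hTmean : P[T] = 0 := by
    rw [hT, integral_const_mul, integral_finsetSum _ fun i _ => (hmem i).integrable (by norm_num)]
    simp [hmean]
  have hTvar : Var[T; P] ≤ v := by
    have h1 : Var[fun ω => ∑ i ∈ Finset.range n, f (Y i ω); P] = n * v := by
      have := IndepFun.variance_sum (μ := P) (X := fun i ω => f (Y i ω)) (s := Finset.range n)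
        (fun i _ => hmem i) (fun i _ j _ hij => (hindep.indepFun hij).comp hf hf)
      have e : (∑ i ∈ Finset.range n, fun ω => f (Y i ω)) =
          fun ω => ∑ i ∈ Finset.range n, f (Y i ω) := by ext; simp
      rw [e] at this
      rw [this]; simp [hvar, hv]
    rw [hT, variance_const_mul, h1, inv_pow, Real.sq_sqrt (Nat.cast_nonneg n)]
    -- For `n = 0` the inverse of zero is zero, so the variance bound is just `0 ≤ v`.
    rcases Nat.eq_zero_or_pos n with rfl | hn
    · simpa using hv0
    · have : (n : ℝ) ≠ 0 := by positivity
      rw [← mul_assoc, inv_mul_cancel₀ this, one_mul]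
  have hch := meas_ge_le_variance_div_sq hTmem hMpos
  rw [hTmean] at hch
  simp only [sub_zero] at hch
  simp only [not_lt]
  refine hch.trans (ENNReal.ofReal_le_ofReal ?_)
  rw [hM2, div_div_eq_mul_div, div_le_iff₀ (by positivity)]
  nlinarith

/-- A normalized sum of centered square integrable variables in a finite-dimensional space is
bounded in probability. -/
lemma exists_bound_normalizedSum [TopologicalSpace S] [BorelSpace S] {B : Type*}
    [NormedAddCommGroup B] [NormedSpace ℝ B] [FiniteDimensional ℝ B] (hindep : iIndepFun Y P)
    (hlaw : ∀ i, HasLaw (Y i) ν P) {f : S → B} (hf : Continuous f)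
    (h2 : MemLp f 2 ν) (h0 : ∫ y, f y ∂ν = 0) {ε : ℝ} (hε : 0 < ε) :
    ∃ M : ℝ, 0 < M ∧ ∀ n : ℕ,
      P {ω | ¬ ‖(Real.sqrt n)⁻¹ • ∑ i ∈ Finset.range n, f (Y i ω)‖ < M} ≤ ENNReal.ofReal ε := by
  have : IsProbabilityMeasure ν := by
    rw [← (hlaw 0).map_eq]; exact Measure.isProbabilityMeasure_map (hlaw 0).aemeasurable
  let b := Module.finBasis ℝ B
  set N := Module.finrank ℝ B with hN
  let c : Fin N → (B →L[ℝ] ℝ) := fun k => LinearMap.toContinuousLinearMap (b.coord k)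
  have hc : ∀ x, x = ∑ k, c k x • b k := fun x => (b.sum_repr x).symm
  have hint : Integrable f ν := h2.integrable (by norm_num)
  -- One bound per coordinate, combined by a union bound. Dividing by `N + 1` rather than `N` also
  -- covers dimension zero.
  choose M hMpos hM using fun k : Fin N =>
    exists_bound_normalizedSum_real (P := P) (Y := Y) hindep hlaw (f := fun y => c k (f y))
      ((c k).continuous.comp hf).measurable ((c k).comp_memLp' h2)
      (by rw [(c k).integral_comp_comm hint, h0, map_zero])
      (ε := ε / (N + 1)) (by positivity)
  refine ⟨∑ k, M k * ‖b k‖ + 1, ?_, fun n => ?_⟩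
  · have : 0 ≤ ∑ k, M k * ‖b k‖ :=
      Finset.sum_nonneg fun k _ => mul_nonneg (hMpos k).le (norm_nonneg _)
    linarith
  have hsub : {ω | ¬ ‖(Real.sqrt n)⁻¹ • ∑ i ∈ Finset.range n, f (Y i ω)‖ <
      ∑ k, M k * ‖b k‖ + 1} ⊆
      ⋃ k, {ω | ¬ |(Real.sqrt n)⁻¹ * ∑ i ∈ Finset.range n, c k (f (Y i ω))| < M k} := by
    intro ω hω
    by_contra hcon
    simp only [Set.mem_iUnion, Set.mem_ofPred_eq, not_exists, not_not] at hcon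
    apply hω
    have h1 : ‖(Real.sqrt n)⁻¹ • ∑ i ∈ Finset.range n, f (Y i ω)‖ ≤ ∑ k, M k * ‖b k‖ := by
      rw [hc ((Real.sqrt n)⁻¹ • ∑ i ∈ Finset.range n, f (Y i ω))]
      refine (norm_sum_le _ _).trans (Finset.sum_le_sum fun k _ => ?_)
      rw [norm_smul]
      refine mul_le_mul_of_nonneg_right ?_ (norm_nonneg _)
      have := (hcon k).le
      simpa [map_sum] using this
    linarith
  refine (measure_mono hsub).trans ((measure_iUnion_fintype_le _ _).trans ?_)
  refine (Finset.sum_le_sum fun k _ => hM k n).trans ?_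
  rw [Finset.sum_const, Finset.card_univ, Fintype.card_fin, nsmul_eq_mul,
    ← ENNReal.ofReal_natCast, ← ENNReal.ofReal_mul (by positivity)]
  refine ENNReal.ofReal_le_ofReal ?_
  rw [mul_div_assoc', div_le_iff₀ (by positivity)]
  nlinarith

/-- Multivariate central limit theorem for a function of i.i.d. observations. -/
lemma tendstoInDistribution_normalizedSum [TopologicalSpace S] [BorelSpace S] {d : ℕ}
    (hindep : iIndepFun Y P) (hlaw : ∀ i, HasLaw (Y i) ν P)
    {f : S → EuclideanSpace ℝ (Fin d)} (hf : Continuous f) (h2 : MemLp f 2 ν)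
    (h0 : ∫ y, f y ∂ν = 0) (C : Matrix (Fin d) (Fin d) ℝ) (hCpsd : C.PosSemidef)
    (hC : ∀ x : EuclideanSpace ℝ (Fin d), ∫ y, (inner ℝ (f y) x) ^ 2 ∂ν = x.ofLp ⬝ᵥ C *ᵥ x.ofLp) :
    TendstoInDistribution
      (fun (n : ℕ) ω => (Real.sqrt n)⁻¹ • ∑ i ∈ Finset.range n, f (Y i ω)) atTop
      (id : EuclideanSpace ℝ (Fin d) → EuclideanSpace ℝ (Fin d)) (fun _ => P)
      (multivariateGaussian 0 C) := by
  have hY : ∀ i, AEMeasurable (Y i) P := fun i => (hlaw i).aemeasurable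
  have : IsProbabilityMeasure ν := by
    rw [← (hlaw 0).map_eq]; exact Measure.isProbabilityMeasure_map (hY 0)
  have hfm : Measurable f := hf.measurable
  have hmeas : ∀ n : ℕ, AEMeasurable
      (fun ω => (Real.sqrt n)⁻¹ • ∑ i ∈ Finset.range n, f (Y i ω)) P := fun n =>
    (Finset.aemeasurable_fun_sum _ fun i _ => hfm.comp_aemeasurable (hY i)).fun_const_smul _
  refine ⟨hmeas, by fun_prop, ProbabilityMeasure.tendsto_iff_tendsto_charFun.2 fun x => ?_⟩
  simp only [ProbabilityMeasure.coe_mk, Measure.map_id]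
  let φ : S → ℝ := fun y => inner ℝ (f y) x
  have hφc : Continuous φ := hf.inner continuous_const
  have hφm : Measurable φ := hφc.measurable
  have hφ2 : MemLp φ 2 ν := by
    have := (innerSL ℝ x).comp_memLp' h2
    refine this.congr_norm hφm.aestronglyMeasurable (Eventually.of_forall fun y => ?_)
    simp [φ, real_inner_comm]
  have hφ0 : ∫ y, φ y ∂ν = 0 := by
    have := (innerSL ℝ x).integral_comp_comm (h2.integrable (by norm_num))
    rw [h0, map_zero] at this
    simpa [φ, real_inner_comm] using this
  have hvar : Var[fun ω => φ (Y 0 ω); P] = x.ofLp ⬝ᵥ C *ᵥ x.ofLp := by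
    have e : Var[fun ω => φ (Y 0 ω); P] = Var[φ; ν] := by
      rw [← (hlaw 0).map_eq, variance_map hφm.aemeasurable (hY 0)]; rfl
    rw [e, variance_of_integral_eq_zero hφm.aemeasurable hφ0]
    exact hC x
  have hX2 : MemLp (fun ω => φ (Y 0 ω)) 2 P := by
    have := hφ2
    rw [← (hlaw 0).map_eq] at this
    exact (memLp_map_measure_iff hφm.aestronglyMeasurable (hY 0)).1 this
  have hmean : P[fun ω => φ (Y 0 ω)] = 0 := by
    rw [← hφ0, ← (hlaw 0).map_eq, integral_map (hY 0) hφm.aestronglyMeasurable]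
  have hclt := tendstoInDistribution_inv_sqrt_mul_sum_sub (P := P)
    (X := fun i ω => φ (Y i ω)) (Y := id)
    (P' := gaussianReal 0 Var[fun ω => φ (Y 0 ω); P].toNNReal)
    ⟨by fun_prop, by simp⟩ hX2 (hindep.comp (fun _ => φ) fun _ => hφm)
    (fun i => ((hlaw i).identDistrib (hlaw 0)).comp hφm)
  -- Cramér–Wold: the characteristic function of the vector sum at `x` is that of the sum of the
  -- projections on `x`, taken at the argument `1`.
  have hlim := ProbabilityMeasure.tendsto_iff_tendsto_charFun.1 hclt.tendsto 1
  simp only [ProbabilityMeasure.coe_mk, Measure.map_id] at hlim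
  rw [charFun_multivariateGaussian hCpsd]
  rw [hvar, charFun_gaussianReal] at hlim
  have hnn : 0 ≤ x.ofLp ⬝ᵥ C *ᵥ x.ofLp := by
    rw [← hC x]; exact integral_nonneg fun y => sq_nonneg _
  have hRHS : Complex.exp (((1 : ℝ) : ℂ) * ((0 : ℝ) : ℂ) * Complex.I -
      (((x.ofLp ⬝ᵥ C *ᵥ x.ofLp).toNNReal : ℝ) : ℂ) * ((1 : ℝ) : ℂ) ^ 2 / 2) =
      Complex.exp (((inner ℝ x (0 : EuclideanSpace ℝ (Fin d)) : ℝ) : ℂ) * Complex.I -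
        ((x.ofLp ⬝ᵥ C *ᵥ x.ofLp : ℝ) : ℂ) / 2) := by
    rw [Real.coe_toNNReal _ hnn]; simp
  rw [hRHS] at hlim
  refine hlim.congr fun n => ?_
  rw [charFun_apply_real, charFun_apply, integral_map (hmeas n) (by fun_prop),
    integral_map (hclt.forall_aemeasurable n) (by fun_prop)]
  refine integral_congr_ae (Eventually.of_forall fun ω => ?_)
  simp only [hmean, φ, mul_zero, sub_zero, real_inner_smul_left, sum_inner]
  push_cast
  ring_nf

end WHP

/-! ### Asymptotic linearity of constrained M-estimators -/

section ConstrainedMEstimator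

variable {E F : Type*} [NormedAddCommGroup E] [NormedSpace ℝ E]
  [NormedAddCommGroup F] [NormedSpace ℝ F]

/-- Stability of the linearized first order conditions of a constrained maximum. -/
lemma exists_norm_sub_le_of_firstOrderConditions
    (A : E →L[ℝ] E →L[ℝ] ℝ) (D : E →L[ℝ] F) (Pm : (E →L[ℝ] ℝ) →L[ℝ] E) (Q : F →L[ℝ] E)
    (hPA : ∀ h, Pm (A h) = h - Q (D h)) (hPD : ∀ l : F →L[ℝ] ℝ, Pm (l.comp D) = 0)
    (hDQ : ∀ x, D (Q x) = x) :
    ∃ C > 0, ∃ ε₀ > 0, ∀ ε, 0 < ε → ε < ε₀ → ∀ (h : E) (U gr : E →L[ℝ] ℝ) (l : F →L[ℝ] ℝ)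
      (D' : E →L[ℝ] F), ‖gr - (U - A h)‖ ≤ ε * ‖h‖ → gr = l.comp D' → ‖D' - D‖ ≤ ε →
      ‖D h‖ ≤ ε * ‖h‖ → ‖h - Pm U‖ ≤ C * ε * ‖U‖ := by
  set p := ‖Pm‖ with hp
  set q := ‖Q‖ with hq
  set a := ‖A‖ with ha
  have hp0 : 0 ≤ p := norm_nonneg Pm
  have hq0 : 0 ≤ q := norm_nonneg Q
  have ha0 : 0 ≤ a := norm_nonneg A
  -- `c` collects the norms of the three terms of `hkey`; the final `1` makes it positive, so that
  -- one may divide by it.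
  set c := q + p + 2 * p * q * (a + 1) + 1 with hc
  have hc1 : 1 ≤ c := by
    have : 0 ≤ 2 * p * q * (a + 1) := by positivity
    linarith
  have hc0 : 0 < c := by linarith
  refine ⟨c * (2 * p + 2), by positivity, min (1 / (2 * (q + 1))) (1 / (2 * c)),
    lt_min (by positivity) (by positivity), ?_⟩
  intro ε hε hε0 h U gr l D' hgr hl hD' hDh
  have hε1 : ε * q ≤ 1 / 2 := by
    have := (lt_min_iff.1 hε0).1
    rw [lt_div_iff₀ (by positivity)] at this
    nlinarith
  have hε2 : ε * c ≤ 1 / 2 := by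
    have := (lt_min_iff.1 hε0).2
    rw [lt_div_iff₀ (by positivity)] at this
    linarith
  have hε3 : ε ≤ 1 := by nlinarith
  set e := gr - (U - A h) with he
  have hgrU : ‖gr‖ ≤ ‖U‖ + a * ‖h‖ + ε * ‖h‖ := by
    have : gr = (U - A h) + e := by rw [he]; abel
    rw [this]
    have h1 : ‖A h‖ ≤ a * ‖h‖ := A.le_opNorm h
    calc ‖U - A h + e‖ ≤ ‖U - A h‖ + ‖e‖ := norm_add_le _ _
      _ ≤ ‖U‖ + ‖A h‖ + ‖e‖ := by gcongr; exact norm_sub_le _ _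
      _ ≤ _ := by gcongr
  -- The right inverse `Q` recovers the multiplier: `l` equals `l ∘ D ∘ Q`, and `l ∘ D` differs from
  -- `gr` by `l ∘ (D' - D)`.
  have hlq : l = (gr - l.comp (D' - D)).comp Q := by
    ext x
    simp [hl, hDQ]
  have hlD : ‖l.comp (D' - D)‖ ≤ ‖l‖ * ε :=
    (l.opNorm_comp_le _).trans (by gcongr)
  have hln : ‖l‖ ≤ (‖U‖ + a * ‖h‖ + ε * ‖h‖ + ‖l‖ * ε) * q := by
    calc ‖l‖ = ‖(gr - l.comp (D' - D)).comp Q‖ := by rw [← hlq]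
      _ ≤ ‖gr - l.comp (D' - D)‖ * q := ContinuousLinearMap.opNorm_comp_le _ _
      _ ≤ _ := by
        gcongr
        exact (norm_sub_le _ _).trans (add_le_add hgrU hlD)
  have hl0 := norm_nonneg l
  have hh0 := norm_nonneg h
  have hU0 := norm_nonneg U
  -- The term with ‖l‖ on the right of `hln` has coefficient at most 1/2 and is absorbed on the
  -- left.
  have hln' : ‖l‖ ≤ 2 * q * (‖U‖ + (a + 1) * ‖h‖) := by
    have h1 : ‖l‖ * (ε * q) ≤ ‖l‖ * (1 / 2) := by gcongr
    have h2 : ε * ‖h‖ * q ≤ 1 * ‖h‖ * q := by gcongr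
    nlinarith
  -- Applying `Pm` to the first order condition removes `l ∘ D` and turns `A h` into `h - Q (D h)`,
  -- leaving only terms of order `ε`.
  have hkey : h - Pm U = Q (D h) + Pm e - Pm (l.comp (D' - D)) := by
    have h1 : l.comp (D' - D) = gr - l.comp D := by
      rw [hl]; ext x; simp
    have h2 : Pm (gr - l.comp D) = Pm gr := by rw [map_sub, hPD, sub_zero]
    rw [h1, h2, he, map_sub, map_sub, hPA]
    abel
  have hb : ‖h - Pm U‖ ≤ ε * c * (‖h‖ + ‖U‖) := by
    rw [hkey]
    have h1 : ‖Q (D h)‖ ≤ q * (ε * ‖h‖) := (Q.le_opNorm _).trans (by gcongr)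
    have h2 : ‖Pm e‖ ≤ p * (ε * ‖h‖) := (Pm.le_opNorm _).trans (by gcongr)
    have h3 : ‖Pm (l.comp (D' - D))‖ ≤ p * (2 * q * (‖U‖ + (a + 1) * ‖h‖) * ε) :=
      (Pm.le_opNorm _).trans (by gcongr; exact hlD.trans (by gcongr))
    refine (norm_sub_le _ _).trans ((add_le_add ((norm_add_le _ _).trans (add_le_add h1 h2)) h3).trans ?_)
    have h5 : 0 ≤ ε * (p * q * a * ‖U‖) := by positivity
    have h6 : 0 ≤ ε * ((q + p) * ‖U‖) := by positivity
    have h7 : 0 ≤ ε * (‖h‖ + ‖U‖) := by positivity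
    rw [hc]
    nlinarith
  have hhn : ‖h‖ ≤ (2 * p + 1) * ‖U‖ := by
    have h1 : ‖h‖ ≤ ‖Pm U‖ + ‖h - Pm U‖ := by
      have := norm_add_le (Pm U) (h - Pm U)
      simpa using this
    have h2 : ‖Pm U‖ ≤ p * ‖U‖ := Pm.le_opNorm U
    have h3 : ε * c * (‖h‖ + ‖U‖) ≤ 1 / 2 * (‖h‖ + ‖U‖) := by gcongr
    linarith
  calc ‖h - Pm U‖ ≤ ε * c * (‖h‖ + ‖U‖) := hb
    _ ≤ ε * c * ((2 * p + 1) * ‖U‖ + ‖U‖) := by gcongr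
    _ = c * (2 * p + 2) * ε * ‖U‖ := by ring

/-- Linearization error of a map whose derivative is close to `-A` on a ball. -/
lemma norm_sub_linearization_le {B : Type*} [NormedAddCommGroup B] [NormedSpace ℝ B]
    {Φ : E → B} {Φ' φ : E → E →L[ℝ] B} {A : E →L[ℝ] B} {θ t : E} {r ε : ℝ}
    (ht : t ∈ Metric.ball θ r) (hd : ∀ x ∈ Metric.ball θ r, HasFDerivAt Φ (Φ' x) x)
    (h1 : ∀ x ∈ Metric.ball θ r, ‖Φ' x - φ x‖ ≤ ε / 2)
    (h2 : ∀ x ∈ Metric.ball θ r, ‖φ x - -A‖ ≤ ε / 2) :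
    ‖Φ t - (Φ θ - A (t - θ))‖ ≤ ε * ‖t - θ‖ := by
  have hr : 0 < r := dist_nonneg.trans_lt ht
  have hb : ∀ x ∈ Metric.ball θ r, ‖Φ' x - (-A)‖ ≤ ε := fun x hx =>
    calc ‖Φ' x - (-A)‖ = ‖(Φ' x - φ x) + (φ x - -A)‖ := by congr 1; abel
      _ ≤ ‖Φ' x - φ x‖ + ‖φ x - -A‖ := norm_add_le _ _
      _ ≤ ε / 2 + ε / 2 := add_le_add (h1 x hx) (h2 x hx)
      _ = ε := by ring
  have := (convex_ball θ r).norm_image_sub_le_of_norm_hasFDerivWithin_le' (f := Φ) (φ := -A)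
    (fun x hx => (hd x hx).hasFDerivWithinAt) hb (Metric.mem_ball_self hr) ht
  have e : Φ t - (Φ θ - A (t - θ)) = Φ t - Φ θ - (-A) (t - θ) := by
    rw [neg_apply]; abel
  rw [e]; exact this

/-- Lagrange multipliers when the derivative of the constraint is close to a map with a right
inverse. -/
lemma exists_multiplier_of_norm_sub_le [CompleteSpace E] [FiniteDimensional ℝ F]
    {Φ : E → ℝ} {g : E → F} {t : E} {Φ' : E →L[ℝ] ℝ} {D D' : E →L[ℝ] F} {Q : F →L[ℝ] E} {ε : ℝ}
    (hextr : IsLocalExtrOn Φ {x | g x = g t} t) (hg : HasStrictFDerivAt g D' t)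
    (hΦ : HasStrictFDerivAt Φ Φ' t) (hDQ : ∀ x, D (Q x) = x) (hD : ‖D' - D‖ ≤ ε)
    (hε : ε * ‖Q‖ < 1) : ∃ l : F →L[ℝ] ℝ, Φ' = l.comp D' := by
  have : CompleteSpace F := FiniteDimensional.complete ℝ F
  obtain ⟨Λ, Λ₀, hne, hΛ⟩ := hextr.exists_linear_map_of_hasStrictFDerivAt hg hΦ
  set Λc : F →L[ℝ] ℝ := LinearMap.toContinuousLinearMap Λ with hΛc
  have hΛa : ∀ x, Λc x = Λ x := fun x => rfl
  -- In the abnormal case `Λ` annihilates the range of `D'`, so Λ = Λ D Q = -Λ (D' - D) Q. Its norm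
  -- is then at most ε ‖Q‖ < 1 times itself, which forces `Λ = 0` and contradicts nontriviality.
  have hΛ₀ : Λ₀ ≠ 0 := by
    intro h0
    have hz : ∀ x, Λc (D' x) = 0 := fun x => by
      have := hΛ x; rw [h0] at this; simpa [hΛa] using this
    have h1 : Λc = -(Λc.comp ((D' - D).comp Q)) := by
      ext x; simp [hz, hDQ]
    have h2 : ‖Λc‖ ≤ ‖Λc‖ * (ε * ‖Q‖) := by
      calc ‖Λc‖ = ‖Λc.comp ((D' - D).comp Q)‖ := by
            conv_lhs => rw [h1, norm_neg]
        _ ≤ ‖Λc‖ * (‖D' - D‖ * ‖Q‖) :=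
            (ContinuousLinearMap.opNorm_comp_le _ _).trans
              (by gcongr; exact ContinuousLinearMap.opNorm_comp_le _ _)
        _ ≤ _ := by gcongr
    have h3 : ‖Λc‖ = 0 := by nlinarith [norm_nonneg Λc]
    apply hne
    have h4 : Λ = 0 := by
      ext x
      have : Λc x = 0 := by rw [norm_eq_zero.1 h3]; rfl
      simpa [hΛa] using this
    simp [h4, h0]
  refine ⟨(-Λ₀⁻¹) • Λc, ?_⟩
  ext x
  have := hΛ x
  simp only [ContinuousLinearMap.comp_apply, smul_apply, hΛa, smul_eq_mul] at this ⊢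
  field_simp
  linarith

variable [FiniteDimensional ℝ E] [FiniteDimensional ℝ F]
  {Ω : Type*} [MeasurableSpace Ω] {P : Measure Ω} [IsProbabilityMeasure P]
  {S : Type*} [MeasurableSpace S] [TopologicalSpace S] [BorelSpace S] [SecondCountableTopology S]
  {ν : Measure S} {Y : ℕ → Ω → S}

/-- Uniform law of large numbers over a compact parameter set, with a continuous limit. -/
lemma exists_continuousMap_holdsWHP_mean_close {K : Type*} [TopologicalSpace K] [CompactSpace K]
    {B : Type*} [NormedAddCommGroup B] [NormedSpace ℝ B] [CompleteSpace B]
    (hindep : iIndepFun Y P) (hlaw : ∀ i, HasLaw (Y i) ν P) (f : K → S → B)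
    (hf : Continuous fun x : S × K => f x.2 x.1) (b : S → ℝ) (hb : Integrable b ν)
    (hfb : ∀ k y, ‖f k y‖ ≤ b y) :
    ∃ φ : C(K, B), (∀ k, φ k = ∫ y, f k y ∂ν) ∧ ∀ ε > 0, HoldsWHP P (fun n ω =>
      ∀ k, ‖(n : ℝ)⁻¹ • ∑ i ∈ Finset.range n, f k (Y i ω) - φ k‖ < ε) := by
  -- The whole random function of the parameter is one random element of `C(K, B)`; the law of large
  -- numbers in its supremum norm is the uniform law.
  let G : C(S, C(K, B)) := ContinuousMap.curry ⟨fun x : S × K => f x.2 x.1, hf⟩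
  have hG : ∀ y k, G y k = f k y := fun y k => rfl
  have hGint : Integrable (fun y => G y) ν := by
    -- Nonnegativity of the dominating function is read off at a point of `K`, so empty `K` is
    -- separate.
    by_cases hK : Nonempty K
    · refine hb.mono' G.continuous.aestronglyMeasurable (Eventually.of_forall fun y => ?_)
      have h0 : 0 ≤ b y := (norm_nonneg _).trans (hfb hK.some y)
      exact (ContinuousMap.norm_le _ h0).2 fun k => hfb k y
    · have : IsEmpty K := not_nonempty_iff.1 hK
      have : (fun y => G y) = fun _ => 0 := by
        ext y k; exact isEmptyElim k
      rw [this]; exact integrable_zero _ _ _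
  refine ⟨∫ y, G y ∂ν, fun k => ?_, fun ε hε => ?_⟩
  · have := (ContinuousMap.evalCLM ℝ k : C(K, B) →L[ℝ] B).integral_comp_comm hGint
    simpa [hG] using this.symm
  · refine (holdsWHP_mean_close hindep hlaw G.continuous hGint hε).mono
      (Eventually.of_forall fun n ω hω k => ?_)
    refine lt_of_le_of_lt ?_ hω
    have := ContinuousMap.norm_coe_le_norm
      ((n : ℝ)⁻¹ • ∑ i ∈ Finset.range n, G (Y i ω) - ∫ y, G y ∂ν) k
    simpa [hG] using this

/-- Asymptotic linearity of a consistent constrained M-estimator. -/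
theorem holdsWHP_constrained_asymptotically_linear
    (hindep : iIndepFun Y P) (hlaw : ∀ i, HasLaw (Y i) ν P) {θ : E} {ρ : ℝ} (hρ : 0 < ρ)
    (ψ : E → S → ℝ) (ψ' : E → S → E →L[ℝ] ℝ) (ψ'' : E → S → E →L[ℝ] E →L[ℝ] ℝ)
    (hψ' : ∀ t ∈ Metric.ball θ ρ, ∀ y, HasFDerivAt (fun t => ψ t y) (ψ' t y) t)
    (hψ'' : ∀ t ∈ Metric.ball θ ρ, ∀ y, HasFDerivAt (fun t => ψ' t y) (ψ'' t y) t)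
    (hcont : ContinuousOn (fun x : S × E => ψ'' x.2 x.1) (Set.univ ×ˢ Metric.ball θ ρ))
    (b : S → ℝ) (hb : Integrable b ν) (hψb : ∀ t ∈ Metric.ball θ ρ, ∀ y, ‖ψ'' t y‖ ≤ b y)
    (hgc : Continuous (ψ' θ)) (hg2 : MemLp (ψ' θ) 2 ν) (hg0 : ∫ y, ψ' θ y ∂ν = 0)
    (A : E →L[ℝ] E →L[ℝ] ℝ) (hA : ∫ y, ψ'' θ y ∂ν = -A)
    (g : E → F) (hg : ContDiffAt ℝ 1 g θ) (hgθ : g θ = 0)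
    (Pm : (E →L[ℝ] ℝ) →L[ℝ] E) (Q : F →L[ℝ] E)
    (hPA : ∀ h, Pm (A h) = h - Q (fderiv ℝ g θ h))
    (hPD : ∀ l : F →L[ℝ] ℝ, Pm (l.comp (fderiv ℝ g θ)) = 0)
    (hDQ : ∀ x, fderiv ℝ g θ (Q x) = x)
    (Θ : Set E) (hΘ : Θ ∈ 𝓝 θ) (est : ℕ → Ω → E)
    (hcons : ∀ ε > 0, HoldsWHP P (fun n ω => ‖est n ω - θ‖ < ε))
    (hmax : HoldsWHP P (fun n ω => g (est n ω) = 0 ∧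
      IsMaxOn (fun t => (n : ℝ)⁻¹ * ∑ i ∈ Finset.range n, ψ t (Y i ω))
        {t | t ∈ Θ ∧ g t = 0} (est n ω)))
    {δ : ℝ} (hδ : 0 < δ) :
    HoldsWHP P (fun n ω => ‖Real.sqrt n • (est n ω - θ) -
      Pm ((Real.sqrt n)⁻¹ • ∑ i ∈ Finset.range n, ψ' θ (Y i ω))‖ < δ) := by
  set D := fderiv ℝ g θ with hD
  obtain ⟨C, hC, ε₀, hε₀, hlin⟩ := exists_norm_sub_le_of_firstOrderConditions A D Pm Q hPA hPD hDQ
  have hsub : Metric.closedBall θ (ρ / 2) ⊆ Metric.ball θ ρ :=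
    Metric.closedBall_subset_ball (by linarith)
  have hKc : CompactSpace (Metric.closedBall θ (ρ / 2)) :=
    isCompact_iff_compactSpace.1 (isCompact_closedBall θ (ρ / 2))
  obtain ⟨φ, hφ, hφlim⟩ := exists_continuousMap_holdsWHP_mean_close (P := P) (Y := Y) (ν := ν)
    (K := Metric.closedBall θ (ρ / 2)) hindep hlaw (fun t y => ψ'' t y)
    (by
      refine hcont.comp_continuous (f := fun x : S × Metric.closedBall θ (ρ / 2) =>
        (x.1, (x.2 : E))) (by fun_prop) fun x => ⟨trivial, hsub x.2.2⟩) b hb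
    (fun k y => hψb k (hsub k.2) y)
  refine holdsWHP_of_forall_eps fun ε₁ hε₁ => ?_
  obtain ⟨M, hM, hMb⟩ := exists_bound_normalizedSum (P := P) (Y := Y) hindep hlaw hgc hg2 hg0 hε₁
  -- The three constraints serve the stability of the first order conditions, the final error bound,
  -- and the existence of a multiplier. `M` bounds the normalized score outside an event of
  -- probability at most `ε₁`.
  obtain ⟨ε, hε, hεε₀, hεc, hεQ⟩ : ∃ ε, 0 < ε ∧ ε < ε₀ ∧ C * ε * M < δ ∧ ε * ‖Q‖ < 1 := by
    refine ⟨min (ε₀ / 2) (min (δ / (2 * (C * M))) (1 / (2 * (‖Q‖ + 1)))),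
      lt_min (by positivity) (lt_min (by positivity) (by positivity)),
      (min_le_left _ _).trans_lt (by linarith), ?_, ?_⟩
    · have h : min (ε₀ / 2) (min (δ / (2 * (C * M))) (1 / (2 * (‖Q‖ + 1)))) ≤ δ / (2 * (C * M)) :=
        (min_le_right _ _).trans (min_le_left _ _)
      rw [le_div_iff₀ (by positivity)] at h
      nlinarith
    · have h : min (ε₀ / 2) (min (δ / (2 * (C * M))) (1 / (2 * (‖Q‖ + 1)))) ≤
          1 / (2 * (‖Q‖ + 1)) := (min_le_right _ _).trans (min_le_right _ _)
      rw [le_div_iff₀ (by positivity)] at h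
      have := lt_min (show (0:ℝ) < ε₀ / 2 by positivity)
        (lt_min (show 0 < δ / (2 * (C * M)) by positivity)
          (show 0 < 1 / (2 * (‖Q‖ + 1)) by positivity))
      nlinarith [norm_nonneg Q]
  -- a small ball on which the constraint and the limiting Hessian are under control
  have hev1 : ∀ᶠ t in 𝓝 θ, HasStrictFDerivAt g (fderiv ℝ g t) t := by
    filter_upwards [hg.eventually (by simp)] with t ht
    exact ht.hasStrictFDerivAt (by simp)
  have hev2 : ∀ᶠ t in 𝓝 θ, ‖fderiv ℝ g t - D‖ ≤ ε := by
    have hc : ContinuousAt (fderiv ℝ g) θ :=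
      (hg.fderiv_right (m := 0) (by simp)).continuousAt
    filter_upwards [Metric.continuousAt_iff'.1 hc ε hε] with t ht
    rw [← dist_eq_norm]; exact ht.le
  have hev3 : ∀ᶠ t in 𝓝 θ, ‖g t - g θ - D (t - θ)‖ ≤ ε * ‖t - θ‖ :=
    ((hg.differentiableAt (by simp)).hasFDerivAt.isLittleO).def hε
  have hev4 : ∀ᶠ t in 𝓝 θ, ∀ ht : t ∈ Metric.closedBall θ (ρ / 2), ‖φ ⟨t, ht⟩ - -A‖ < ε / 2 := by
    have hθK : θ ∈ Metric.closedBall θ (ρ / 2) := Metric.mem_closedBall_self (by positivity)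
    have hc := Metric.continuousAt_iff.1 (φ.continuous.continuousAt (x := ⟨θ, hθK⟩)) (ε / 2)
      (by positivity)
    obtain ⟨r, hr, hrb⟩ := hc
    filter_upwards [Metric.ball_mem_nhds θ hr] with t ht htK
    have := hrb (x := ⟨t, htK⟩) ht
    rw [dist_eq_norm, hφ ⟨θ, hθK⟩, hA] at this
    exact this
  have hev5 : ∀ᶠ t in 𝓝 θ, t ∈ Θ := hΘ
  have hev6 : ∀ᶠ t in 𝓝 θ, t ∈ Metric.closedBall θ (ρ / 2) :=
    Metric.closedBall_mem_nhds θ (by positivity)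
  obtain ⟨r, hr, hrall⟩ := Metric.eventually_nhds_iff_ball.1
    (hev1.and (hev2.and (hev3.and (hev4.and (hev5.and hev6)))))
  refine ⟨_, _, ((hcons r hr).and (hmax.and (hφlim (ε / 2) (by positivity)))),
    Eventually.of_forall hMb, ?_⟩
  filter_upwards [eventually_gt_atTop 0] with n hn ω ⟨hest, ⟨hg0', hmx⟩, hdev⟩ hUM
  set t := est n ω with ht
  have htb : t ∈ Metric.ball θ r := by rwa [mem_ball_iff_norm]
  set Φ : E → ℝ := fun t => (n : ℝ)⁻¹ * ∑ i ∈ Finset.range n, ψ t (Y i ω) with hΦ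
  set Φ' : E → E →L[ℝ] ℝ := fun t => (n : ℝ)⁻¹ • ∑ i ∈ Finset.range n, ψ' t (Y i ω) with hΦ'
  set Φ'' : E → E →L[ℝ] E →L[ℝ] ℝ :=
    fun t => (n : ℝ)⁻¹ • ∑ i ∈ Finset.range n, ψ'' t (Y i ω) with hΦ''
  have hd1 : ∀ x ∈ Metric.ball θ ρ, HasFDerivAt Φ (Φ' x) x := fun x hx => by
    have := (HasFDerivAt.fun_sum (u := Finset.range n) fun i _ => hψ' x hx (Y i ω)).const_mul
      (n : ℝ)⁻¹
    exact this
  have hd2 : ∀ x ∈ Metric.ball θ ρ, HasFDerivAt Φ' (Φ'' x) x := fun x hx => by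
    have := (HasFDerivAt.fun_sum (u := Finset.range n) fun i _ => hψ'' x hx (Y i ω)).const_smul
      (n : ℝ)⁻¹
    exact this
  have hballρ : ∀ x ∈ Metric.ball θ r, x ∈ Metric.ball θ ρ := fun x hx =>
    hsub (hrall x hx).2.2.2.2.2
  have hstrict : HasStrictFDerivAt Φ (Φ' t) t := by
    refine hasStrictFDerivAt_of_hasFDerivAt_of_continuousAt ?_ (hd2 t (hballρ t htb)).continuousAt
    filter_upwards [Metric.isOpen_ball.mem_nhds (hballρ t htb)] with x hx using hd1 x hx
  obtain ⟨hgt, hgD, hgl, -, -, -⟩ := hrall t htb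
  -- Points of the level set of `g` through `t` inside the small ball lie in `Θ` and satisfy `g =
  -- 0`, hence belong to the set over which `t` is maximal.
  have hextr : IsLocalExtrOn Φ {x | g x = g t} t := by
    refine Or.inr ?_
    have h1 : ∀ᶠ x in 𝓝[{x | g x = g t}] t, x ∈ Metric.ball θ r :=
      mem_nhdsWithin_of_mem_nhds (Metric.isOpen_ball.mem_nhds htb)
    filter_upwards [h1, self_mem_nhdsWithin] with x hx hxg
    exact hmx ⟨(hrall x hx).2.2.2.2.1, (show g x = g t from hxg).trans hg0'⟩
  obtain ⟨l, hgr⟩ := exists_multiplier_of_norm_sub_le hextr hgt hstrict hDQ hgD hεQ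
  have hmv : ‖Φ' t - (Φ' θ - A (t - θ))‖ ≤ ε * ‖t - θ‖ := by
    classical
    -- The limiting Hessian `φ` lives on the closed ball only; its extension by zero is never
    -- evaluated outside.
    refine norm_sub_linearization_le htb (Φ' := Φ'')
      (φ := fun x => if hx : x ∈ Metric.closedBall θ (ρ / 2) then φ ⟨x, hx⟩ else 0)
      (fun x hx => hd2 x (hballρ x hx)) (fun x hx => ?_) (fun x hx => ?_)
    · have hxK := (hrall x hx).2.2.2.2.2
      simp only [hxK, dif_pos]
      exact (hdev ⟨x, hxK⟩).le
    · have hxK := (hrall x hx).2.2.2.2.2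
      simp only [hxK, dif_pos]
      exact ((hrall x hx).2.2.2.1 hxK).le
  have hDh : ‖D (t - θ)‖ ≤ ε * ‖t - θ‖ := by
    rw [hg0', hgθ, sub_zero, zero_sub, norm_neg] at hgl
    exact hgl
  have hfin := hlin ε hε hεε₀ (t - θ) (Φ' θ) (Φ' t) l _ hmv hgr hgD hDh
  have hn' : (0 : ℝ) < n := Nat.cast_pos.2 hn
  have hs : 0 < Real.sqrt n := Real.sqrt_pos.2 hn'
  have hsn : Real.sqrt n * (n : ℝ)⁻¹ = (Real.sqrt n)⁻¹ := by
    have := Real.mul_self_sqrt hn'.le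
    field_simp
    nlinarith
  have hU : (Real.sqrt n)⁻¹ • ∑ i ∈ Finset.range n, ψ' θ (Y i ω) = Real.sqrt n • Φ' θ := by
    rw [hΦ', smul_smul, hsn]
  rw [hU] at hUM ⊢
  rw [map_smul, ← smul_sub, norm_smul, Real.norm_of_nonneg hs.le]
  rw [norm_smul, Real.norm_of_nonneg hs.le] at hUM
  calc Real.sqrt n * ‖t - θ - Pm (Φ' θ)‖ ≤ Real.sqrt n * (C * ε * ‖Φ' θ‖) := by gcongr
    _ = C * ε * (Real.sqrt n * ‖Φ' θ‖) := by ring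
    _ ≤ C * ε * M := by gcongr
    _ < δ := hεc

end ConstrainedMEstimator

/-! ### Gaussian densities and their powers -/

section Gaussian

/-- Functions of polynomial growth are integrable with respect to a Gaussian measure. -/
lemma integrable_of_norm_le_pow {H B : Type*} [NormedAddCommGroup H] [NormedSpace ℝ H]
    [FiniteDimensional ℝ H] [MeasurableSpace H] [BorelSpace H]
    [NormedAddCommGroup B] (μ : Measure H) [IsGaussian μ] {f : H → B}
    (hf : AEStronglyMeasurable f μ) (C : ℝ) (k : ℕ) (h : ∀ y, ‖f y‖ ≤ C * (1 + ‖y‖ ^ 2) ^ k) :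
    Integrable f μ := by
  have hC : 0 ≤ C := by
    have := (norm_nonneg _).trans (h 0)
    simpa using this
  have : CompleteSpace H := FiniteDimensional.complete ℝ H
  have : SecondCountableTopology H := inferInstance
  have h1 : Integrable (fun y : H => ‖y‖ ^ (2 * k)) μ := by
    have := (IsGaussian.memLp_id μ ((2 * k : ℕ) : ENNReal) (ENNReal.natCast_ne_top _)).integrable_norm_pow'
    simpa using this
  have h2 : Integrable (fun y : H => C * (2 ^ k * (1 + ‖y‖ ^ (2 * k)))) μ :=
    (((integrable_const 1).add h1).const_mul _).const_mul _
  refine h2.mono' hf (Eventually.of_forall fun y => (h y).trans ?_)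
  gcongr
  have h3 : (1 + ‖y‖ ^ 2) ^ k ≤ 2 ^ (k - 1) * (1 ^ k + (‖y‖ ^ 2) ^ k) :=
    add_pow_le zero_le_one (by positivity) k
  rw [one_pow, ← pow_mul] at h3
  refine h3.trans ?_
  gcongr
  · norm_num
  · omega

variable {m : ℕ}

/-- The standard Gaussian measure has the usual density. -/
lemma stdGaussian_eq_withDensity :
    stdGaussian (EuclideanSpace ℝ (Fin m)) = volume.withDensity (fun x =>
      ENNReal.ofReal (Real.exp (-((m : ℝ) / 2) * Real.log (2 * Real.pi) - 1 / 2 * ‖x‖ ^ 2))) := by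
  set ρ : EuclideanSpace ℝ (Fin m) → ℝ :=
    fun x => Real.exp (-((m : ℝ) / 2) * Real.log (2 * Real.pi) - 1 / 2 * ‖x‖ ^ 2) with hρ
  have hρc : Continuous ρ := by fun_prop
  have hint : Integrable (fun x : EuclideanSpace ℝ (Fin m) => Real.exp (-(1 / 2) * ‖x‖ ^ 2)) := by
    have := (GaussianFourier.integrable_cexp_neg_mul_sq_norm_add
      (V := EuclideanSpace ℝ (Fin m)) (b := (1 / 2 : ℂ)) (by norm_num) 0 0).norm
    refine this.congr (Eventually.of_forall fun x => ?_)
    simp only [Complex.norm_exp]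
    congr 1
    simp [← Complex.ofReal_pow]
  have hρint : Integrable ρ := by
    refine (hint.const_mul (Real.exp (-((m : ℝ) / 2) * Real.log (2 * Real.pi)))).congr
      (Eventually.of_forall fun x => ?_)
    simp only [hρ, ← Real.exp_add]
    congr 1; ring
  have : IsFiniteMeasure (volume.withDensity fun x => ENNReal.ofReal (ρ x)) :=
    isFiniteMeasure_withDensity_ofReal hρint.2
  -- Both measures are finite, so characteristic functions decide; that of the density is a Gaussian
  -- Fourier integral with parameter 1/2.
  refine Measure.ext_of_charFun ?_
  ext t
  rw [charFun_stdGaussian, charFun_apply, integral_withDensity_eq_integral_toReal_smul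
    (by fun_prop) (Eventually.of_forall fun _ => ENNReal.ofReal_lt_top)]
  have h1 : ∀ x : EuclideanSpace ℝ (Fin m),
      (ENNReal.ofReal (ρ x)).toReal • Complex.exp (((inner ℝ x t : ℝ) : ℂ) * Complex.I) =
      (Real.exp (-((m : ℝ) / 2) * Real.log (2 * Real.pi)) : ℂ) *
        Complex.exp (-(1 / 2 : ℂ) * ‖x‖ ^ 2 + Complex.I * ((inner ℝ t x : ℝ) : ℂ)) := fun x => by
    rw [ENNReal.toReal_ofReal (Real.exp_pos _).le, Complex.real_smul]
    simp only [Complex.ofReal_exp, ← Complex.exp_add]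
    congr 1
    rw [real_inner_comm]
    push_cast
    ring
  rw [integral_congr_ae (Eventually.of_forall h1), integral_const_mul,
    GaussianFourier.integral_cexp_neg_mul_sq_norm_add (by norm_num)]
  have h2 : ((Real.pi : ℂ) / (1 / 2 : ℂ)) = ((2 * Real.pi : ℝ) : ℂ) := by
    push_cast; ring
  have h3 : (((2 * Real.pi : ℝ) : ℂ) ^ ((Module.finrank ℝ (EuclideanSpace ℝ (Fin m)) : ℂ) / 2)) =
      ((Real.exp ((m : ℝ) / 2 * Real.log (2 * Real.pi)) : ℝ) : ℂ) := by
    rw [finrank_euclideanSpace_fin]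
    have : ((m : ℂ) / 2) = (((m : ℝ) / 2 : ℝ) : ℂ) := by push_cast; ring
    rw [this, ← Complex.ofReal_cpow (by positivity), Real.rpow_def_of_pos (by positivity)]
    congr 2; ring
  rw [h2, h3, ← mul_assoc, ← Complex.ofReal_mul, ← Real.exp_add]
  rw [show -((m : ℝ) / 2) * Real.log (2 * Real.pi) + (m : ℝ) / 2 * Real.log (2 * Real.pi) = 0 by
    ring, Real.exp_zero, Complex.ofReal_one, one_mul, Complex.I_sq]
  congr 1
  ring

/-- The logarithm of the density of the Gaussian law with mean `ν` and covariance `S`. -/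
def logDens (ν : EuclideanSpace ℝ (Fin m)) (S : Matrix (Fin m) (Fin m) ℝ)
    (y : EuclideanSpace ℝ (Fin m)) : ℝ :=
  -((m : ℝ) / 2) * Real.log (2 * Real.pi) - 1 / 2 * Real.log S.det - 1 / 2 * mahalanobisSq ν S y

lemma continuous_mahalanobisSq (ν : EuclideanSpace ℝ (Fin m)) (S : Matrix (Fin m) (Fin m) ℝ) :
    Continuous (mahalanobisSq ν S) := by
  unfold mahalanobisSq dotProduct Matrix.mulVec dotProduct
  fun_prop

lemma continuous_logDens (ν : EuclideanSpace ℝ (Fin m)) (S : Matrix (Fin m) (Fin m) ℝ) :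
    Continuous (logDens ν S) := by
  have := continuous_mahalanobisSq ν S
  unfold logDens
  fun_prop

open scoped MatrixOrder in
/-- A symmetric square root of a positive definite matrix, by which Gaussian vectors are
standardized. -/
lemma exists_sqrt_multivariateGaussian {S : Matrix (Fin m) (Fin m) ℝ} (hS : S.PosDef)
    (ν : EuclideanSpace ℝ (Fin m)) :
    ∃ R : Matrix (Fin m) (Fin m) ℝ, Rᵀ = R ∧ R * R = S ∧ IsUnit R.det ∧
      multivariateGaussian ν S = (stdGaussian (EuclideanSpace ℝ (Fin m))).map
        (fun x => ν + Matrix.toEuclideanCLM (𝕜 := ℝ) R x) := by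
  have hSn : 0 ≤ S := hS.posSemidef.nonneg
  have hRR : CFC.sqrt S * CFC.sqrt S = S := CFC.sqrt_mul_sqrt_self S hSn
  refine ⟨CFC.sqrt S, ?_, hRR, ?_, rfl⟩
  · have := (CFC.sqrt_nonneg S).isSelfAdjoint.star_eq
    rwa [Matrix.star_eq_conjTranspose, Matrix.conjTranspose_eq_transpose_of_trivial] at this
  · have h : (CFC.sqrt S).det * (CFC.sqrt S).det = S.det := by rw [← Matrix.det_mul, hRR]
    rw [isUnit_iff_ne_zero]
    intro h0
    rw [h0, zero_mul] at h
    exact hS.det_pos.ne h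

/-- Because `R` is symmetric with square `S`, the inverse of `S` is R⁻¹ R⁻¹ and cancels both factors
`R` of the quadratic form. -/
lemma mahalanobisSq_add_toEuclideanCLM {S R : Matrix (Fin m) (Fin m) ℝ} (hR : Rᵀ = R)
    (hRR : R * R = S) (hu : IsUnit R.det) (ν z : EuclideanSpace ℝ (Fin m)) :
    mahalanobisSq ν S (ν + Matrix.toEuclideanCLM (𝕜 := ℝ) R z) = ‖z‖ ^ 2 := by
  have h1 : (ν + Matrix.toEuclideanCLM (𝕜 := ℝ) R z - ν).ofLp = R *ᵥ z.ofLp := by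
    rw [add_sub_cancel_left, Matrix.ofLp_toEuclideanCLM]
  rw [mahalanobisSq, h1, ← hRR, Matrix.mul_inv_rev, Matrix.mulVec_mulVec, Matrix.mul_assoc,
    Matrix.nonsing_inv_mul _ hu, Matrix.mul_one, Matrix.dotProduct_mulVec,
    ← Matrix.mulVec_transpose, Matrix.transpose_nonsing_inv, hR, Matrix.mulVec_mulVec,
    Matrix.nonsing_inv_mul _ hu, Matrix.one_mulVec, EuclideanSpace.real_norm_sq_eq]
  simp [dotProduct, sq]

/-- Nondegenerate Gaussian measures have the usual density. -/
lemma multivariateGaussian_eq_withDensity {S : Matrix (Fin m) (Fin m) ℝ} (hS : S.PosDef)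
    (ν : EuclideanSpace ℝ (Fin m)) :
    multivariateGaussian ν S =
      volume.withDensity (fun y => ENNReal.ofReal (Real.exp (logDens ν S y))) := by
  obtain ⟨R, hR, hRR, hu, hmap⟩ := exists_sqrt_multivariateGaussian hS ν
  have hdet : R.det ≠ 0 := hu.ne_zero
  set f : EuclideanSpace ℝ (Fin m) → EuclideanSpace ℝ (Fin m) :=
    fun x => ν + Matrix.toEuclideanCLM (𝕜 := ℝ) R x with hf
  have hfm : Measurable f := by fun_prop
  have hld : Continuous (logDens ν S) := continuous_logDens ν S
  -- Change of variables: translations preserve volume and `R` scales it by its determinant.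
  -- Together with log det S = 2 log |det R| this produces the normalizing constant.
  have hvol : (volume : Measure (EuclideanSpace ℝ (Fin m))).map f =
      ENNReal.ofReal |R.det⁻¹| • volume := by
    have h1 : LinearMap.det (Matrix.toEuclideanCLM (𝕜 := ℝ) R :
        EuclideanSpace ℝ (Fin m) →ₗ[ℝ] EuclideanSpace ℝ (Fin m)) = R.det := by
      rw [Matrix.coe_toEuclideanCLM_eq_toEuclideanLin, Matrix.toEuclideanLin_eq_toLin_orthonormal,
        LinearMap.det_toLin]
    have h2 := Measure.map_linearMap_addHaar_eq_smul_addHaar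
      (volume : Measure (EuclideanSpace ℝ (Fin m))) (f := (Matrix.toEuclideanCLM (𝕜 := ℝ) R :
        EuclideanSpace ℝ (Fin m) →ₗ[ℝ] EuclideanSpace ℝ (Fin m))) (by rwa [h1])
    rw [h1] at h2
    have h3 : f = (fun x => ν + x) ∘ (Matrix.toEuclideanCLM (𝕜 := ℝ) R) := rfl
    rw [h3, ← Measure.map_map (by fun_prop) (by fun_prop)]
    rw [show ((Matrix.toEuclideanCLM (𝕜 := ℝ) R :
        EuclideanSpace ℝ (Fin m) → EuclideanSpace ℝ (Fin m))) = ⇑((Matrix.toEuclideanCLM (𝕜 := ℝ) R :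
        EuclideanSpace ℝ (Fin m) →ₗ[ℝ] EuclideanSpace ℝ (Fin m))) from rfl, h2, Measure.map_smul,
        map_add_left_eq_self]
  have hpt : ∀ x, ENNReal.ofReal (Real.exp (-((m : ℝ) / 2) * Real.log (2 * Real.pi)
      - 1 / 2 * ‖x‖ ^ 2)) =
      ENNReal.ofReal |R.det| * ENNReal.ofReal (Real.exp (logDens ν S (f x))) := fun x => by
    rw [← ENNReal.ofReal_mul (abs_nonneg _)]
    congr 1
    rw [logDens, hf, mahalanobisSq_add_toEuclideanCLM hR hRR hu, ← hRR, Matrix.det_mul,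
      ← Real.exp_log (abs_pos.2 hdet), ← Real.exp_add, Real.log_abs, Real.log_mul hdet hdet]
    congr 1; ring
  rw [hmap, stdGaussian_eq_withDensity]
  ext s hs
  rw [Measure.map_apply hfm hs, withDensity_apply _ (hfm hs), withDensity_apply _ hs]
  simp_rw [hpt]
  rw [lintegral_const_mul' _ _ ENNReal.ofReal_ne_top]
  have h4 : ∫⁻ y in s, ENNReal.ofReal (Real.exp (logDens ν S y)) ∂(volume.map f) =
      ∫⁻ x in f ⁻¹' s, ENNReal.ofReal (Real.exp (logDens ν S (f x))) :=
    setLIntegral_map hs (by fun_prop) hfm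
  rw [← h4, hvol, Measure.restrict_smul, lintegral_smul_measure, smul_eq_mul, ← mul_assoc,
    ← ENNReal.ofReal_mul (abs_nonneg _), ← abs_mul, mul_inv_cancel₀ hdet, abs_one,
    ENNReal.ofReal_one, one_mul]

lemma integral_multivariateGaussian_eq {S : Matrix (Fin m) (Fin m) ℝ} (hS : S.PosDef)
    (ν : EuclideanSpace ℝ (Fin m)) {B : Type*} [NormedAddCommGroup B] [NormedSpace ℝ B]
    (h : EuclideanSpace ℝ (Fin m) → B) :
    ∫ y, h y ∂(multivariateGaussian ν S) = ∫ y, Real.exp (logDens ν S y) • h y := by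
  have hld : Continuous (logDens ν S) := continuous_logDens ν S
  rw [multivariateGaussian_eq_withDensity hS ν, integral_withDensity_eq_integral_toReal_smul
    (by fun_prop) (Eventually.of_forall fun _ => ENNReal.ofReal_lt_top)]
  simp_rw [ENNReal.toReal_ofReal (Real.exp_pos _).le]

lemma integrable_multivariateGaussian_iff {S : Matrix (Fin m) (Fin m) ℝ} (hS : S.PosDef)
    (ν : EuclideanSpace ℝ (Fin m)) {B : Type*} [NormedAddCommGroup B] [NormedSpace ℝ B]
    (h : EuclideanSpace ℝ (Fin m) → B) :
    Integrable h (multivariateGaussian ν S) ↔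
      Integrable (fun y => Real.exp (logDens ν S y) • h y) := by
  have hld : Continuous (logDens ν S) := continuous_logDens ν S
  rw [multivariateGaussian_eq_withDensity hS ν, integrable_withDensity_iff_integrable_smul'
    (by fun_prop) (Eventually.of_forall fun _ => ENNReal.ofReal_lt_top)]
  simp_rw [ENNReal.toReal_ofReal (Real.exp_pos _).le]

/-- `∫ φ^(1+τ)` for the Gaussian density `φ` with covariance `S`. -/
def kap (m : ℕ) (τ : ℝ) (D : ℝ) : ℝ :=
  Real.exp (-((m : ℝ) * τ / 2) * Real.log (2 * Real.pi) - τ / 2 * Real.log D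
    - (m : ℝ) / 2 * Real.log (1 + τ))

lemma posDef_inv_smul {S : Matrix (Fin m) (Fin m) ℝ} (hS : S.PosDef) {τ : ℝ} (hτ : 0 ≤ τ) :
    ((1 + τ)⁻¹ • S).PosDef := hS.smul (by positivity)

/-- Multiplying the log-density by 1 + τ multiplies the quadratic form by 1 + τ, that is, divides
the covariance by 1 + τ; `kap` absorbs the change of normalization. Integrals against powers of the
density thereby become Gaussian moments. -/
lemma exp_mul_logDens {S : Matrix (Fin m) (Fin m) ℝ} (hS : S.PosDef) {τ : ℝ} (hτ : 0 ≤ τ)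
    (ν y : EuclideanSpace ℝ (Fin m)) :
    Real.exp ((1 + τ) * logDens ν S y) =
      kap m τ S.det * Real.exp (logDens ν ((1 + τ)⁻¹ • S) y) := by
  have h1 : (0 : ℝ) < 1 + τ := by positivity
  have hd := hS.det_pos
  have hmah : mahalanobisSq ν ((1 + τ)⁻¹ • S) y = (1 + τ) * mahalanobisSq ν S y := by
    have : ((1 + τ)⁻¹ • S)⁻¹ = (1 + τ) • S⁻¹ := by
      refine Matrix.inv_eq_right_inv ?_
      rw [Matrix.smul_mul, Matrix.mul_smul, smul_smul, inv_mul_cancel₀ h1.ne', one_smul,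
        Matrix.mul_nonsing_inv _ hd.ne'.isUnit]
    rw [mahalanobisSq, mahalanobisSq, this, Matrix.smul_mulVec, dotProduct_smul, smul_eq_mul]
  rw [kap, ← Real.exp_add, logDens, logDens, hmah, Matrix.det_smul, Fintype.card_fin,
    Real.log_mul (by positivity) hd.ne', Real.log_pow, Real.log_inv]
  congr 1
  ring

lemma integral_exp_mul_logDens_smul {S : Matrix (Fin m) (Fin m) ℝ} (hS : S.PosDef) {τ : ℝ}
    (hτ : 0 ≤ τ) (ν : EuclideanSpace ℝ (Fin m)) {B : Type*} [NormedAddCommGroup B]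
    [NormedSpace ℝ B] (h : EuclideanSpace ℝ (Fin m) → B) :
    ∫ y, Real.exp ((1 + τ) * logDens ν S y) • h y =
      kap m τ S.det • ∫ y, h y ∂(multivariateGaussian ν ((1 + τ)⁻¹ • S)) := by
  rw [integral_multivariateGaussian_eq (posDef_inv_smul hS hτ), ← integral_smul]
  simp_rw [exp_mul_logDens hS hτ, mul_smul]

lemma integrable_exp_mul_logDens_smul {S : Matrix (Fin m) (Fin m) ℝ} (hS : S.PosDef) {τ : ℝ}
    (hτ : 0 ≤ τ) (ν : EuclideanSpace ℝ (Fin m)) {B : Type*} [NormedAddCommGroup B]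
    [NormedSpace ℝ B] {h : EuclideanSpace ℝ (Fin m) → B}
    (hh : Integrable h (multivariateGaussian ν ((1 + τ)⁻¹ • S))) :
    Integrable fun y => Real.exp ((1 + τ) * logDens ν S y) • h y := by
  rw [integrable_multivariateGaussian_iff (posDef_inv_smul hS hτ)] at hh
  simp_rw [exp_mul_logDens hS hτ, mul_smul]
  exact hh.smul (kap m τ S.det)

lemma integral_exp_mul_logDens {S : Matrix (Fin m) (Fin m) ℝ} (hS : S.PosDef) {τ : ℝ}
    (hτ : 0 ≤ τ) (ν : EuclideanSpace ℝ (Fin m)) :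
    ∫ y, Real.exp ((1 + τ) * logDens ν S y) = kap m τ S.det := by
  have := integral_exp_mul_logDens_smul hS hτ ν (fun _ => (1 : ℝ))
  simpa using this

end Gaussian

/-! ### Moments of quadratic polynomials of Gaussian vectors -/

section Moments

lemma integral_pow_gaussianReal (k : ℕ) :
    ∫ x, x ^ k ∂(gaussianReal 0 1) = iteratedDeriv k (fun t : ℝ => Real.exp (t ^ 2 / 2)) 0 := by
  have h := iteratedDeriv_mgf_zero (X := id) (μ := gaussianReal 0 1) (by simp) k
  rw [mgf_id_gaussianReal] at h
  have e : (fun t : ℝ => Real.exp (((0 : ℝ)) * t + ((1 : NNReal) : ℝ) * t ^ 2 / 2)) =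
      fun t : ℝ => Real.exp (t ^ 2 / 2) := by ext t; simp
  rw [e] at h
  rw [h]
  rfl

/-- These are the derivatives of the moment generating function of the standard normal law; their
values at zero are the moments 0, 1, 0, 3. -/
lemma iteratedDeriv_exp_half_sq :
    iteratedDeriv 1 (fun t : ℝ => Real.exp (t ^ 2 / 2)) = (fun t => t * Real.exp (t ^ 2 / 2)) ∧
    iteratedDeriv 2 (fun t : ℝ => Real.exp (t ^ 2 / 2)) =
      (fun t => (t ^ 2 + 1) * Real.exp (t ^ 2 / 2)) ∧
    iteratedDeriv 3 (fun t : ℝ => Real.exp (t ^ 2 / 2)) =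
      (fun t => (t ^ 3 + 3 * t) * Real.exp (t ^ 2 / 2)) ∧
    iteratedDeriv 4 (fun t : ℝ => Real.exp (t ^ 2 / 2)) =
      (fun t => (t ^ 4 + 6 * t ^ 2 + 3) * Real.exp (t ^ 2 / 2)) := by
  have h0 : ∀ t : ℝ, HasDerivAt (fun t : ℝ => Real.exp (t ^ 2 / 2)) (t * Real.exp (t ^ 2 / 2)) t :=
    fun t => by
      have := ((hasDerivAt_pow 2 t).div_const 2).exp
      convert! this using 1
      simp; ring
  have h1 : iteratedDeriv 1 (fun t : ℝ => Real.exp (t ^ 2 / 2)) =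
      (fun t => t * Real.exp (t ^ 2 / 2)) := by
    rw [iteratedDeriv_one]; ext t; exact (h0 t).deriv
  have h2 : iteratedDeriv 2 (fun t : ℝ => Real.exp (t ^ 2 / 2)) =
      (fun t => (t ^ 2 + 1) * Real.exp (t ^ 2 / 2)) := by
    rw [iteratedDeriv_succ, h1]; ext t
    refine HasDerivAt.deriv ?_
    convert! (hasDerivAt_id t).mul (h0 t) using 1
    simp; ring
  have h3 : iteratedDeriv 3 (fun t : ℝ => Real.exp (t ^ 2 / 2)) =
      (fun t => (t ^ 3 + 3 * t) * Real.exp (t ^ 2 / 2)) := by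
    rw [iteratedDeriv_succ, h2]; ext t
    refine HasDerivAt.deriv ?_
    convert! ((hasDerivAt_pow 2 t).add_const 1).mul (h0 t) using 1
    simp; ring
  refine ⟨h1, h2, h3, ?_⟩
  rw [iteratedDeriv_succ, h3]; ext t
  refine HasDerivAt.deriv ?_
  convert! ((hasDerivAt_pow 3 t).add ((hasDerivAt_id t).const_mul 3)).mul (h0 t) using 1
  simp; ring

/-- The first moments of the standard normal law. -/
def stdMoment : ℕ → ℝ
  | 0 => 1
  | 2 => 1
  | 4 => 3
  | _ => 0

/-- The default value of `stdMoment` is correct for odd orders but not for even orders from six on,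
whence the bound on `k`. -/
lemma integral_pow_gaussianReal_of_le {k : ℕ} (hk : k ≤ 4) :
    ∫ x, x ^ k ∂(gaussianReal 0 1) = stdMoment k := by
  obtain ⟨h1, h2, h3, h4⟩ := iteratedDeriv_exp_half_sq
  interval_cases k
  · simp [stdMoment]
  · rw [integral_pow_gaussianReal, h1]; simp [stdMoment]
  · rw [integral_pow_gaussianReal, h2]; simp [stdMoment]
  · rw [integral_pow_gaussianReal, h3]; simp [stdMoment]
  · rw [integral_pow_gaussianReal, h4]; simp [stdMoment]

variable {m : ℕ}

lemma integral_prod_pow_stdGaussian (k : Fin m → ℕ) (hk : ∀ i, k i ≤ 4) :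
    ∫ z, ∏ i, z i ^ k i ∂(stdGaussian (EuclideanSpace ℝ (Fin m))) = ∏ i, stdMoment (k i) := by
  rw [← map_pi_eq_stdGaussian, integral_map (by fun_prop)
    (Continuous.aestronglyMeasurable (by fun_prop))]
  have h := integral_fintype_prod_eq_prod (𝕜 := ℝ) (ι := Fin m) (E := fun _ => ℝ)
    (μ := fun _ => gaussianReal 0 1) (fun i t => t ^ k i)
  refine h.trans (Finset.prod_congr rfl fun i _ => integral_pow_gaussianReal_of_le (hk i))

lemma integral_mul_stdGaussian (a b : Fin m) :
    ∫ z, z a * z b ∂(stdGaussian (EuclideanSpace ℝ (Fin m))) = if a = b then 1 else 0 := by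
  -- The exponent at `i` counts how often `i` occurs among the given indices, so a monomial becomes
  -- a product over all coordinates.
  have h := integral_prod_pow_stdGaussian
    (fun i : Fin m => (if i = a then 1 else 0) + (if i = b then 1 else 0))
    (fun i => by split_ifs <;> norm_num)
  simp only [pow_add, Finset.prod_mul_distrib, pow_ite, pow_one, pow_zero,
    Finset.prod_ite_eq', Finset.mem_univ, if_true] at h
  rw [h]
  by_cases hab : a = b
  · subst hab
    rw [if_pos rfl]
    refine Finset.prod_eq_one fun i _ => ?_
    by_cases hi : i = a <;> simp [hi, stdMoment]
  · rw [if_neg hab]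
    exact Finset.prod_eq_zero (Finset.mem_univ a) (by simp [hab, stdMoment])

/-- The Isserlis formula for the fourth moments of the standard Gaussian measure. -/
lemma integral_mul_mul_mul_stdGaussian (a b c e : Fin m) :
    ∫ z, z a * z b * (z c * z e) ∂(stdGaussian (EuclideanSpace ℝ (Fin m))) =
      (if a = b then 1 else 0) * (if c = e then 1 else 0)
      + (if a = c then 1 else 0) * (if b = e then 1 else 0)
      + (if a = e then 1 else 0) * (if b = c then 1 else 0) := by
  have h := integral_prod_pow_stdGaussian
    (fun i : Fin m => (if i = a then 1 else 0) + (if i = b then 1 else 0) +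
      ((if i = c then 1 else 0) + (if i = e then 1 else 0)))
    (fun i => by split_ifs <;> norm_num)
  simp only [pow_add, Finset.prod_mul_distrib, pow_ite, pow_one, pow_zero,
    Finset.prod_ite_eq', Finset.mem_univ, if_true] at h
  rw [h]
  have pairs : ∀ {x y : Fin m}, x ≠ y → ∏ i, stdMoment ((if i = x then 2 else 0) +
      (if i = y then 2 else 0)) = 1 := fun {x y} hxy => by
    refine Finset.prod_eq_one fun i _ => ?_
    by_cases h1 : i = x
    · subst h1; simp [hxy, stdMoment]
    · by_cases h2 : i = y <;> simp [h1, h2, stdMoment, hxy.symm]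
  have odd : ∀ (f : Fin m → ℕ) (x : Fin m), stdMoment (f x) = 0 → ∏ i, stdMoment (f i) = 0 :=
    fun f x hx => Finset.prod_eq_zero (Finset.mem_univ x) hx
  -- Either some index occurs an odd number of times and its factor vanishes, or the indices form
  -- two distinct pairs (moment 1), or all four agree (moment 3).
  by_cases hab : a = b
  · subst hab
    by_cases hce : c = e
    · subst hce
      by_cases hac : a = c
      · subst hac
        have : ∏ i, stdMoment ((if i = a then 1 else 0) + (if i = a then 1 else 0) +
            ((if i = a then 1 else 0) + (if i = a then 1 else 0))) = 3 := by
          rw [Finset.prod_eq_single a]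
          · simp [stdMoment]
          · intro i _ hi; simp [hi, stdMoment]
          · simp
        rw [this]; norm_num
      · simp only [hac, if_false, if_true]
        norm_num
        rw [← pairs hac]
        refine Finset.prod_congr rfl fun i _ => ?_
        split_ifs <;> rfl
    · by_cases hac : a = c
      · subst hac
        rw [odd _ e (by simp [Ne.symm hce, stdMoment])]
        simp [hce]
      · rw [odd _ c (by simp [hce, Ne.symm hac, stdMoment])]
        simp [hce, hac]
  · by_cases hac : a = c
    · subst hac
      by_cases hbe : b = e
      · subst hbe
        simp only [hab, if_false, if_true, Ne.symm hab]
        norm_num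
        rw [← pairs hab]
        refine Finset.prod_congr rfl fun i _ => ?_
        split_ifs <;> rfl
      · rw [odd _ b (by simp [hbe, Ne.symm hab, stdMoment])]
        simp [hbe, hab, Ne.symm hab]
    · by_cases hae : a = e
      · subst hae
        by_cases hbc : b = c
        · subst hbc
          simp only [hab, if_false, if_true, Ne.symm hab]
          norm_num
          rw [← pairs hab]
          refine Finset.prod_congr rfl fun i _ => ?_
          split_ifs <;> rfl
        · rw [odd _ b (by simp [hbc, Ne.symm hab, stdMoment])]
          simp [hbc, hab, hac]
      · rw [odd _ a (by simp [hab, hac, hae, stdMoment])]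
        simp [hab, hac, hae]

/-- Odd functions integrate to zero with respect to the standard Gaussian measure. -/
lemma integral_stdGaussian_eq_zero_of_odd {f : EuclideanSpace ℝ (Fin m) → ℝ}
    (hf : Continuous f) (hodd : ∀ z, f (-z) = -f z) :
    ∫ z, f z ∂(stdGaussian (EuclideanSpace ℝ (Fin m))) = 0 := by
  have h1 : ∫ z, f z ∂(stdGaussian (EuclideanSpace ℝ (Fin m))) =
      ∫ z, f (-z) ∂(stdGaussian (EuclideanSpace ℝ (Fin m))) := by
    conv_lhs => rw [← stdGaussian_map (LinearIsometryEquiv.neg ℝ (E := EuclideanSpace ℝ (Fin m)))]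
    rw [integral_map (by fun_prop) hf.aestronglyMeasurable]
    rfl
  simp_rw [hodd] at h1
  rw [integral_neg] at h1
  linarith

lemma abs_coord_le (z : EuclideanSpace ℝ (Fin m)) (a : Fin m) : |z a| ≤ ‖z‖ := by
  simpa using PiLp.norm_apply_le z a

lemma integrable_coord_mul (μ : Measure (EuclideanSpace ℝ (Fin m))) [IsGaussian μ]
    (a b : Fin m) : Integrable (fun z => z a * z b) μ := by
  refine integrable_of_norm_le_pow μ (Continuous.aestronglyMeasurable (by fun_prop)) 1 1
    fun y => ?_
  rw [Real.norm_eq_abs, abs_mul]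
  have h1 := abs_coord_le y a
  have h2 := abs_coord_le y b
  nlinarith [abs_nonneg (y a), abs_nonneg (y b), norm_nonneg y]

lemma integrable_coord_mul_mul_mul (μ : Measure (EuclideanSpace ℝ (Fin m))) [IsGaussian μ]
    (a b c e : Fin m) : Integrable (fun z => z a * z b * (z c * z e)) μ := by
  refine integrable_of_norm_le_pow μ (Continuous.aestronglyMeasurable (by fun_prop)) 1 2
    fun y => ?_
  rw [Real.norm_eq_abs, abs_mul, abs_mul, abs_mul]
  have h : ∀ i j, |y i| * |y j| ≤ 1 + ‖y‖ ^ 2 := fun i j => by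
    have h1 := abs_coord_le y i
    have h2 := abs_coord_le y j
    nlinarith [abs_nonneg (y i), abs_nonneg (y j), norm_nonneg y]
  rw [one_mul, sq (1 + ‖y‖ ^ 2)]
  exact mul_le_mul (h a b) (h c e) (by positivity) (by positivity)

lemma dotProduct_mulVec_eq_sum (B : Matrix (Fin m) (Fin m) ℝ) (z : Fin m → ℝ) :
    z ⬝ᵥ B *ᵥ z = ∑ a, ∑ b, B a b * (z a * z b) := by
  simp only [dotProduct, Matrix.mulVec, Finset.mul_sum]
  exact Finset.sum_congr rfl fun a _ => Finset.sum_congr rfl fun b _ => by ring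

lemma integrable_quadForm (μ : Measure (EuclideanSpace ℝ (Fin m))) [IsGaussian μ]
    (B : Matrix (Fin m) (Fin m) ℝ) : Integrable (fun z => z.ofLp ⬝ᵥ B *ᵥ z.ofLp) μ := by
  simp_rw [dotProduct_mulVec_eq_sum]
  exact integrable_finsetSum _ fun a _ => integrable_finsetSum _ fun b _ =>
    (integrable_coord_mul μ a b).const_mul _

lemma quadForm_mul_quadForm (B C : Matrix (Fin m) (Fin m) ℝ) (z : Fin m → ℝ) :
    (z ⬝ᵥ B *ᵥ z) * (z ⬝ᵥ C *ᵥ z) =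
      ∑ a, ∑ b, ∑ c, ∑ e, B a b * C c e * (z a * z b * (z c * z e)) := by
  simp_rw [dotProduct_mulVec_eq_sum, Finset.sum_mul, Finset.mul_sum]
  exact Finset.sum_congr rfl fun a _ => Finset.sum_congr rfl fun b _ =>
    Finset.sum_congr rfl fun c _ => Finset.sum_congr rfl fun e _ => by ring

lemma integrable_quadForm_mul_quadForm (μ : Measure (EuclideanSpace ℝ (Fin m))) [IsGaussian μ]
    (B C : Matrix (Fin m) (Fin m) ℝ) :
    Integrable (fun z => (z.ofLp ⬝ᵥ B *ᵥ z.ofLp) * (z.ofLp ⬝ᵥ C *ᵥ z.ofLp)) μ := by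
  simp_rw [quadForm_mul_quadForm]
  exact integrable_finsetSum _ fun a _ => integrable_finsetSum _ fun b _ =>
    integrable_finsetSum _ fun c _ => integrable_finsetSum _ fun e _ =>
      (integrable_coord_mul_mul_mul μ a b c e).const_mul _

lemma integral_quadForm_stdGaussian (B : Matrix (Fin m) (Fin m) ℝ) :
    ∫ z, z.ofLp ⬝ᵥ B *ᵥ z.ofLp ∂(stdGaussian (EuclideanSpace ℝ (Fin m))) = B.trace := by
  have h2 := fun a b : Fin m =>
    (integrable_coord_mul (stdGaussian (EuclideanSpace ℝ (Fin m))) a b).const_mul (B a b)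
  simp_rw [dotProduct_mulVec_eq_sum]
  rw [integral_finsetSum _ fun a _ => integrable_finsetSum _ fun b _ => h2 a b]
  refine Finset.sum_congr rfl fun a _ => ?_
  rw [integral_finsetSum _ fun b _ => h2 a b]
  simp_rw [integral_const_mul, integral_mul_stdGaussian]
  simp

/-- Of the three pairings in Isserlis' formula, one keeps each form to itself and gives the product
of traces; the two crossed ones give tr(B Cᵀ) and tr(B C), which agree for symmetric `C`. -/
lemma integral_quadForm_mul_quadForm_stdGaussian (B C : Matrix (Fin m) (Fin m) ℝ) (hC : Cᵀ = C) :
    ∫ z, (z.ofLp ⬝ᵥ B *ᵥ z.ofLp) * (z.ofLp ⬝ᵥ C *ᵥ z.ofLp)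
      ∂(stdGaussian (EuclideanSpace ℝ (Fin m))) = B.trace * C.trace + 2 * (B * C).trace := by
  simp_rw [quadForm_mul_quadForm]
  have h4 := fun a b c e : Fin m =>
    (integrable_coord_mul_mul_mul (stdGaussian (EuclideanSpace ℝ (Fin m))) a b c e).const_mul
      (B a b * C c e)
  rw [integral_finsetSum _ fun a _ => integrable_finsetSum _ fun b _ =>
    integrable_finsetSum _ fun c _ => integrable_finsetSum _ fun e _ => h4 a b c e]
  have key : ∀ a, ∫ z, ∑ b, ∑ c, ∑ e, B a b * C c e * (z a * z b * (z c * z e))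
      ∂(stdGaussian (EuclideanSpace ℝ (Fin m))) =
      B a a * C.trace + 2 * ∑ b, B a b * C b a := fun a => by
    rw [integral_finsetSum _ fun b _ =>
      integrable_finsetSum _ fun c _ => integrable_finsetSum _ fun e _ => h4 a b c e]
    have hb : ∀ b, ∫ z, ∑ c, ∑ e, B a b * C c e * (z a * z b * (z c * z e))
        ∂(stdGaussian (EuclideanSpace ℝ (Fin m))) =
        (if a = b then B a b * C.trace else 0) + 2 * (B a b * C b a) := fun b => by
      rw [integral_finsetSum _ fun c _ => integrable_finsetSum _ fun e _ => h4 a b c e]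
      have hc : ∀ c, ∫ z, ∑ e, B a b * C c e * (z a * z b * (z c * z e))
          ∂(stdGaussian (EuclideanSpace ℝ (Fin m))) =
          (if a = b then B a b * C c c else 0) + (if a = c then B a b * C c b else 0) +
            (if b = c then B a b * C c a else 0) := fun c => by
        rw [integral_finsetSum _ fun e _ => h4 a b c e]
        simp_rw [integral_const_mul, integral_mul_mul_mul_stdGaussian, mul_add,
          Finset.sum_add_distrib]
        simp
      simp_rw [hc, Finset.sum_add_distrib]
      have hs : C a b = C b a := by conv_lhs => rw [← hC, Matrix.transpose_apply]
      split_ifs with hab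
      · simp [Matrix.trace, Finset.mul_sum, hs]; ring
      · simp [hs]; ring
    simp_rw [hb, Finset.sum_add_distrib, ← Finset.mul_sum]
    simp
  simp_rw [key, Finset.sum_add_distrib, ← Finset.sum_mul, ← Finset.mul_sum]
  simp [Matrix.trace, Matrix.mul_apply]

lemma integrable_coord (μ : Measure (EuclideanSpace ℝ (Fin m))) [IsGaussian μ]
    (b : Fin m → ℝ) : Integrable (fun z => b ⬝ᵥ z.ofLp) μ := by
  refine integrable_finsetSum _ fun a _ => Integrable.const_mul ?_ _
  refine integrable_of_norm_le_pow μ (Continuous.aestronglyMeasurable (by fun_prop)) 1 1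
    fun y => ?_
  have h1 := abs_coord_le y a
  rw [Real.norm_eq_abs]
  nlinarith [sq_nonneg (‖y‖ - 1)]

lemma dotProduct_mul_dotProduct (b b' z : Fin m → ℝ) :
    (b ⬝ᵥ z) * (b' ⬝ᵥ z) = z ⬝ᵥ (Matrix.vecMulVec b b') *ᵥ z := by
  rw [Matrix.vecMulVec_mulVec, dotProduct_smul, dotProduct_comm z b]
  simp

/-- The mean of a quadratic polynomial under the standard Gaussian measure. -/
lemma integral_quadPoly_stdGaussian (c : ℝ) (b : Fin m → ℝ) (B : Matrix (Fin m) (Fin m) ℝ) :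
    ∫ z, (c + b ⬝ᵥ z.ofLp + z.ofLp ⬝ᵥ B *ᵥ z.ofLp)
      ∂(stdGaussian (EuclideanSpace ℝ (Fin m))) = c + B.trace := by
  have hodd : ∫ z, b ⬝ᵥ z.ofLp ∂(stdGaussian (EuclideanSpace ℝ (Fin m))) = 0 :=
    integral_stdGaussian_eq_zero_of_odd (by unfold dotProduct; fun_prop) fun z => by simp
  rw [integral_add ((integrable_const c).fun_add (integrable_coord _ b)) (integrable_quadForm _ B),
    integral_add (integrable_const c) (integrable_coord _ b), hodd,
    integral_quadForm_stdGaussian]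
  simp

/-- The mean of a product of quadratic polynomials under the standard Gaussian measure. -/
lemma integral_quadPoly_mul_quadPoly_stdGaussian (c c' : ℝ) (b b' : Fin m → ℝ)
    (B C : Matrix (Fin m) (Fin m) ℝ) (hC : Cᵀ = C) :
    ∫ z, (c + b ⬝ᵥ z.ofLp + z.ofLp ⬝ᵥ B *ᵥ z.ofLp) * (c' + b' ⬝ᵥ z.ofLp + z.ofLp ⬝ᵥ C *ᵥ z.ofLp)
      ∂(stdGaussian (EuclideanSpace ℝ (Fin m))) =
      c * c' + c * C.trace + c' * B.trace + b ⬝ᵥ b' + B.trace * C.trace + 2 * (B * C).trace := by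
  set γ := stdGaussian (EuclideanSpace ℝ (Fin m)) with hγ
  -- `f` collects the terms of degree at most two, with constant term `c` in place of `c * c'`; the
  -- difference is restored in `hexp`. The cubic terms form the odd function `o`.
  set f : EuclideanSpace ℝ (Fin m) → ℝ := fun z =>
    (c + (c' • b + c • b') ⬝ᵥ z.ofLp + z.ofLp ⬝ᵥ (c • C + c' • B + Matrix.vecMulVec b b') *ᵥ z.ofLp)
  have hf : Integrable f γ :=
    ((integrable_const c).add (integrable_coord _ _)).add (integrable_quadForm _ _)
  set o : EuclideanSpace ℝ (Fin m) → ℝ := fun z =>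
    (b ⬝ᵥ z.ofLp) * (z.ofLp ⬝ᵥ C *ᵥ z.ofLp) + (b' ⬝ᵥ z.ofLp) * (z.ofLp ⬝ᵥ B *ᵥ z.ofLp)
  have hoc : Continuous o := by
    simp only [o, dotProduct, Matrix.mulVec]; fun_prop
  have ho0 : ∫ z, o z ∂γ = 0 := integral_stdGaussian_eq_zero_of_odd hoc fun z => by
    simp [o, Matrix.mulVec_neg]; ring
  have hBC := integrable_quadForm_mul_quadForm γ B C
  have ho : Integrable o γ := by
    have hlin : ∀ (b : Fin m → ℝ) (C : Matrix (Fin m) (Fin m) ℝ),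
        Integrable (fun z => (b ⬝ᵥ z.ofLp) * (z.ofLp ⬝ᵥ C *ᵥ z.ofLp)) γ := fun b C => by
      have h1 : Integrable (fun z => (b ⬝ᵥ z.ofLp) * (b ⬝ᵥ z.ofLp)
          + (z.ofLp ⬝ᵥ C *ᵥ z.ofLp) * (z.ofLp ⬝ᵥ C *ᵥ z.ofLp)) γ := by
        simp_rw [dotProduct_mul_dotProduct b b]
        exact (integrable_quadForm _ _).add (integrable_quadForm_mul_quadForm γ C C)
      refine h1.mono' (Continuous.aestronglyMeasurable (by
        simp only [dotProduct, Matrix.mulVec]; fun_prop)) (Eventually.of_forall fun z => ?_)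
      rw [Real.norm_eq_abs, abs_mul]
      nlinarith [sq_nonneg (|b ⬝ᵥ z.ofLp| - |z.ofLp ⬝ᵥ C *ᵥ z.ofLp|),
        sq_abs (b ⬝ᵥ z.ofLp), sq_abs (z.ofLp ⬝ᵥ C *ᵥ z.ofLp), abs_nonneg (b ⬝ᵥ z.ofLp),
        abs_nonneg (z.ofLp ⬝ᵥ C *ᵥ z.ofLp)]
    exact (hlin b C).add (hlin b' B)
  have hexp : ∀ z : EuclideanSpace ℝ (Fin m),
      (c + b ⬝ᵥ z.ofLp + z.ofLp ⬝ᵥ B *ᵥ z.ofLp) * (c' + b' ⬝ᵥ z.ofLp + z.ofLp ⬝ᵥ C *ᵥ z.ofLp) =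
      (f z + (z.ofLp ⬝ᵥ B *ᵥ z.ofLp) * (z.ofLp ⬝ᵥ C *ᵥ z.ofLp) + o z) + (c * c' - c) := fun z => by
    simp only [f, o, Matrix.add_mulVec, Matrix.smul_mulVec, dotProduct_add, add_dotProduct,
      smul_dotProduct, dotProduct_smul, smul_eq_mul, ← dotProduct_mul_dotProduct]
    ring
  simp_rw [hexp]
  rw [integral_add ((hf.fun_add hBC).fun_add ho) (integrable_const _),
    integral_add (hf.fun_add hBC) ho,
    integral_add hf hBC, ho0, integral_quadForm_mul_quadForm_stdGaussian B C hC]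
  simp only [f]
  rw [integral_quadPoly_stdGaussian]
  simp [Matrix.trace_add, Matrix.trace_smul, Matrix.trace_vecMulVec]
  ring

/-- Substituting y = ν + R z sends the coefficients `b`, `B` to `R b`, `R B R`. The outer function
`F` lets one substitution serve both a single polynomial and a product of two. -/
lemma integral_quadPoly_comp {S R : Matrix (Fin m) (Fin m) ℝ} {ν : EuclideanSpace ℝ (Fin m)}
    (hR : Rᵀ = R) (hmap : multivariateGaussian ν S =
      (stdGaussian (EuclideanSpace ℝ (Fin m))).map
        (fun x => ν + Matrix.toEuclideanCLM (𝕜 := ℝ) R x)) (F : ℝ → ℝ → ℝ) (hF : Continuous fun p : ℝ × ℝ => F p.1 p.2)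
    (c c' : ℝ) (b b' : Fin m → ℝ) (B C : Matrix (Fin m) (Fin m) ℝ) :
    ∫ y, F (c + b ⬝ᵥ (y - ν).ofLp + (y - ν).ofLp ⬝ᵥ B *ᵥ (y - ν).ofLp)
        (c' + b' ⬝ᵥ (y - ν).ofLp + (y - ν).ofLp ⬝ᵥ C *ᵥ (y - ν).ofLp)
      ∂(multivariateGaussian ν S) =
    ∫ z, F (c + (R *ᵥ b) ⬝ᵥ z.ofLp + z.ofLp ⬝ᵥ (R * B * R) *ᵥ z.ofLp)
        (c' + (R *ᵥ b') ⬝ᵥ z.ofLp + z.ofLp ⬝ᵥ (R * C * R) *ᵥ z.ofLp)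
      ∂(stdGaussian (EuclideanSpace ℝ (Fin m))) := by
  have h1 : ∀ (b z : Fin m → ℝ), b ⬝ᵥ (R *ᵥ z) = (R *ᵥ b) ⬝ᵥ z := fun b z => by
    rw [Matrix.dotProduct_mulVec, ← Matrix.mulVec_transpose, hR]
  have h2 : ∀ (B : Matrix (Fin m) (Fin m) ℝ) (z : Fin m → ℝ),
      (R *ᵥ z) ⬝ᵥ B *ᵥ (R *ᵥ z) = z ⬝ᵥ (R * B * R) *ᵥ z := fun B z => by
    rw [← h1, Matrix.mulVec_mulVec, Matrix.mulVec_mulVec, Matrix.mul_assoc]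
  rw [hmap, integral_map (by fun_prop) (Continuous.aestronglyMeasurable (by
    simp only [dotProduct, Matrix.mulVec]
    refine hF.comp (f := fun y => (_, _)) ?_
    fun_prop))]
  simp only [add_sub_cancel_left, Matrix.ofLp_toEuclideanCLM, h1, h2]

/-- The mean of a quadratic polynomial under a Gaussian measure. -/
lemma integral_quadPoly_multivariateGaussian {S : Matrix (Fin m) (Fin m) ℝ} (hS : S.PosDef)
    (ν : EuclideanSpace ℝ (Fin m)) (c : ℝ) (b : Fin m → ℝ) (B : Matrix (Fin m) (Fin m) ℝ) :
    ∫ y, (c + b ⬝ᵥ (y - ν).ofLp + (y - ν).ofLp ⬝ᵥ B *ᵥ (y - ν).ofLp)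
      ∂(multivariateGaussian ν S) = c + (B * S).trace := by
  obtain ⟨R, hR, hRR, -, hmap⟩ := exists_sqrt_multivariateGaussian hS ν
  rw [integral_quadPoly_comp hR hmap (fun x _ => x) (by fun_prop) c c b b B B,
    integral_quadPoly_stdGaussian, Matrix.mul_assoc, Matrix.trace_mul_comm, Matrix.mul_assoc, hRR]

/-- The mean of a product of quadratic polynomials under a Gaussian measure. -/
lemma integral_quadPoly_mul_quadPoly_multivariateGaussian {S : Matrix (Fin m) (Fin m) ℝ}
    (hS : S.PosDef) (ν : EuclideanSpace ℝ (Fin m)) (c c' : ℝ) (b b' : Fin m → ℝ)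
    (B C : Matrix (Fin m) (Fin m) ℝ) (hC : Cᵀ = C) :
    ∫ y, (c + b ⬝ᵥ (y - ν).ofLp + (y - ν).ofLp ⬝ᵥ B *ᵥ (y - ν).ofLp) *
        (c' + b' ⬝ᵥ (y - ν).ofLp + (y - ν).ofLp ⬝ᵥ C *ᵥ (y - ν).ofLp)
      ∂(multivariateGaussian ν S) =
      c * c' + c * (C * S).trace + c' * (B * S).trace + b ⬝ᵥ S *ᵥ b' +
        (B * S).trace * (C * S).trace + 2 * (B * S * (C * S)).trace := by
  obtain ⟨R, hR, hRR, -, hmap⟩ := exists_sqrt_multivariateGaussian hS ν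
  have ht : ∀ B : Matrix (Fin m) (Fin m) ℝ, (R * B * R).trace = (B * S).trace := fun B => by
    rw [Matrix.mul_assoc, Matrix.trace_mul_comm, Matrix.mul_assoc, hRR]
  have ht2 : (R * B * R * (R * C * R)).trace = (B * S * (C * S)).trace := by
    have : R * B * R * (R * C * R) = R * (B * S * C) * R := by
      rw [← hRR]; simp only [Matrix.mul_assoc]
    rw [this, ht]; simp only [Matrix.mul_assoc]
  have hb : (R *ᵥ b) ⬝ᵥ (R *ᵥ b') = b ⬝ᵥ S *ᵥ b' := by
    rw [Matrix.dotProduct_mulVec, ← Matrix.mulVec_transpose, hR, Matrix.mulVec_mulVec, hRR,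
      dotProduct_comm, Matrix.dotProduct_mulVec, ← Matrix.mulVec_transpose,
      show Sᵀ = S by rw [← hRR, Matrix.transpose_mul, hR], dotProduct_comm]
  rw [integral_quadPoly_comp hR hmap (fun x y => x * y) (by fun_prop) c c' b b' B C,
    integral_quadPoly_mul_quadPoly_stdGaussian, ht, ht, ht2, hb]
  rw [Matrix.transpose_mul, Matrix.transpose_mul, hR, hC, Matrix.mul_assoc]

end Moments

/-! ### Differentiation of the partition function under the integral -/

section ExponentialFamily

lemma continuous_smulRight_self {H V : Type*} [TopologicalSpace H] [NormedAddCommGroup V]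
    [NormedSpace ℝ V] [FiniteDimensional ℝ V] {T : H → V →L[ℝ] ℝ} (hT : Continuous T) :
    Continuous fun y => (T y).smulRight (T y) := by
  refine continuous_clm_apply.2 fun v => ?_
  simp only [ContinuousLinearMap.smulRight_apply]
  exact (hT.clm_apply continuous_const).smul hT

lemma norm_smul_smulRight_self_le {V : Type*} [NormedAddCommGroup V] [NormedSpace ℝ V] (c : ℝ)
    (l : V →L[ℝ] ℝ) : ‖c • l.smulRight l‖ ≤ |c| * ‖l‖ ^ 2 := by
  refine ContinuousLinearMap.opNorm_le_bound _ (by positivity) fun v => ?_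
  rw [smul_apply, ContinuousLinearMap.smulRight_apply, norm_smul, norm_smul, Real.norm_eq_abs, sq]
  have := l.le_opNorm v
  calc |c| * (‖l v‖ * ‖l‖) ≤ |c| * (‖l‖ * ‖v‖ * ‖l‖) := by gcongr
    _ = _ := by ring

variable {H V : Type*} [NormedAddCommGroup H] [MeasurableSpace H] [BorelSpace H]
  [NormedAddCommGroup V] [NormedSpace ℝ V] [FiniteDimensional ℝ V]

/-- The partition function `∫ exp (s ⟨T y, v⟩) dy`. -/
def part (μ : Measure H) (s : ℝ) (T : H → V →L[ℝ] ℝ) (v : V) : ℝ :=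
  ∫ y, Real.exp (s * T y v) ∂μ

/-- The first moment `∫ exp (s ⟨T y, v⟩) T y dy` of the sufficient statistic. -/
def partGrad (μ : Measure H) (s : ℝ) (T : H → V →L[ℝ] ℝ) (v : V) : V →L[ℝ] ℝ :=
  ∫ y, Real.exp (s * T y v) • T y ∂μ

/-- The second moment `s ∫ exp (s ⟨T y, v⟩) T y ⊗ T y dy` of the sufficient statistic. -/
def partHess (μ : Measure H) (s : ℝ) (T : H → V →L[ℝ] ℝ) (v : V) : V →L[ℝ] V →L[ℝ] ℝ :=
  ∫ y, (s * Real.exp (s * T y v)) • (T y).smulRight (T y) ∂μ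

/-- Differentiability, twice, of the partition function of an exponential family. -/
lemma exists_hasFDerivAt_part {μ : Measure H} {s : ℝ} (hs : 0 < s) {T : H → V →L[ℝ] ℝ}
    (hT : Continuous T) {v₀ : V} {ε : ℝ} (hε : 0 < ε)
    (hint : Integrable (fun y => Real.exp (s * T y v₀ + ε * ‖T y‖)) μ) :
    ∃ δ > 0, ∀ v ∈ Metric.ball v₀ δ, HasFDerivAt (part μ s T) (s • partGrad μ s T v) v ∧
      HasFDerivAt (partGrad μ s T) (partHess μ s T v) v ∧ ContinuousAt (partHess μ s T) v := by
  set K : ℝ := 1 + 2 / ε + 16 / ε ^ 2 with hK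
  have hK0 : 0 < K := by positivity
  set bd : H → ℝ := fun y => K * Real.exp (s * T y v₀ + ε * ‖T y‖) with hbd
  have hbdint : Integrable bd μ := hint.const_mul _
  have hexpc : ∀ v, Continuous fun y => Real.exp (s * T y v) := fun v => by
    have := hT.clm_apply (continuous_const (y := v))
    fun_prop
  have hTT := continuous_smulRight_self hT
  have hpow : ∀ x : ℝ, 0 ≤ x → ∀ k : ℕ, k ≤ 2 → x ^ k * Real.exp (ε / 2 * x) ≤
      K * Real.exp (ε * x) := fun x hx k hk => by
    have e1 : Real.exp (ε * x) = Real.exp (ε / 2 * x) * Real.exp (ε / 2 * x) := by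
      rw [← Real.exp_add]; ring_nf
    have e2 : Real.exp (ε / 2 * x) = Real.exp (ε / 4 * x) * Real.exp (ε / 4 * x) := by
      rw [← Real.exp_add]; ring_nf
    rw [e1, ← mul_assoc]
    refine mul_le_mul_of_nonneg_right ?_ (Real.exp_pos _).le
    have h1 : 1 ≤ Real.exp (ε / 2 * x) := Real.one_le_exp (by positivity)
    have h2 : ε / 2 * x ≤ Real.exp (ε / 2 * x) := by linarith [Real.add_one_le_exp (ε / 2 * x)]
    have h3 : ε / 4 * x ≤ Real.exp (ε / 4 * x) := by linarith [Real.add_one_le_exp (ε / 4 * x)]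
    have h4 : (ε / 4 * x) * (ε / 4 * x) ≤ Real.exp (ε / 2 * x) := by
      rw [e2]; exact mul_le_mul h3 h3 (by positivity) (Real.exp_pos _).le
    have h5 : x ≤ 2 / ε * Real.exp (ε / 2 * x) := by
      have : 2 / ε * (ε / 2 * x) = x := by field_simp
      calc x = 2 / ε * (ε / 2 * x) := this.symm
        _ ≤ _ := by gcongr
    have h6 : x ^ 2 ≤ 16 / ε ^ 2 * Real.exp (ε / 2 * x) := by
      have : 16 / ε ^ 2 * ((ε / 4 * x) * (ε / 4 * x)) = x ^ 2 := by field_simp; norm_num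
      calc x ^ 2 = 16 / ε ^ 2 * ((ε / 4 * x) * (ε / 4 * x)) := this.symm
        _ ≤ _ := by gcongr
    have h7 : 0 ≤ 2 / ε * Real.exp (ε / 2 * x) := by positivity
    have h8 : 0 ≤ 16 / ε ^ 2 * Real.exp (ε / 2 * x) := by positivity
    rw [hK]
    obtain rfl | rfl | rfl : k = 0 ∨ k = 1 ∨ k = 2 := by omega
    · rw [pow_zero]; linarith
    · rw [pow_one]; linarith
    · linarith
  -- The other half of the margin pays for moving `v`: within radius ε/(2s) the exponent changes by
  -- at most (ε/2) ‖T y‖.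
  have hmain : ∀ v ∈ Metric.ball v₀ (ε / (2 * s)), ∀ y, ∀ k : ℕ, k ≤ 2 →
      Real.exp (s * T y v) * ‖T y‖ ^ k ≤ bd y := fun v hv y k hk => by
    have h1 : s * T y v ≤ s * T y v₀ + ε / 2 * ‖T y‖ := by
      have h2 : T y (v - v₀) ≤ ‖T y‖ * ‖v - v₀‖ := (le_abs_self _).trans ((T y).le_opNorm _)
      have h3 : ‖v - v₀‖ ≤ ε / (2 * s) := by rw [← dist_eq_norm]; exact (Metric.mem_ball.1 hv).le
      have h4 : s * (‖T y‖ * ‖v - v₀‖) ≤ s * (‖T y‖ * (ε / (2 * s))) := by gcongr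
      have h5 : s * (‖T y‖ * (ε / (2 * s))) = ε / 2 * ‖T y‖ := by field_simp
      rw [map_sub] at h2
      nlinarith
    calc Real.exp (s * T y v) * ‖T y‖ ^ k
        ≤ Real.exp (s * T y v₀ + ε / 2 * ‖T y‖) * ‖T y‖ ^ k := by gcongr
      _ = Real.exp (s * T y v₀) * (‖T y‖ ^ k * Real.exp (ε / 2 * ‖T y‖)) := by
          rw [Real.exp_add]; ring
      _ ≤ Real.exp (s * T y v₀) * (K * Real.exp (ε * ‖T y‖)) := by
          exact mul_le_mul_of_nonneg_left (hpow _ (norm_nonneg _) k hk) (Real.exp_pos _).le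
      _ = bd y := by rw [hbd]; simp only [Real.exp_add]; ring
  have hhess : ∀ x ∈ Metric.ball v₀ (ε / (2 * s)), ∀ y,
      ‖(s * Real.exp (s * T y x)) • (T y).smulRight (T y)‖ ≤ s * bd y := fun x hx y => by
    have := hmain x hx y 2 le_rfl
    refine (norm_smul_smulRight_self_le _ _).trans ?_
    rw [abs_of_pos (by positivity), mul_assoc]
    exact mul_le_mul_of_nonneg_left this hs.le
  have hderiv : ∀ y v, HasFDerivAt (fun v => Real.exp (s * T y v))
      (Real.exp (s * T y v) • s • T y) v := fun y v =>
    ((T y).hasFDerivAt.const_mul s).exp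
  refine ⟨ε / (2 * s), by positivity, fun v hv => ?_⟩
  have hnhds : Metric.ball v₀ (ε / (2 * s)) ∈ 𝓝 v := Metric.isOpen_ball.mem_nhds hv
  refine ⟨?_, ?_, ?_⟩
  · have := hasFDerivAt_integral_of_dominated_of_fderiv_le (μ := μ) (𝕜 := ℝ)
      (F := fun v y => Real.exp (s * T y v)) (F' := fun v y => Real.exp (s * T y v) • s • T y)
      (bound := fun y => s * bd y) hnhds
      (Eventually.of_forall fun v => (hexpc v).aestronglyMeasurable)
      (hbdint.mono' (hexpc v).aestronglyMeasurable (Eventually.of_forall fun y => by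
        have := hmain v hv y 0 (by norm_num)
        rw [Real.norm_of_nonneg (Real.exp_pos _).le]; simpa using this))
      ((hexpc v).smul (hT.const_smul s)).aestronglyMeasurable
      (Eventually.of_forall fun y x hx => by
        have := hmain x hx y 1 (by norm_num)
        rw [norm_smul, norm_smul, Real.norm_of_nonneg (Real.exp_pos _).le,
          Real.norm_of_nonneg hs.le]
        rw [pow_one] at this
        nlinarith)
      (hbdint.const_mul s) (Eventually.of_forall fun y x _ => hderiv y x)
    have e : s • partGrad μ s T v = ∫ y, Real.exp (s * T y v) • s • T y ∂μ := by
      rw [partGrad, ← integral_smul]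
      exact integral_congr_ae (Eventually.of_forall fun y => smul_comm _ _ _)
    rw [e]; exact this
  · have hd : ∀ y x, HasFDerivAt (fun v => Real.exp (s * T y v) • T y)
        ((s * Real.exp (s * T y x)) • (T y).smulRight (T y)) x := fun y x => by
      have := (hderiv y x).smul_const (T y)
      convert! this using 1
      ext a b
      simp [mul_comm, mul_assoc, mul_left_comm]
    exact hasFDerivAt_integral_of_dominated_of_fderiv_le (μ := μ) (𝕜 := ℝ)
      (F := fun v y => Real.exp (s * T y v) • T y)
      (F' := fun v y => (s * Real.exp (s * T y v)) • (T y).smulRight (T y))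
      (bound := fun y => s * bd y) hnhds
      (Eventually.of_forall fun v => ((hexpc v).smul hT).aestronglyMeasurable)
      (hbdint.mono' ((hexpc v).smul hT).aestronglyMeasurable (Eventually.of_forall fun y => by
        have := hmain v hv y 1 (by norm_num)
        rw [norm_smul, Real.norm_of_nonneg (Real.exp_pos _).le]; simpa using this))
      ((continuous_const.mul (hexpc v)).smul hTT).aestronglyMeasurable
      (Eventually.of_forall fun y x hx => hhess x hx y)
      (hbdint.const_mul s) (Eventually.of_forall fun y x _ => hd y x)
  · refine continuousAt_of_dominated
      (F := fun v y => (s * Real.exp (s * T y v)) • (T y).smulRight (T y)) (bound := fun y => s * bd y)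
      (Eventually.of_forall fun v =>
        ((continuous_const.mul (hexpc v)).smul hTT).aestronglyMeasurable) ?_
      (hbdint.const_mul s) (Eventually.of_forall fun y => ?_)
    · filter_upwards [hnhds] with x hx
      refine Eventually.of_forall fun y => ?_
      exact hhess x hx y
    · have := (T y).continuous
      fun_prop

end ExponentialFamily

/-! ### Gradient and Hessian of the contribution of one observation -/

section Smooth

/-- The transformation `x ↦ (1 + 1/τ) exp (τ x) - 1/τ` of log-densities, which is the identity
for `τ = 0`. -/
def powLink (τ x : ℝ) : ℝ :=
  if τ = 0 then x else (1 + 1 / τ) * Real.exp (τ * x) - 1 / τ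

/-- The derivative needs no case distinction: from here on the likelihood case τ = 0 and the case τ
> 0 are differentiated together. -/
lemma hasDerivAt_powLink (τ x : ℝ) :
    HasDerivAt (powLink τ) ((1 + τ) * Real.exp (τ * x)) x := by
  by_cases h : τ = 0
  · subst h
    have : powLink 0 = id := by ext; simp [powLink]
    rw [this]
    simpa using hasDerivAt_id x
  · have : powLink τ = fun x => (1 + 1 / τ) * Real.exp (τ * x) - 1 / τ := by
      ext; simp [powLink, h]
    rw [this]
    have h1 : HasDerivAt (fun x => Real.exp (τ * x)) (Real.exp (τ * x) * τ) x := by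
      simpa using ((hasDerivAt_id x).const_mul τ).exp
    convert! (h1.const_mul (1 + 1 / τ)).sub_const (1 / τ) using 1
    field_simp
    ring

variable {m : ℕ} {E V : Type*} [NormedAddCommGroup E] [NormedSpace ℝ E]
  [NormedAddCommGroup V] [NormedSpace ℝ V]

/-- The contribution of one observation to the density power divergence objective. -/
def dpd (τ : ℝ) (T : EuclideanSpace ℝ (Fin m) → V →L[ℝ] ℝ) (η : E → V) (t : E)
    (y : EuclideanSpace ℝ (Fin m)) : ℝ :=
  powLink τ (T y (η t)) - part volume (1 + τ) T (η t)

/-- The gradient of `dpd`, up to the factor `1 + τ`, in the natural parameter. -/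
def natGrad (τ : ℝ) (T : EuclideanSpace ℝ (Fin m) → V →L[ℝ] ℝ) (v : V)
    (y : EuclideanSpace ℝ (Fin m)) : V →L[ℝ] ℝ :=
  Real.exp (τ * T y v) • T y - partGrad volume (1 + τ) T v

/-- The derivative of `natGrad`. -/
def natHess (τ : ℝ) (T : EuclideanSpace ℝ (Fin m) → V →L[ℝ] ℝ) (v : V)
    (y : EuclideanSpace ℝ (Fin m)) : V →L[ℝ] V →L[ℝ] ℝ :=
  (τ * Real.exp (τ * T y v)) • (T y).smulRight (T y) - partHess volume (1 + τ) T v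

/-- The gradient of `dpd`. -/
def dpdGrad (τ : ℝ) (T : EuclideanSpace ℝ (Fin m) → V →L[ℝ] ℝ) (η : E → V) (t : E)
    (y : EuclideanSpace ℝ (Fin m)) : E →L[ℝ] ℝ :=
  (1 + τ) • (natGrad τ T (η t) y).comp (fderiv ℝ η t)

/-- The second derivative of `dpd`. -/
def dpdHess (τ : ℝ) (T : EuclideanSpace ℝ (Fin m) → V →L[ℝ] ℝ) (η : E → V) (t : E)
    (y : EuclideanSpace ℝ (Fin m)) : E →L[ℝ] E →L[ℝ] ℝ :=
  (1 + τ) • ((ContinuousLinearMap.compL ℝ E V ℝ (natGrad τ T (η t) y)).comp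
      (fderiv ℝ (fderiv ℝ η) t) +
    ((ContinuousLinearMap.compL ℝ E V ℝ).flip (fderiv ℝ η t)).comp
      ((natHess τ T (η t) y).comp (fderiv ℝ η t)))

lemma dpdHess_apply (τ : ℝ) (T : EuclideanSpace ℝ (Fin m) → V →L[ℝ] ℝ) (η : E → V) (t : E)
    (y : EuclideanSpace ℝ (Fin m)) (h k : E) :
    dpdHess τ T η t y h k = (1 + τ) * (natGrad τ T (η t) y (fderiv ℝ (fderiv ℝ η) t h k) +
      natHess τ T (η t) y (fderiv ℝ η t h) (fderiv ℝ η t k)) := rfl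

lemma natHess_apply (τ : ℝ) (T : EuclideanSpace ℝ (Fin m) → V →L[ℝ] ℝ) (v : V)
    (y : EuclideanSpace ℝ (Fin m)) (a b : V) :
    natHess τ T v y a b = τ * Real.exp (τ * T y v) * (T y a * T y b) -
      partHess volume (1 + τ) T v a b := rfl

lemma natGrad_apply (τ : ℝ) (T : EuclideanSpace ℝ (Fin m) → V →L[ℝ] ℝ) (v : V)
    (y : EuclideanSpace ℝ (Fin m)) (a : V) :
    natGrad τ T v y a = Real.exp (τ * T y v) * T y a - partGrad volume (1 + τ) T v a := rfl

lemma hasFDerivAt_dpd {τ : ℝ} {T : EuclideanSpace ℝ (Fin m) → V →L[ℝ] ℝ} {η : E → V} {t : E}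
    (hη : DifferentiableAt ℝ η t)
    (hp : HasFDerivAt (part volume (1 + τ) T) ((1 + τ) • partGrad volume (1 + τ) T (η t)) (η t))
    (y : EuclideanSpace ℝ (Fin m)) :
    HasFDerivAt (fun t => dpd τ T η t y) (dpdGrad τ T η t y) t := by
  have h1 : HasFDerivAt (fun t => T y (η t)) ((T y).comp (fderiv ℝ η t)) t :=
    (T y).hasFDerivAt.comp t hη.hasFDerivAt
  have h2 := (hasDerivAt_powLink τ (T y (η t))).comp_hasFDerivAt t h1
  have h3 := hp.comp t hη.hasFDerivAt
  convert! h2.sub h3 using 1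
  ext k
  simp only [dpdGrad, natGrad, ContinuousLinearMap.comp_apply, smul_apply, sub_apply, smul_eq_mul]
  ring

lemma hasFDerivAt_dpdGrad {τ : ℝ} {T : EuclideanSpace ℝ (Fin m) → V →L[ℝ] ℝ} {η : E → V} {t : E}
    (hη : DifferentiableAt ℝ η t) (hη' : DifferentiableAt ℝ (fderiv ℝ η) t)
    (hp : HasFDerivAt (partGrad volume (1 + τ) T) (partHess volume (1 + τ) T (η t)) (η t))
    (y : EuclideanSpace ℝ (Fin m)) :
    HasFDerivAt (fun t => dpdGrad τ T η t y) (dpdHess τ T η t y) t := by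
  have h1 : HasFDerivAt (fun v => Real.exp (τ * T y v)) (Real.exp (τ * T y (η t)) • τ • T y) (η t) :=
    ((T y).hasFDerivAt.const_mul τ).exp
  have h2 : HasFDerivAt (fun v => natGrad τ T v y) (natHess τ T (η t) y) (η t) := by
    convert! (h1.smul_const (T y)).sub hp using 1
    ext a b
    simp only [natHess, sub_apply, smul_apply, ContinuousLinearMap.smulRight_apply, smul_eq_mul]
    ring
  have h3 := (h2.comp t hη.hasFDerivAt)
  exact (h3.clm_comp hη'.hasFDerivAt).const_smul (1 + τ)

end Smooth

/-! ### Growth bounds in the observation, uniform near the true parameter -/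

section SmoothBall

variable {m : ℕ} {E V : Type*} [NormedAddCommGroup E] [NormedSpace ℝ E]
  [NormedAddCommGroup V] [NormedSpace ℝ V]

lemma norm_natGrad_le {τ c CT G : ℝ} {T : EuclideanSpace ℝ (Fin m) → V →L[ℝ] ℝ}
    {v : V} {y : EuclideanSpace ℝ (Fin m)} (hTb : ‖T y‖ ≤ CT * (1 + ‖y‖ ^ 2))
    (hc : Real.exp (τ * T y v) ≤ c) (hG : ‖partGrad volume (1 + τ) T v‖ ≤ G) :
    ‖natGrad τ T v y‖ ≤ (c * CT + G) * (1 + ‖y‖ ^ 2) := by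
  have hG0 : 0 ≤ G := (norm_nonneg _).trans hG
  have hc0 : 0 ≤ c := (Real.exp_pos _).le.trans hc
  refine (norm_sub_le _ _).trans ?_
  rw [norm_smul, Real.norm_of_nonneg (Real.exp_pos _).le]
  have h1 : Real.exp (τ * T y v) * ‖T y‖ ≤ c * (CT * (1 + ‖y‖ ^ 2)) :=
    mul_le_mul hc hTb (norm_nonneg _) hc0
  nlinarith [mul_nonneg hG0 (sq_nonneg ‖y‖)]

/-- The statistic grows quadratically and enters twice, so the growth is quartic; the exponential
factor stays bounded because Gaussian densities are. This yields the integrable envelope for the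
Hessian. -/
lemma abs_natHess_apply_le {τ c CT G : ℝ} (hτ : 0 ≤ τ)
    {T : EuclideanSpace ℝ (Fin m) → V →L[ℝ] ℝ}
    {v : V} {y : EuclideanSpace ℝ (Fin m)} (hTb : ‖T y‖ ≤ CT * (1 + ‖y‖ ^ 2))
    (hc : Real.exp (τ * T y v) ≤ c) (hG : ‖partHess volume (1 + τ) T v‖ ≤ G) (a b : V) :
    |natHess τ T v y a b| ≤ (τ * c * CT ^ 2 + G) * (1 + ‖y‖ ^ 2) ^ 2 * ‖a‖ * ‖b‖ := by
  have hG0 : 0 ≤ G := (norm_nonneg (partHess volume (1 + τ) T v)).trans hG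
  have hc0 : 0 ≤ c := (Real.exp_pos _).le.trans hc
  have hT2 : ‖T y‖ ^ 2 ≤ CT ^ 2 * (1 + ‖y‖ ^ 2) ^ 2 := by
    rw [← mul_pow]; exact pow_le_pow_left₀ (norm_nonneg _) hTb 2
  rw [natHess_apply]
  have h1 : |τ * Real.exp (τ * T y v) * (T y a * T y b)| ≤
      τ * c * (CT ^ 2 * (1 + ‖y‖ ^ 2) ^ 2) * (‖a‖ * ‖b‖) := by
    rw [abs_mul, abs_mul (T y a), abs_of_nonneg (mul_nonneg hτ (Real.exp_pos _).le)]
    have ha : |T y a| ≤ ‖T y‖ * ‖a‖ := (T y).le_opNorm a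
    have hb : |T y b| ≤ ‖T y‖ * ‖b‖ := (T y).le_opNorm b
    calc τ * Real.exp (τ * T y v) * (|T y a| * |T y b|)
        ≤ τ * c * ((‖T y‖ * ‖a‖) * (‖T y‖ * ‖b‖)) := by gcongr
      _ = τ * c * ‖T y‖ ^ 2 * (‖a‖ * ‖b‖) := by ring
      _ ≤ _ := by gcongr
  have h2 : |partHess volume (1 + τ) T v a b| ≤ G * ‖a‖ * ‖b‖ :=
    ((partHess volume (1 + τ) T v).le_opNorm₂ a b).trans (by gcongr)
  have h3 : 1 ≤ (1 + ‖y‖ ^ 2) ^ 2 := one_le_pow₀ (by nlinarith [sq_nonneg ‖y‖])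
  have h4 : G * ‖a‖ * ‖b‖ * 1 ≤ G * ‖a‖ * ‖b‖ * (1 + ‖y‖ ^ 2) ^ 2 := by gcongr
  calc |τ * Real.exp (τ * T y v) * (T y a * T y b) - partHess volume (1 + τ) T v a b|
      ≤ _ := abs_sub _ _
    _ ≤ τ * c * (CT ^ 2 * (1 + ‖y‖ ^ 2) ^ 2) * (‖a‖ * ‖b‖) + G * ‖a‖ * ‖b‖ := add_le_add h1 h2
    _ ≤ _ := by linarith

lemma eventually_norm_le_add_one {X B : Type*} [TopologicalSpace X] [NormedAddCommGroup B]
    {f : X → B} {x : X} (hf : ContinuousAt f x) : ∀ᶠ t in 𝓝 x, ‖f t‖ ≤ ‖f x‖ + 1 := by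
  filter_upwards [hf.norm.eventually_lt_const (lt_add_one ‖f x‖)] with t ht using ht.le

lemma continuousAt_dpdHess [FiniteDimensional ℝ E] [FiniteDimensional ℝ V] {τ : ℝ}
    {T : EuclideanSpace ℝ (Fin m) → V →L[ℝ] ℝ}
    (hT : Continuous T) {η : E → V} {t : E} (h0 : ContinuousAt η t)
    (h1 : ContinuousAt (fderiv ℝ η) t) (h2 : ContinuousAt (fderiv ℝ (fderiv ℝ η)) t)
    (hg : ContinuousAt (partGrad volume (1 + τ) T) (η t))
    (hh : ContinuousAt (partHess volume (1 + τ) T) (η t)) (y : EuclideanSpace ℝ (Fin m)) :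
    ContinuousAt (fun x : EuclideanSpace ℝ (Fin m) × E => dpdHess τ T η x.2 x.1) (y, t) := by
  have cT : ContinuousAt (fun x : EuclideanSpace ℝ (Fin m) × E => T x.1) (y, t) :=
    (hT.comp continuous_fst).continuousAt
  have cη : ContinuousAt (fun x : EuclideanSpace ℝ (Fin m) × E => η x.2) (y, t) :=
    ContinuousAt.comp (g := η) h0 continuousAt_snd
  have cη' : ContinuousAt (fun x : EuclideanSpace ℝ (Fin m) × E => fderiv ℝ η x.2) (y, t) :=
    ContinuousAt.comp (g := fderiv ℝ η) h1 continuousAt_snd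
  have cη'' : ContinuousAt
      (fun x : EuclideanSpace ℝ (Fin m) × E => fderiv ℝ (fderiv ℝ η) x.2) (y, t) :=
    ContinuousAt.comp (g := fderiv ℝ (fderiv ℝ η)) h2 continuousAt_snd
  have cG : ContinuousAt
      (fun x : EuclideanSpace ℝ (Fin m) × E => partGrad volume (1 + τ) T (η x.2)) (y, t) :=
    ContinuousAt.comp (g := partGrad volume (1 + τ) T) hg cη
  have cH : ContinuousAt
      (fun x : EuclideanSpace ℝ (Fin m) × E => partHess volume (1 + τ) T (η x.2)) (y, t) :=
    ContinuousAt.comp (g := partHess volume (1 + τ) T) hh cη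
  have cTη : ContinuousAt (fun x : EuclideanSpace ℝ (Fin m) × E => T x.1 (η x.2)) (y, t) :=
    cT.clm_apply cη
  have cexp : ContinuousAt
      (fun x : EuclideanSpace ℝ (Fin m) × E => Real.exp (τ * T x.1 (η x.2))) (y, t) :=
    (continuousAt_const.mul cTη).rexp
  refine continuousAt_clm_apply.2 fun h => continuousAt_clm_apply.2 fun k => ?_
  simp only [dpdHess_apply, natGrad_apply, natHess_apply]
  have ch := cη'.clm_apply (continuousAt_const (y := h))
  have ck := cη'.clm_apply (continuousAt_const (y := k))
  have chk := (cη''.clm_apply (continuousAt_const (y := h))).clm_apply (continuousAt_const (y := k))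
  exact continuousAt_const.mul (((cexp.mul (cT.clm_apply chk)).sub (cG.clm_apply chk)).add
    (((continuousAt_const.mul cexp).mul ((cT.clm_apply ch).mul (cT.clm_apply ck))).sub
      ((cH.clm_apply ch).clm_apply ck)))

/-- Regularity of the objective on a ball. -/
lemma exists_ball_dpd [FiniteDimensional ℝ E] [FiniteDimensional ℝ V] {τ : ℝ} (hτ : 0 ≤ τ) {T : EuclideanSpace ℝ (Fin m) → V →L[ℝ] ℝ}
    (hT : Continuous T) {CT : ℝ} (hTb : ∀ y, ‖T y‖ ≤ CT * (1 + ‖y‖ ^ 2))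
    {η : E → V} {θ : E} (hη : ContDiffAt ℝ 2 η θ) {δ : ℝ} (hδ : 0 < δ)
    (hpart : ∀ v ∈ Metric.ball (η θ) δ,
      HasFDerivAt (part volume (1 + τ) T) ((1 + τ) • partGrad volume (1 + τ) T v) v ∧
      HasFDerivAt (partGrad volume (1 + τ) T) (partHess volume (1 + τ) T v) v ∧
      ContinuousAt (partHess volume (1 + τ) T) v)
    {c : ℝ} (hexp : ∀ᶠ t in 𝓝 θ, ∀ y, Real.exp (τ * T y (η t)) ≤ c) :
    ∃ ρ > 0, (∀ t ∈ Metric.ball θ ρ, ∀ y,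
        HasFDerivAt (fun t => dpd τ T η t y) (dpdGrad τ T η t y) t) ∧
      (∀ t ∈ Metric.ball θ ρ, ∀ y,
        HasFDerivAt (fun t => dpdGrad τ T η t y) (dpdHess τ T η t y) t) ∧
      ContinuousOn (fun x : EuclideanSpace ℝ (Fin m) × E => dpdHess τ T η x.2 x.1)
        (Set.univ ×ˢ Metric.ball θ ρ) ∧
      ∃ C, ∀ t ∈ Metric.ball θ ρ, ∀ y, ‖dpdHess τ T η t y‖ ≤ C * (1 + ‖y‖ ^ 2) ^ 2 := by
  have hC2 : ∀ᶠ t in 𝓝 θ, ContDiffAt ℝ 2 η t := hη.eventually (by simp)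
  have hd1 : ∀ t, ContDiffAt ℝ 2 η t → ContDiffAt ℝ 1 (fderiv ℝ η) t := fun t ht =>
    ht.fderiv_right (by norm_num)
  have hd2 : ∀ t, ContDiffAt ℝ 2 η t → ContinuousAt (fderiv ℝ (fderiv ℝ η)) t := fun t ht =>
    ((hd1 t ht).fderiv_right (m := 0) (by norm_num)).continuousAt
  have hball : ∀ᶠ t in 𝓝 θ, η t ∈ Metric.ball (η θ) δ :=
    hη.continuousAt (Metric.ball_mem_nhds _ hδ)
  have hθδ := hpart (η θ) (Metric.mem_ball_self hδ)
  have hb1 := eventually_norm_le_add_one (hd1 θ hη).continuousAt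
  have hb2 := eventually_norm_le_add_one (f := fderiv ℝ (fderiv ℝ η)) (hd2 θ hη)
  have hb3 : ∀ᶠ t in 𝓝 θ, ‖partGrad volume (1 + τ) T (η t)‖ ≤
      ‖partGrad volume (1 + τ) T (η θ)‖ + 1 :=
    eventually_norm_le_add_one (f := fun t => partGrad volume (1 + τ) T (η t))
      (ContinuousAt.comp (g := partGrad volume (1 + τ) T) hθδ.2.1.continuousAt hη.continuousAt)
  have hb4 : ∀ᶠ t in 𝓝 θ, ‖partHess volume (1 + τ) T (η t)‖ ≤
      ‖partHess volume (1 + τ) T (η θ)‖ + 1 :=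
    eventually_norm_le_add_one (f := fun t => partHess volume (1 + τ) T (η t))
      (ContinuousAt.comp (g := partHess volume (1 + τ) T) hθδ.2.2 hη.continuousAt)
  obtain ⟨ρ, hρ, hall⟩ := Metric.eventually_nhds_iff_ball.1
    (hC2.and (hball.and (hexp.and (hb1.and (hb2.and (hb3.and hb4))))))
  refine ⟨ρ, hρ, fun t ht y => ?_, fun t ht y => ?_, ?_, ?_⟩
  · obtain ⟨h2, hv, -⟩ := hall t ht
    exact hasFDerivAt_dpd (h2.differentiableAt (by norm_num)) (hpart _ hv).1 y
  · obtain ⟨h2, hv, -⟩ := hall t ht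
    exact hasFDerivAt_dpdGrad (h2.differentiableAt (by norm_num))
      ((hd1 t h2).differentiableAt (by norm_num)) (hpart _ hv).2.1 y
  · rintro ⟨y, t⟩ ⟨-, ht⟩
    obtain ⟨h2, hv, -⟩ := hall t ht
    obtain ⟨-, hg, hh⟩ := hpart _ hv
    refine ContinuousAt.continuousWithinAt ?_
    exact continuousAt_dpdHess hT h2.continuousAt (hd1 t h2).continuousAt (hd2 t h2)
      hg.continuousAt hh y
  · set N1 := ‖fderiv ℝ η θ‖ + 1
    set N2 := ‖fderiv ℝ (fderiv ℝ η) θ‖ + 1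
    set G1 := ‖partGrad volume (1 + τ) T (η θ)‖ + 1
    set G2 := ‖partHess volume (1 + τ) T (η θ)‖ + 1
    have hc0 : 0 ≤ c := (Real.exp_pos _).le.trans
      ((hall θ (Metric.mem_ball_self hρ)).2.2.1 0)
    have hCT0 : 0 ≤ CT := by
      have := (norm_nonneg _).trans (hTb 0)
      simpa using this
    have hG10 : 0 ≤ G1 := by positivity
    have hG20 : 0 ≤ G2 := by positivity
    have hN1 : 0 ≤ N1 := by positivity
    have hN2 : 0 ≤ N2 := by positivity
    refine ⟨(1 + τ) * ((c * CT + G1) * N2 + (τ * c * CT ^ 2 + G2) * N1 ^ 2), fun t ht y => ?_⟩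
    obtain ⟨-, -, he, h1, h2, h3, h4⟩ := hall t ht
    set w := 1 + ‖y‖ ^ 2 with hw
    have hw1 : 1 ≤ w := by rw [hw]; nlinarith [sq_nonneg ‖y‖]
    have hw2 : w ≤ w ^ 2 := by nlinarith
    refine ContinuousLinearMap.opNorm_le_bound₂ _ (by positivity) fun h k => ?_
    rw [dpdHess_apply, Real.norm_eq_abs, abs_mul, abs_of_nonneg (by positivity : 0 ≤ 1 + τ)]
    have e1 : |natGrad τ T (η t) y (fderiv ℝ (fderiv ℝ η) t h k)| ≤
        (c * CT + G1) * w ^ 2 * (N2 * ‖h‖ * ‖k‖) := by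
      refine ((natGrad τ T (η t) y).le_opNorm _).trans ?_
      refine mul_le_mul ((norm_natGrad_le (hTb y) (he y) h3).trans (by gcongr))
        (((fderiv ℝ (fderiv ℝ η) t).le_opNorm₂ h k).trans (by gcongr)) (norm_nonneg _)
        (by positivity)
    have e2 : |natHess τ T (η t) y (fderiv ℝ η t h) (fderiv ℝ η t k)| ≤
        (τ * c * CT ^ 2 + G2) * w ^ 2 * (N1 * ‖h‖) * (N1 * ‖k‖) := by
      refine (abs_natHess_apply_le hτ (hTb y) (he y) h4 _ _).trans ?_
      have l1 : ‖fderiv ℝ η t h‖ ≤ N1 * ‖h‖ := ((fderiv ℝ η t).le_opNorm h).trans (by gcongr)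
      have l2 : ‖fderiv ℝ η t k‖ ≤ N1 * ‖k‖ := ((fderiv ℝ η t).le_opNorm k).trans (by gcongr)
      gcongr
    calc (1 + τ) * |natGrad τ T (η t) y (fderiv ℝ (fderiv ℝ η) t h k) +
          natHess τ T (η t) y (fderiv ℝ η t h) (fderiv ℝ η t k)|
        ≤ (1 + τ) * ((c * CT + G1) * w ^ 2 * (N2 * ‖h‖ * ‖k‖) +
          (τ * c * CT ^ 2 + G2) * w ^ 2 * (N1 * ‖h‖) * (N1 * ‖k‖)) := by
          gcongr; exact (abs_add_le _ _).trans (add_le_add e1 e2)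
      _ = _ := by ring

end SmoothBall

/-! ### Expectations of gradient and Hessian in the natural parameter -/

section Expectations

variable {m : ℕ}

lemma mahalanobisSq_nonneg {S : Matrix (Fin m) (Fin m) ℝ} (hS : S.PosDef)
    (ν y : EuclideanSpace ℝ (Fin m)) : 0 ≤ mahalanobisSq ν S y := by
  have := hS.inv.posSemidef.dotProduct_mulVec_nonneg (y - ν).ofLp
  simpa [mahalanobisSq] using this

lemma logDens_le {S : Matrix (Fin m) (Fin m) ℝ} (hS : S.PosDef)
    (ν y : EuclideanSpace ℝ (Fin m)) :
    logDens ν S y ≤ -((m : ℝ) / 2) * Real.log (2 * Real.pi) - 1 / 2 * Real.log S.det := by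
  have := mahalanobisSq_nonneg hS ν y
  rw [logDens]; linarith

variable {V : Type*} [NormedAddCommGroup V] [NormedSpace ℝ V]

lemma clm_integral_of_norm_le {α B C : Type*} [MeasurableSpace α] {μ : Measure α}
    [NormedAddCommGroup B] [NormedSpace ℝ B] [CompleteSpace B] [NormedAddCommGroup C]
    [NormedSpace ℝ C] [CompleteSpace C] (L : B →L[ℝ] C) {f : α → B}
    (hf : AEStronglyMeasurable f μ) {g : α → ℝ} (hg : Integrable g μ) (h : ∀ y, ‖f y‖ ≤ g y) :
    L (∫ y, f y ∂μ) = ∫ y, L (f y) ∂μ :=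
  (L.integral_comp_comm (hg.mono' hf (Eventually.of_forall h))).symm

lemma integral_apply_apply_of_norm_le {α : Type*} [MeasurableSpace α] {μ : Measure α}
    {f : α → V →L[ℝ] V →L[ℝ] ℝ} (hf : AEStronglyMeasurable f μ) {g : α → ℝ}
    (hg : Integrable g μ) (h : ∀ y, ‖f y‖ ≤ g y) (a b : V) :
    (∫ y, f y ∂μ) a b = ∫ y, f y a b ∂μ := by
  let L₁ : (V →L[ℝ] V →L[ℝ] ℝ) →L[ℝ] (V →L[ℝ] ℝ) := ContinuousLinearMap.apply ℝ (V →L[ℝ] ℝ) a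
  let L₂ : (V →L[ℝ] ℝ) →L[ℝ] ℝ := ContinuousLinearMap.apply ℝ ℝ b
  exact clm_integral_of_norm_le (B := V →L[ℝ] V →L[ℝ] ℝ) (C := ℝ) (f := f) (L₂.comp L₁) hf hg h

/-- Fernique's theorem makes exp(C ‖y‖²) integrable for the Gaussian law with rescaled covariance.
Since `T` grows at most quadratically, ε = C/(CT + 1) keeps ε ‖T y‖ below C (1 + ‖y‖²). -/
lemma exists_integrable_exp_mul_logDens_add {S : Matrix (Fin m) (Fin m) ℝ} (hS : S.PosDef)
    (ν : EuclideanSpace ℝ (Fin m)) {τ : ℝ} (hτ : 0 ≤ τ)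
    {T : EuclideanSpace ℝ (Fin m) → V →L[ℝ] ℝ}
    (hT : Continuous T) {CT : ℝ} (hTb : ∀ y, ‖T y‖ ≤ CT * (1 + ‖y‖ ^ 2)) {v : V}
    (hv : ∀ y, T y v = logDens ν S y) :
    ∃ ε > 0, Integrable (fun y => Real.exp ((1 + τ) * T y v + ε * ‖T y‖)) := by
  obtain ⟨C, hC, hint⟩ := IsGaussian.exists_integrable_exp_sq
    (multivariateGaussian ν ((1 + τ)⁻¹ • S))
  have hCT0 : 0 ≤ CT := by
    have := (norm_nonneg _).trans (hTb 0)
    simpa using this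
  refine ⟨C / (CT + 1), by positivity, ?_⟩
  have h1 := (integrable_exp_mul_logDens_smul hS hτ ν hint).const_mul (Real.exp C)
  have hc : Continuous fun y => T y v := hT.clm_apply continuous_const
  refine h1.mono' (Continuous.aestronglyMeasurable (by fun_prop))
    (Eventually.of_forall fun y => ?_)
  rw [Real.norm_of_nonneg (Real.exp_pos _).le, smul_eq_mul, ← Real.exp_add, ← Real.exp_add, hv]
  refine Real.exp_le_exp.2 ?_
  have h2 : C / (CT + 1) * ‖T y‖ ≤ C / (CT + 1) * ((CT + 1) * (1 + ‖y‖ ^ 2)) := by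
    gcongr
    refine (hTb y).trans ?_
    gcongr
    linarith
  have h3 : C / (CT + 1) * ((CT + 1) * (1 + ‖y‖ ^ 2)) = C * (1 + ‖y‖ ^ 2) := by
    field_simp
  linarith

section

variable {S : Matrix (Fin m) (Fin m) ℝ} {ν : EuclideanSpace ℝ (Fin m)} {τ : ℝ}
  {T : EuclideanSpace ℝ (Fin m) → V →L[ℝ] ℝ} {CT : ℝ} {v : V}

lemma abs_apply_le
    (hTb : ∀ y, ‖T y‖ ≤ CT * (1 + ‖y‖ ^ 2))
    (y : EuclideanSpace ℝ (Fin m)) (a : V) :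
    |T y a| ≤ CT * ‖a‖ * (1 + ‖y‖ ^ 2) := by
  have h1 : |T y a| ≤ ‖T y‖ * ‖a‖ := (T y).le_opNorm a
  have h2 := mul_le_mul_of_nonneg_right (hTb y) (norm_nonneg a)
  linarith

lemma integrable_apply
    (hT : Continuous T) (hTb : ∀ y, ‖T y‖ ≤ CT * (1 + ‖y‖ ^ 2))
    (μ : Measure (EuclideanSpace ℝ (Fin m))) [IsGaussian μ] (a : V) :
    Integrable (fun y => T y a) μ :=
  integrable_of_norm_le_pow μ (hT.clm_apply continuous_const).aestronglyMeasurable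
    (CT * ‖a‖) 1 fun y => by rw [pow_one]; exact abs_apply_le hTb y a

lemma integrable_apply_mul_apply
    (hT : Continuous T) (hTb : ∀ y, ‖T y‖ ≤ CT * (1 + ‖y‖ ^ 2))
    (μ : Measure (EuclideanSpace ℝ (Fin m))) [IsGaussian μ]
    (a b : V) : Integrable (fun y => T y a * T y b) μ :=
  integrable_of_norm_le_pow μ
    ((hT.clm_apply continuous_const).mul (hT.clm_apply continuous_const)).aestronglyMeasurable
    (CT * ‖a‖ * (CT * ‖b‖)) 2 fun y => by
      rw [Real.norm_eq_abs, abs_mul]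
      calc |T y a| * |T y b| ≤ (CT * ‖a‖ * (1 + ‖y‖ ^ 2)) * (CT * ‖b‖ * (1 + ‖y‖ ^ 2)) :=
            mul_le_mul (abs_apply_le hTb y a) (abs_apply_le hTb y b) (abs_nonneg _)
              ((abs_nonneg _).trans (abs_apply_le hTb y a))
        _ = _ := by ring

lemma exp_mul_apply_le
    (hS : S.PosDef) (hτ : 0 ≤ τ) (hv : ∀ y, T y v = logDens ν S y)
    (y : EuclideanSpace ℝ (Fin m)) : Real.exp (τ * T y v) ≤
    Real.exp (τ * (-((m : ℝ) / 2) * Real.log (2 * Real.pi) - 1 / 2 * Real.log S.det)) := by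
  rw [hv]
  exact Real.exp_le_exp.2 (mul_le_mul_of_nonneg_left (logDens_le hS ν y) hτ)

/-- Powers of the density against the Gaussian law. -/
lemma integral_exp_mul_gaussian {B : Type*} [NormedAddCommGroup B] [NormedSpace ℝ B]
    (hS : S.PosDef) (hτ : 0 ≤ τ) (f : EuclideanSpace ℝ (Fin m) → B) :
    ∫ y, Real.exp (τ * logDens ν S y) • f y ∂(multivariateGaussian ν S) =
      kap m τ S.det • ∫ y, f y ∂(multivariateGaussian ν ((1 + τ)⁻¹ • S)) := by
  rw [integral_multivariateGaussian_eq hS, ← integral_exp_mul_logDens_smul hS hτ]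
  simp_rw [smul_smul, ← Real.exp_add]
  congr! 4
  ring

lemma integrable_exp_mul_gaussian {B : Type*} [NormedAddCommGroup B] [NormedSpace ℝ B]
    (hS : S.PosDef) (hτ : 0 ≤ τ) {f : EuclideanSpace ℝ (Fin m) → B}
    (hf : Integrable f (multivariateGaussian ν ((1 + τ)⁻¹ • S))) :
    Integrable (fun y => Real.exp (τ * logDens ν S y) • f y) (multivariateGaussian ν S) := by
  rw [integrable_multivariateGaussian_iff hS]
  have := integrable_exp_mul_logDens_smul hS hτ ν hf
  refine this.congr (Eventually.of_forall fun y => ?_)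
  simp only [smul_smul, ← Real.exp_add]
  congr 2
  ring

lemma partGrad_apply
    (hS : S.PosDef) (hτ : 0 ≤ τ) (hT : Continuous T) (hTb : ∀ y, ‖T y‖ ≤ CT * (1 + ‖y‖ ^ 2))
    (hv : ∀ y, T y v = logDens ν S y)
    (a : V) : partGrad volume (1 + τ) T v a =
    kap m τ S.det * ∫ y, T y a ∂(multivariateGaussian ν ((1 + τ)⁻¹ • S)) := by
  have hTint : Integrable T (multivariateGaussian ν ((1 + τ)⁻¹ • S)) :=
    integrable_of_norm_le_pow _ hT.aestronglyMeasurable CT 1 (by simpa using hTb)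
  have h1 := integrable_exp_mul_logDens_smul hS hτ ν hTint
  rw [partGrad, ContinuousLinearMap.integral_apply (by simpa only [hv] using h1)]
  have := integral_exp_mul_logDens_smul hS hτ ν (fun y => T y a)
  simpa [hv] using this

lemma partHess_apply
    (hS : S.PosDef) (hτ : 0 ≤ τ) (hT : Continuous T) (hTb : ∀ y, ‖T y‖ ≤ CT * (1 + ‖y‖ ^ 2))
    (hv : ∀ y, T y v = logDens ν S y)
    [FiniteDimensional ℝ V] (a b : V) : partHess volume (1 + τ) T v a b =
    (1 + τ) * (kap m τ S.det *
      ∫ y, T y a * T y b ∂(multivariateGaussian ν ((1 + τ)⁻¹ • S))) := by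
  have h1 : Integrable (fun y => CT ^ 2 * (1 + ‖y‖ ^ 2) ^ 2)
      (multivariateGaussian ν ((1 + τ)⁻¹ • S)) := by
    refine integrable_of_norm_le_pow _ (Continuous.aestronglyMeasurable (by fun_prop))
      (CT ^ 2) 2 fun y => ?_
    rw [Real.norm_of_nonneg (by positivity)]
  have h2 := (integrable_exp_mul_logDens_smul hS hτ ν h1).const_mul (1 + τ)
  have hc : Continuous fun y => (1 + τ) * Real.exp ((1 + τ) * T y v) := by
    have := hT.clm_apply (continuous_const (y := v))
    fun_prop
  have h3 := integral_apply_apply_of_norm_le (a := a) (b := b)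
    (f := fun y => ((1 + τ) * Real.exp ((1 + τ) * T y v)) • (T y).smulRight (T y))
    (hc.smul (continuous_smulRight_self hT)).aestronglyMeasurable h2 fun y => by
      refine (norm_smul_smulRight_self_le _ _).trans ?_
      rw [abs_of_nonneg (by positivity), hv, mul_assoc, smul_eq_mul]
      have := pow_le_pow_left₀ (norm_nonneg _) (hTb y) 2
      rw [mul_pow] at this
      gcongr
  refine h3.trans ?_
  have := integral_exp_mul_logDens_smul hS hτ ν (fun y => T y a * T y b)
  rw [smul_eq_mul] at this
  rw [← this, ← integral_const_mul]
  refine integral_congr_ae (Eventually.of_forall fun y => ?_)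
  simp [hv, mul_assoc]

lemma integrable_natGrad_apply
    (hS : S.PosDef) (hτ : 0 ≤ τ) (hT : Continuous T) (hTb : ∀ y, ‖T y‖ ≤ CT * (1 + ‖y‖ ^ 2))
    (hv : ∀ y, T y v = logDens ν S y)
    (a : V) :
    Integrable (fun y => natGrad τ T v y a) (multivariateGaussian ν S) := by
  simp only [natGrad_apply, hv]
  exact (integrable_exp_mul_gaussian hS hτ (integrable_apply hT hTb _ a)).sub (integrable_const _)

/-- Under the law with density φ, the mean of φ^τ T is ∫ φ^(1+τ) T, which is exactly the term
subtracted in `natGrad`. -/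
lemma integral_natGrad_apply
    (hS : S.PosDef) (hτ : 0 ≤ τ) (hT : Continuous T) (hTb : ∀ y, ‖T y‖ ≤ CT * (1 + ‖y‖ ^ 2))
    (hv : ∀ y, T y v = logDens ν S y)
    (a : V) :
    ∫ y, natGrad τ T v y a ∂(multivariateGaussian ν S) = 0 := by
  simp only [natGrad_apply, hv]
  have h1 := integrable_exp_mul_gaussian hS hτ (integrable_apply hT hTb
    (multivariateGaussian ν ((1 + τ)⁻¹ • S)) a)
  simp only [smul_eq_mul] at h1
  rw [integral_sub h1 (integrable_const _), partGrad_apply hS hτ hT hTb hv]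
  have := integral_exp_mul_gaussian (ν := ν) hS hτ (fun y => T y a)
  simp only [smul_eq_mul] at this
  rw [this]
  simp

lemma integrable_natHess_apply
    (hS : S.PosDef) (hτ : 0 ≤ τ) (hT : Continuous T) (hTb : ∀ y, ‖T y‖ ≤ CT * (1 + ‖y‖ ^ 2))
    (hv : ∀ y, T y v = logDens ν S y)
    (a b : V) :
    Integrable (fun y => natHess τ T v y a b) (multivariateGaussian ν S) := by
  simp only [natHess_apply, hv]
  have h1 := integrable_exp_mul_gaussian hS hτ (integrable_apply_mul_apply hT hTb
    (multivariateGaussian ν ((1 + τ)⁻¹ • S)) a b)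
  simp only [smul_eq_mul] at h1
  refine Integrable.sub ?_ (integrable_const _)
  simp_rw [mul_assoc]
  exact h1.const_mul τ

/-- The two terms of `natHess` contribute τ and 1 + τ times the same integral, so their difference
carries the coefficient -1. -/
lemma integral_natHess_apply
    (hS : S.PosDef) (hτ : 0 ≤ τ) (hT : Continuous T) (hTb : ∀ y, ‖T y‖ ≤ CT * (1 + ‖y‖ ^ 2))
    (hv : ∀ y, T y v = logDens ν S y)
    [FiniteDimensional ℝ V] (a b : V) :
    ∫ y, natHess τ T v y a b ∂(multivariateGaussian ν S) =
      -(kap m τ S.det * ∫ y, T y a * T y b ∂(multivariateGaussian ν ((1 + τ)⁻¹ • S))) := by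
  simp only [natHess_apply, hv]
  have h1 := integrable_exp_mul_gaussian hS hτ (integrable_apply_mul_apply hT hTb
    (multivariateGaussian ν ((1 + τ)⁻¹ • S)) a b)
  simp only [smul_eq_mul] at h1
  have := integral_exp_mul_gaussian (ν := ν) hS hτ (fun y => T y a * T y b)
  simp only [smul_eq_mul] at this
  simp_rw [mul_assoc]
  rw [integral_sub (h1.const_mul τ) (integrable_const _), partHess_apply hS hτ hT hTb hv,
    integral_const_mul, this]
  simp
  ring

/-- The covariance of the score in the natural parameter. -/
lemma integral_natGrad_mul_natGrad
    (hS : S.PosDef) (hτ : 0 ≤ τ) (hT : Continuous T) (hTb : ∀ y, ‖T y‖ ≤ CT * (1 + ‖y‖ ^ 2))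
    (hv : ∀ y, T y v = logDens ν S y)
    (a b : V) :
    ∫ y, natGrad τ T v y a * natGrad τ T v y b ∂(multivariateGaussian ν S) =
      kap m (2 * τ) S.det *
        ∫ y, T y a * T y b ∂(multivariateGaussian ν ((1 + 2 * τ)⁻¹ • S)) -
      partGrad volume (1 + τ) T v a * partGrad volume (1 + τ) T v b := by
  have hτ2 : 0 ≤ 2 * τ := by positivity
  have h1 := integrable_exp_mul_gaussian hS hτ2 (integrable_apply_mul_apply hT hTb
    (multivariateGaussian ν ((1 + 2 * τ)⁻¹ • S)) a b)
  have h2 := integral_exp_mul_gaussian (ν := ν) hS hτ2 (fun y => T y a * T y b)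
  simp only [smul_eq_mul] at h1 h2
  have ha := integrable_natGrad_apply hS hτ hT hTb hv a
  have hb := integrable_natGrad_apply hS hτ hT hTb hv b
  have ha0 := integral_natGrad_apply hS hτ hT hTb hv a
  have hb0 := integral_natGrad_apply hS hτ hT hTb hv b
  set pa := partGrad volume (1 + τ) T v a
  set pb := partGrad volume (1 + τ) T v b
  -- The linear terms are written through the centred `natGrad`, so that they integrate to zero.
  have e : ∀ y, natGrad τ T v y a * natGrad τ T v y b =
      Real.exp (2 * τ * logDens ν S y) * (T y a * T y b) - pb * natGrad τ T v y a -
        pa * natGrad τ T v y b - pa * pb := fun y => by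
    rw [natGrad_apply, natGrad_apply, hv, show 2 * τ * logDens ν S y =
      τ * logDens ν S y + τ * logDens ν S y by ring, Real.exp_add]
    ring
  simp_rw [e]
  have h3 : Integrable (fun y => Real.exp (2 * τ * logDens ν S y) * (T y a * T y b) -
      pb * natGrad τ T v y a) (multivariateGaussian ν S) := h1.sub (ha.const_mul pb)
  have h4 : Integrable (fun y => Real.exp (2 * τ * logDens ν S y) * (T y a * T y b) -
      pb * natGrad τ T v y a - pa * natGrad τ T v y b) (multivariateGaussian ν S) :=
    h3.sub (hb.const_mul pa)
  rw [integral_sub h4 (integrable_const _), integral_sub h3 (hb.const_mul pa),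
    integral_sub h1 (ha.const_mul pb), integral_const_mul, integral_const_mul, ha0, hb0, h2]
  simp

end

end Expectations

/-! ### The Gaussian family in natural coordinates -/

section NaturalParameter

variable {m : ℕ}

/-- The space of natural parameters of the Gaussian family: the coefficients of polynomials of
degree at most two. -/
abbrev NatParam (m : ℕ) : Type := (Fin m → Fin m → ℝ) × (Fin m → ℝ) × ℝ

lemma abs_quadEval_le (y : EuclideanSpace ℝ (Fin m)) (v : NatParam m) :
    |(∑ a, ∑ b, v.1 a b * (y a * y b)) + (∑ a, v.2.1 a * y a) + v.2.2| ≤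
      ((m : ℝ) * m + m + 1) * (1 + ‖y‖ ^ 2) * ‖v‖ := by
  have h1 : ∀ a b, |v.1 a b| ≤ ‖v‖ := fun a b =>
    ((norm_le_pi_norm (v.1 a) b).trans (norm_le_pi_norm v.1 a)).trans (norm_fst_le v)
  have h2 : ∀ a, |v.2.1 a| ≤ ‖v‖ := fun a =>
    ((norm_le_pi_norm v.2.1 a).trans (norm_fst_le v.2)).trans (norm_snd_le v)
  have h3 : |v.2.2| ≤ ‖v‖ := (norm_snd_le v.2).trans (norm_snd_le v)
  have hy : ∀ a, |y a| ≤ ‖y‖ := fun a => PiLp.norm_apply_le y a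
  have hv := norm_nonneg v
  have hy0 := norm_nonneg y
  have e1 : ∀ a b, |v.1 a b * (y a * y b)| ≤ (1 + ‖y‖ ^ 2) * ‖v‖ := fun a b => by
    rw [abs_mul, abs_mul]
    calc |v.1 a b| * (|y a| * |y b|) ≤ ‖v‖ * (‖y‖ * ‖y‖) := by
          gcongr
          exacts [h1 a b, hy a, hy b]
      _ ≤ _ := by nlinarith
  have e2 : ∀ a, |v.2.1 a * y a| ≤ (1 + ‖y‖ ^ 2) * ‖v‖ := fun a => by
    rw [abs_mul]
    calc |v.2.1 a| * |y a| ≤ ‖v‖ * ‖y‖ := by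
          gcongr
          exacts [h2 a, hy a]
      _ ≤ _ := by nlinarith [mul_nonneg hv (sq_nonneg (‖y‖ - 1)), mul_nonneg hv (sq_nonneg ‖y‖)]
  have e3 : |v.2.2| ≤ (1 + ‖y‖ ^ 2) * ‖v‖ := by nlinarith [mul_nonneg hv (sq_nonneg ‖y‖)]
  have s1 : |∑ a, ∑ b, v.1 a b * (y a * y b)| ≤ (m : ℝ) * m * ((1 + ‖y‖ ^ 2) * ‖v‖) := by
    calc _ ≤ ∑ a, ∑ b, |v.1 a b * (y a * y b)| :=
          (Finset.abs_sum_le_sum_abs _ _).trans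
            (Finset.sum_le_sum fun a _ => Finset.abs_sum_le_sum_abs _ _)
      _ ≤ ∑ _a : Fin m, ∑ _b : Fin m, (1 + ‖y‖ ^ 2) * ‖v‖ :=
          Finset.sum_le_sum fun a _ => Finset.sum_le_sum fun b _ => e1 a b
      _ = _ := by simp; ring
  have s2 : |∑ a, v.2.1 a * y a| ≤ (m : ℝ) * ((1 + ‖y‖ ^ 2) * ‖v‖) := by
    calc _ ≤ ∑ a, |v.2.1 a * y a| := Finset.abs_sum_le_sum_abs _ _
      _ ≤ ∑ _a : Fin m, (1 + ‖y‖ ^ 2) * ‖v‖ := Finset.sum_le_sum fun a _ => e2 a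
      _ = _ := by simp
  have := abs_add_le ((∑ a, ∑ b, v.1 a b * (y a * y b)) + ∑ a, v.2.1 a * y a) v.2.2
  have := abs_add_le (∑ a, ∑ b, v.1 a b * (y a * y b)) (∑ a, v.2.1 a * y a)
  linarith

/-- Evaluation at `y` of the polynomial with given coefficients: the sufficient statistic of the
Gaussian family. -/
def suff (y : EuclideanSpace ℝ (Fin m)) : NatParam m →L[ℝ] ℝ :=
  LinearMap.mkContinuous
    { toFun := fun v => (∑ a, ∑ b, v.1 a b * (y a * y b)) + (∑ a, v.2.1 a * y a) + v.2.2
      map_add' := fun v w => by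
        simp only [Prod.fst_add, Prod.snd_add, Pi.add_apply, add_mul, Finset.sum_add_distrib]
        ring
      map_smul' := fun c v => by
        simp only [Prod.smul_fst, Prod.smul_snd, Pi.smul_apply, smul_eq_mul, mul_add,
          Finset.mul_sum, RingHom.id_apply, mul_assoc] }
    (((m : ℝ) * m + m + 1) * (1 + ‖y‖ ^ 2)) fun v => abs_quadEval_le y v

lemma suff_apply (y : EuclideanSpace ℝ (Fin m)) (v : NatParam m) :
    suff y v = (∑ a, ∑ b, v.1 a b * (y a * y b)) + (∑ a, v.2.1 a * y a) + v.2.2 := rfl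

lemma norm_suff_le (y : EuclideanSpace ℝ (Fin m)) :
    ‖suff y‖ ≤ ((m : ℝ) * m + m + 1) * (1 + ‖y‖ ^ 2) :=
  LinearMap.mkContinuous_norm_le _ (by positivity) _

lemma continuous_suff : Continuous (suff (m := m)) := by
  refine continuous_clm_apply.2 fun v => ?_
  simp only [suff_apply]
  fun_prop

variable {E : Type*}

/-- The natural parameter of the Gaussian law with mean `mu t` and covariance `Sig t`. -/
def natParam (mu : E → EuclideanSpace ℝ (Fin m)) (Sig : E → Matrix (Fin m) (Fin m) ℝ) (t : E) :
    NatParam m :=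
  (fun a b => -(1 / 2) * (Sig t)⁻¹ a b,
    fun a => 1 / 2 * (((Sig t)⁻¹ *ᵥ (mu t).ofLp) a + ((Sig t)⁻¹ᵀ *ᵥ (mu t).ofLp) a),
    -((m : ℝ) / 2) * Real.log (2 * Real.pi) - 1 / 2 * Real.log (Sig t).det -
      1 / 2 * ((mu t).ofLp ⬝ᵥ (Sig t)⁻¹ *ᵥ (mu t).ofLp))

/-- The linear coefficient of `natParam` is symmetrized over Σ⁻¹ and its transpose, so the expansion
of the quadratic form holds for every matrix. No symmetry or positivity has to be carried along
curves of parameters. -/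
lemma suff_natParam (mu : E → EuclideanSpace ℝ (Fin m)) (Sig : E → Matrix (Fin m) (Fin m) ℝ)
    (t : E) (y : EuclideanSpace ℝ (Fin m)) :
    suff y (natParam mu Sig t) = logDens (mu t) (Sig t) y := by
  rw [suff_apply, natParam, logDens, mahalanobisSq]
  have h1 : ∑ a, ∑ b, -(1 / 2) * (Sig t)⁻¹ a b * (y a * y b) =
      -(1 / 2) * (y.ofLp ⬝ᵥ (Sig t)⁻¹ *ᵥ y.ofLp) := by
    simp only [dotProduct, Matrix.mulVec, Finset.mul_sum]
    exact Finset.sum_congr rfl fun a _ => Finset.sum_congr rfl fun b _ => by ring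
  have h2 : ∑ a, 1 / 2 * (((Sig t)⁻¹ *ᵥ (mu t).ofLp) a + ((Sig t)⁻¹ᵀ *ᵥ (mu t).ofLp) a) * y a =
      1 / 2 * (y.ofLp ⬝ᵥ (Sig t)⁻¹ *ᵥ (mu t).ofLp + (mu t).ofLp ⬝ᵥ (Sig t)⁻¹ *ᵥ y.ofLp) := by
    rw [Matrix.dotProduct_mulVec (mu t).ofLp, ← Matrix.mulVec_transpose,
      dotProduct_comm _ y.ofLp, ← dotProduct_add]
    simp only [dotProduct, Finset.mul_sum, Pi.add_apply]
    exact Finset.sum_congr rfl fun a _ => by ring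
  simp only [h1, h2, WithLp.ofLp_sub, Matrix.mulVec_sub, sub_dotProduct, dotProduct_sub]
  ring

variable [NormedAddCommGroup E] [NormedSpace ℝ E]

lemma ContDiffAt.matrix_det {n : WithTop ℕ∞} {ι : Type*} [Fintype ι] [DecidableEq ι]
    {A : E → Matrix ι ι ℝ} {t : E}
    (h : ∀ a b, ContDiffAt ℝ n (fun t => A t a b) t) : ContDiffAt ℝ n (fun t => (A t).det) t := by
  simp only [Matrix.det_apply]
  refine ContDiffAt.sum fun σ _ => ?_
  exact (contDiffAt_prod fun i _ => h _ _).const_smul _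

lemma ContDiffAt.matrix_inv_apply {n : WithTop ℕ∞} {A : E → Matrix (Fin m) (Fin m) ℝ} {t : E}
    (h : ∀ a b, ContDiffAt ℝ n (fun t => A t a b) t) (hd : (A t).det ≠ 0) (a b : Fin m) :
    ContDiffAt ℝ n (fun t => (A t)⁻¹ a b) t := by
  simp only [Matrix.inv_def, Ring.inverse_eq_inv', Matrix.smul_apply, smul_eq_mul,
    Matrix.adjugate_apply]
  refine ((ContDiffAt.matrix_det h).inv hd).mul (ContDiffAt.matrix_det fun i j => ?_)
  simp only [Matrix.updateRow_apply]
  split_ifs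
  · exact contDiffAt_const
  · exact h i j

lemma contDiffAt_coord {n : WithTop ℕ∞} {mu : E → EuclideanSpace ℝ (Fin m)} {t : E}
    (h : ContDiffAt ℝ n mu t) (a : Fin m) : ContDiffAt ℝ n (fun t => mu t a) t :=
  (EuclideanSpace.proj (𝕜 := ℝ) a).contDiff.contDiffAt.comp t h

lemma contDiffAt_natParam {n : WithTop ℕ∞} {mu : E → EuclideanSpace ℝ (Fin m)}
    {Sig : E → Matrix (Fin m) (Fin m) ℝ} {t : E} (hmu : ContDiffAt ℝ n mu t)
    (hSig : ∀ a b, ContDiffAt ℝ n (fun t => Sig t a b) t) (hd : (Sig t).det ≠ 0) :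
    ContDiffAt ℝ n (natParam mu Sig) t := by
  have h1 := ContDiffAt.matrix_inv_apply hSig hd
  have h2 := contDiffAt_coord hmu
  have h3 : ContDiffAt ℝ n (fun t => Real.log (Sig t).det) t := (ContDiffAt.matrix_det hSig).log hd
  refine ContDiffAt.prodMk (contDiffAt_pi.2 fun a => contDiffAt_pi.2 fun b => ?_)
    (ContDiffAt.prodMk (contDiffAt_pi.2 fun a => ?_) ?_)
  · exact contDiffAt_const.mul (h1 a b)
  · simp only [Matrix.mulVec, dotProduct, Matrix.transpose_apply]
    refine contDiffAt_const.mul (ContDiffAt.add ?_ ?_)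
    · exact ContDiffAt.sum fun b _ => (h1 a b).mul (h2 b)
    · exact ContDiffAt.sum fun b _ => (h1 b a).mul (h2 b)
  · simp only [Matrix.mulVec, dotProduct]
    refine (contDiffAt_const.sub (contDiffAt_const.mul h3)).sub (contDiffAt_const.mul ?_)
    exact ContDiffAt.sum fun a _ => (h2 a).mul (ContDiffAt.sum fun b _ => (h1 a b).mul (h2 b))

end NaturalParameter

/-! ### The score as a quadratic polynomial -/

section Score

variable {m : ℕ} {E : Type*} [NormedAddCommGroup E] [NormedSpace ℝ E]

lemma hasDerivAt_mul_apply {ι : Type*} [Fintype ι] {A B : ℝ → Matrix ι ι ℝ}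
    {A' B' : Matrix ι ι ℝ} {s : ℝ} (hA : ∀ a b, HasDerivAt (fun s => A s a b) (A' a b) s)
    (hB : ∀ a b, HasDerivAt (fun s => B s a b) (B' a b) s) (a b : ι) :
    HasDerivAt (fun s => (A s * B s) a b) ((A' * B s + A s * B') a b) s := by
  simp only [Matrix.mul_apply, Matrix.add_apply, ← Finset.sum_add_distrib]
  exact HasDerivAt.fun_sum fun c _ => (hA a c).mul (hB c b)

/-- The product `B s * A s` is locally constant, so its derivative `B' * A s + B s * A'` vanishes.
-/
lemma deriv_inv_eq {A B : ℝ → Matrix (Fin m) (Fin m) ℝ} {A' B' : Matrix (Fin m) (Fin m) ℝ} {s : ℝ}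
    (hA : ∀ a b, HasDerivAt (fun s => A s a b) (A' a b) s)
    (hB : ∀ a b, HasDerivAt (fun s => B s a b) (B' a b) s) (hAB : ∀ᶠ s in 𝓝 s, B s * A s = 1) :
    B' = -(B s * A' * B s) := by
  have h1 : B' * A s + B s * A' = 0 := by
    ext a b
    have h2 := hasDerivAt_mul_apply hB hA a b
    have h3 : HasDerivAt (fun s => (B s * A s) a b) 0 s := by
      refine (hasDerivAt_const s ((1 : Matrix (Fin m) (Fin m) ℝ) a b)).congr_of_eventuallyEq ?_
      filter_upwards [hAB] with s hs
      rw [hs]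
    exact h2.unique h3
  have h4 : A s * B s = 1 := mul_eq_one_comm.1 hAB.self_of_nhds
  calc B' = B' * (A s * B s) := by rw [h4, mul_one]
    _ = (B' * A s) * B s := by rw [Matrix.mul_assoc]
    _ = -(B s * A') * B s := by rw [eq_neg_of_add_eq_zero_left h1]
    _ = _ := by rw [Matrix.neg_mul]

lemma hasDerivAt_quadForm {u : ℝ → Fin m → ℝ} {A : ℝ → Matrix (Fin m) (Fin m) ℝ} {u' : Fin m → ℝ}
    {A' : Matrix (Fin m) (Fin m) ℝ} {s : ℝ} (hu : ∀ a, HasDerivAt (fun s => u s a) (u' a) s)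
    (hA : ∀ a b, HasDerivAt (fun s => A s a b) (A' a b) s) :
    HasDerivAt (fun s => u s ⬝ᵥ A s *ᵥ u s)
      (u' ⬝ᵥ A s *ᵥ u s + u s ⬝ᵥ (A' *ᵥ u s + A s *ᵥ u')) s := by
  simp only [dotProduct, Matrix.mulVec, Pi.add_apply, ← Finset.sum_add_distrib]
  exact HasDerivAt.fun_sum fun a _ => (hu a).mul
    (HasDerivAt.fun_sum fun b _ => (hA a b).mul (hu b))

/-- The derivative of the Gaussian log-density, up to the additive constant, as a quadratic
polynomial in the observation. -/
lemma exists_suff_fderiv_natParam {mu : E → EuclideanSpace ℝ (Fin m)}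
    {Sig : E → Matrix (Fin m) (Fin m) ℝ} {θ : E} (hmu : ContDiffAt ℝ 1 mu θ)
    (hSig : ∀ a b, ContDiffAt ℝ 1 (fun t => Sig t a b) θ) (hpd : ∀ᶠ t in 𝓝 θ, (Sig t).PosDef)
    (e : E) {M : Matrix (Fin m) (Fin m) ℝ}
    (hM : ∀ a b, M a b = fderiv ℝ (fun t => Sig t a b) θ e) :
    ∃ c, ∀ y : EuclideanSpace ℝ (Fin m), suff y (fderiv ℝ (natParam mu Sig) θ e) =
      c + ((Sig θ)⁻¹ *ᵥ (fderiv ℝ mu θ e).ofLp) ⬝ᵥ (y - mu θ).ofLp +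
        (y - mu θ).ofLp ⬝ᵥ ((1 / 2 : ℝ) • ((Sig θ)⁻¹ * M * (Sig θ)⁻¹)) *ᵥ (y - mu θ).ofLp := by
  have hd : (Sig θ).det ≠ 0 := hpd.self_of_nhds.det_pos.ne'
  have hline : ∀ {F : Type} [NormedAddCommGroup F] [NormedSpace ℝ F] {f : E → F},
      ContDiffAt ℝ 1 f θ → HasDerivAt (fun s : ℝ => f (θ + s • e)) (fderiv ℝ f θ e) 0 :=
    fun hf => (hf.differentiableAt one_ne_zero).hasFDerivAt.hasLineDerivAt e
  have htend : Tendsto (fun s : ℝ => θ + s • e) (𝓝 0) (𝓝 θ) := by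
    have : Continuous fun s : ℝ => θ + s • e := by fun_prop
    simpa using this.tendsto 0
  set N : Matrix (Fin m) (Fin m) ℝ := fun a b => fderiv ℝ (fun t => (Sig t)⁻¹ a b) θ e
  have hN : ∀ a b, HasDerivAt (fun s : ℝ => (Sig (θ + s • e))⁻¹ a b) (N a b) 0 := fun a b =>
    hline (ContDiffAt.matrix_inv_apply hSig hd a b)
  have hS : ∀ a b, HasDerivAt (fun s : ℝ => Sig (θ + s • e) a b) (M a b) 0 := fun a b => by
    rw [hM]; exact hline (hSig a b)
  have hNe : N = -((Sig θ)⁻¹ * M * (Sig θ)⁻¹) := by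
    have := deriv_inv_eq hS hN (by
      filter_upwards [htend.eventually hpd] with s hs
      exact Matrix.nonsing_inv_mul _ hs.det_pos.ne'.isUnit)
    simpa using this
  have hlog := hline ((ContDiffAt.matrix_det hSig).log hd)
  -- The derivative of log det is left unevaluated: the constant will be determined by the mean of
  -- the score.
  refine ⟨-(1 / 2) * fderiv ℝ (fun t => Real.log (Sig t).det) θ e, fun y => ?_⟩
  have hu : ∀ a, HasDerivAt (fun s : ℝ => (y - mu (θ + s • e)).ofLp a)
      ((-(fderiv ℝ mu θ e)).ofLp a) 0 := fun a => by
    have h1 := hline hmu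
    have h2 := (EuclideanSpace.proj (𝕜 := ℝ) a).hasFDerivAt.comp_hasDerivAt (0 : ℝ)
      (h1.const_sub y)
    exact h2
  have hq := hasDerivAt_quadForm hu hN
  have hL := ((hlog.const_mul (1 / 2)).const_sub (-((m : ℝ) / 2) * Real.log (2 * Real.pi))).sub
    (hq.const_mul (1 / 2))
  have hη := (suff y).hasFDerivAt.comp_hasDerivAt (0 : ℝ)
    (hline (contDiffAt_natParam hmu hSig hd))
  -- The same log-density along a line, differentiated through the natural parameter and directly;
  -- uniqueness of derivatives equates the results.
  have heq : (suff y ∘ fun s : ℝ => natParam mu Sig (θ + s • e)) =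
      fun s : ℝ => logDens (mu (θ + s • e)) (Sig (θ + s • e)) y := by
    ext s; exact suff_natParam mu Sig _ y
  rw [heq] at hη
  rw [hη.unique hL]
  have hsym : (Sig θ)⁻¹ᵀ = (Sig θ)⁻¹ := by
    have := hpd.self_of_nhds.inv.isHermitian
    rwa [Matrix.IsHermitian, Matrix.conjTranspose_eq_transpose_of_trivial] at this
  simp only [zero_smul, add_zero, hNe, WithLp.ofLp_neg]
  set x := (y - mu θ).ofLp
  set u := (fderiv ℝ mu θ e).ofLp
  have e1 : u ⬝ᵥ (Sig θ)⁻¹ *ᵥ x = ((Sig θ)⁻¹ *ᵥ u) ⬝ᵥ x := by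
    rw [Matrix.dotProduct_mulVec, ← Matrix.mulVec_transpose, hsym]
  have e2 : x ⬝ᵥ (Sig θ)⁻¹ *ᵥ u = ((Sig θ)⁻¹ *ᵥ u) ⬝ᵥ x := dotProduct_comm _ _
  rw [neg_dotProduct, Matrix.neg_mulVec, Matrix.mulVec_neg, dotProduct_add, dotProduct_neg,
    dotProduct_neg, e1, e2, Matrix.smul_mulVec, dotProduct_smul, smul_eq_mul]
  ring

end Score

/-! ### Second moments of the score and the matrices J and K -/

section Information

variable {m d : ℕ} {mu : EuclideanSpace ℝ (Fin d) → EuclideanSpace ℝ (Fin m)}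
  {Sig : EuclideanSpace ℝ (Fin d) → Matrix (Fin m) (Fin m) ℝ} {θ : EuclideanSpace ℝ (Fin d)}

lemma exists_hasFDerivAt_part_suff (hpd : (Sig θ).PosDef) {τ : ℝ} (hτ : 0 ≤ τ) :
    ∃ δ > 0, ∀ v ∈ Metric.ball (natParam mu Sig θ) δ,
      HasFDerivAt (part volume (1 + τ) suff) ((1 + τ) • partGrad volume (1 + τ) suff v) v ∧
      HasFDerivAt (partGrad volume (1 + τ) suff) (partHess volume (1 + τ) suff v) v ∧
      ContinuousAt (partHess volume (1 + τ) suff) v := by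
  obtain ⟨ε, hε, hint⟩ := exists_integrable_exp_mul_logDens_add hpd (mu θ) hτ continuous_suff
    norm_suff_le (suff_natParam mu Sig θ)
  exact exists_hasFDerivAt_part (by positivity) continuous_suff hε hint

lemma part_suff_natParam {t : EuclideanSpace ℝ (Fin d)} (hpd : (Sig t).PosDef) {τ : ℝ}
    (hτ : 0 ≤ τ) : part volume (1 + τ) suff (natParam mu Sig t) = kap m τ (Sig t).det := by
  simp only [part, suff_natParam, integral_exp_mul_logDens hpd hτ]

/-- The score has mean zero. -/
lemma integral_suff_fderiv_natParam (hη : DifferentiableAt ℝ (natParam mu Sig) θ)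
    (hpd : ∀ᶠ t in 𝓝 θ, (Sig t).PosDef) (e : EuclideanSpace ℝ (Fin d)) :
    ∫ y, suff y (fderiv ℝ (natParam mu Sig) θ e) ∂(multivariateGaussian (mu θ) (Sig θ)) = 0 := by
  have hS := hpd.self_of_nhds
  -- At τ = 0 the partition function is the total mass of the density, hence constantly 1 along the
  -- model, and its derivative is the mean of the score.
  obtain ⟨δ, hδ, h⟩ := exists_hasFDerivAt_part_suff (mu := mu) hS (le_refl (0 : ℝ))
  have h1 := (h _ (Metric.mem_ball_self hδ)).1.comp θ hη.hasFDerivAt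
  have h2 : HasFDerivAt (part volume (1 + 0) suff ∘ natParam mu Sig)
      (0 : EuclideanSpace ℝ (Fin d) →L[ℝ] ℝ) θ := by
    refine (hasFDerivAt_const (1 : ℝ) θ).congr_of_eventuallyEq ?_
    filter_upwards [hpd] with t ht
    rw [Function.comp_apply, part_suff_natParam ht le_rfl]
    simp [kap]
  have h3 := congrArg (fun l : EuclideanSpace ℝ (Fin d) →L[ℝ] ℝ => l e) (h1.unique h2)
  simp only [ContinuousLinearMap.comp_apply, smul_apply, zero_apply, smul_eq_mul] at h3
  rw [partGrad_apply hS le_rfl continuous_suff norm_suff_le (suff_natParam mu Sig θ)] at h3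
  have hk : kap m 0 (Sig θ).det ≠ 0 := (Real.exp_pos _).ne'
  simpa [hk] using h3

lemma transpose_dSig (hpd : ∀ᶠ t in 𝓝 θ, (Sig t).PosDef) (i : Fin d) :
    (dSig Sig θ i)ᵀ = dSig Sig θ i := by
  ext a b
  simp only [dSig, Matrix.transpose_apply, Matrix.of_apply]
  have : (fun t => Sig t b a) =ᶠ[𝓝 θ] fun t => Sig t a b := by
    filter_upwards [hpd] with t ht
    simpa using ht.isHermitian.apply a b
  rw [this.fderiv_eq]

/-- A mean-zero score forces the constant to cancel the mean of the quadratic part, half the trace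
of Σ⁻¹ ∂Σ. This takes the place of Jacobi's formula for the derivative of the determinant. -/
lemma suff_fderiv_natParam_single (hmu : ContDiffAt ℝ 1 mu θ)
    (hSig : ∀ a b, ContDiffAt ℝ 1 (fun t => Sig t a b) θ) (hpd : ∀ᶠ t in 𝓝 θ, (Sig t).PosDef)
    (i : Fin d) (y : EuclideanSpace ℝ (Fin m)) :
    suff y (fderiv ℝ (natParam mu Sig) θ (EuclideanSpace.single i 1)) =
      -(1 / 2) * ((Sig θ)⁻¹ * dSig Sig θ i).trace +
        ((Sig θ)⁻¹ *ᵥ dMu mu θ i) ⬝ᵥ (y - mu θ).ofLp +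
        (y - mu θ).ofLp ⬝ᵥ ((1 / 2 : ℝ) • ((Sig θ)⁻¹ * dSig Sig θ i * (Sig θ)⁻¹)) *ᵥ
          (y - mu θ).ofLp := by
  have hS := hpd.self_of_nhds
  obtain ⟨c, hc⟩ := exists_suff_fderiv_natParam hmu hSig hpd (EuclideanSpace.single i 1)
    (M := dSig Sig θ i) fun a b => rfl
  have h0 := integral_suff_fderiv_natParam ((contDiffAt_natParam hmu hSig
    hS.det_pos.ne').differentiableAt one_ne_zero) hpd (EuclideanSpace.single i 1)
  simp only [hc] at h0
  rw [integral_quadPoly_multivariateGaussian hS] at h0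
  have htr : (((1 / 2 : ℝ) • ((Sig θ)⁻¹ * dSig Sig θ i * (Sig θ)⁻¹)) * Sig θ).trace =
      1 / 2 * ((Sig θ)⁻¹ * dSig Sig θ i).trace := by
    rw [Matrix.smul_mul, Matrix.mul_assoc _ _ (Sig θ),
      Matrix.nonsing_inv_mul _ hS.det_pos.ne'.isUnit, Matrix.mul_one, Matrix.trace_smul,
      smul_eq_mul]
  rw [htr] at h0
  rw [hc y]
  have : c = -(1 / 2) * ((Sig θ)⁻¹ * dSig Sig θ i).trace := by linarith
  rw [this]
  rfl

lemma trace_quadCoeff {S M : Matrix (Fin m) (Fin m) ℝ} (hS : S.PosDef) (s : ℝ) :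
    (((1 / 2 : ℝ) • (S⁻¹ * M * S⁻¹)) * (s • S)).trace = s / 2 * (S⁻¹ * M).trace := by
  rw [Matrix.smul_mul, Matrix.mul_smul, Matrix.mul_assoc _ _ S,
    Matrix.nonsing_inv_mul _ hS.det_pos.ne'.isUnit, Matrix.mul_one, Matrix.trace_smul,
    Matrix.trace_smul, smul_eq_mul, smul_eq_mul]
  ring

lemma trace_quadCoeff_mul {S M N : Matrix (Fin m) (Fin m) ℝ} (hS : S.PosDef) (s : ℝ) :
    (((1 / 2 : ℝ) • (S⁻¹ * M * S⁻¹)) * (s • S) *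
      (((1 / 2 : ℝ) • (S⁻¹ * N * S⁻¹)) * (s • S))).trace =
      s ^ 2 / 4 * (S⁻¹ * N * S⁻¹ * M).trace := by
  have h : ∀ M : Matrix (Fin m) (Fin m) ℝ,
      ((1 / 2 : ℝ) • (S⁻¹ * M * S⁻¹)) * (s • S) = (s / 2) • (S⁻¹ * M) := fun M => by
    rw [Matrix.smul_mul, Matrix.mul_smul, Matrix.mul_assoc _ _ S,
      Matrix.nonsing_inv_mul _ hS.det_pos.ne'.isUnit, Matrix.mul_one, smul_smul]
    congr 1; ring
  rw [h, h, Matrix.smul_mul, Matrix.mul_smul, smul_smul, Matrix.trace_smul,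
    Matrix.trace_mul_comm, ← Matrix.mul_assoc, smul_eq_mul]
  ring

lemma dotProduct_smul_mulVec_inv {S : Matrix (Fin m) (Fin m) ℝ} (hS : S.PosDef) (s : ℝ)
    (u v : Fin m → ℝ) :
    (S⁻¹ *ᵥ u) ⬝ᵥ (s • S) *ᵥ (S⁻¹ *ᵥ v) = s * (S⁻¹ * Matrix.vecMulVec u v).trace := by
  rw [Matrix.smul_mulVec, Matrix.mulVec_mulVec, Matrix.mul_nonsing_inv _ hS.det_pos.ne'.isUnit,
    Matrix.one_mulVec, dotProduct_smul, smul_eq_mul, Matrix.mul_vecMulVec, Matrix.trace_vecMulVec]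

/-- Second moments of the score under the law with rescaled covariance. -/
lemma integral_score_mul_score (hmu : ContDiffAt ℝ 1 mu θ)
    (hSig : ∀ a b, ContDiffAt ℝ 1 (fun t => Sig t a b) θ) (hpd : ∀ᶠ t in 𝓝 θ, (Sig t).PosDef)
    {τ : ℝ} (hτ : 0 ≤ τ) (i j : Fin d) :
    ∫ y, suff y (fderiv ℝ (natParam mu Sig) θ (EuclideanSpace.single i 1)) *
        suff y (fderiv ℝ (natParam mu Sig) θ (EuclideanSpace.single j 1))
      ∂(multivariateGaussian (mu θ) ((1 + τ)⁻¹ • Sig θ)) =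
      ((1 + τ) ^ 2)⁻¹ * ((τ + 1) * meanTrace mu Sig θ i j + Delta τ Sig θ i * Delta τ Sig θ j
        + 1 / 2 * covTrace Sig θ i j) := by
  have hS := hpd.self_of_nhds
  simp only [suff_fderiv_natParam_single hmu hSig hpd]
  have hsym : (Sig θ)⁻¹ᵀ = (Sig θ)⁻¹ := by
    have := hS.inv.isHermitian
    rwa [Matrix.IsHermitian, Matrix.conjTranspose_eq_transpose_of_trivial] at this
  rw [integral_quadPoly_mul_quadPoly_multivariateGaussian (posDef_inv_smul hS hτ)]
  · rw [trace_quadCoeff hS, trace_quadCoeff hS, trace_quadCoeff_mul hS,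
      dotProduct_smul_mulVec_inv hS, Delta, Delta, meanTrace, covTrace]
    have : (1 + τ) ≠ 0 := by positivity
    field_simp
    ring
  · rw [Matrix.transpose_smul, Matrix.transpose_mul, Matrix.transpose_mul, hsym,
      transpose_dSig hpd, Matrix.mul_assoc]

lemma integral_score (hmu : ContDiffAt ℝ 1 mu θ)
    (hSig : ∀ a b, ContDiffAt ℝ 1 (fun t => Sig t a b) θ) (hpd : ∀ᶠ t in 𝓝 θ, (Sig t).PosDef)
    {τ : ℝ} (hτ : 0 ≤ τ) (i : Fin d) :
    ∫ y, suff y (fderiv ℝ (natParam mu Sig) θ (EuclideanSpace.single i 1))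
      ∂(multivariateGaussian (mu θ) ((1 + τ)⁻¹ • Sig θ)) = -((1 + τ)⁻¹ * Delta τ Sig θ i) := by
  have hS := hpd.self_of_nhds
  simp only [suff_fderiv_natParam_single hmu hSig hpd]
  rw [integral_quadPoly_multivariateGaussian (posDef_inv_smul hS hτ), trace_quadCoeff hS, Delta]
  have : (1 + τ) ≠ 0 := by positivity
  field_simp
  ring

lemma normConst_rpow (hS : (Sig θ).PosDef) (s : ℝ) : normConst Sig θ ^ s =
    Real.exp (-((m : ℝ) * s / 2) * Real.log (2 * Real.pi) - s / 2 * Real.log (Sig θ).det) := by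
  have hd := hS.det_pos
  have hp : (0 : ℝ) < 2 * Real.pi := by positivity
  rw [normConst, Real.rpow_def_of_pos hp, Real.rpow_def_of_pos hd, ← Real.exp_add, one_div,
    ← Real.exp_neg, Real.rpow_def_of_pos (Real.exp_pos _), Real.log_exp]
  congr 1
  ring

lemma kap_eq (hS : (Sig θ).PosDef) {τ : ℝ} (hτ : 0 ≤ τ) :
    kap m τ (Sig θ).det * ((1 + τ) ^ 2)⁻¹ =
      normConst Sig θ ^ τ * (1 / (1 + τ) ^ ((m : ℝ) / 2 + 2)) := by
  have h1 : (0 : ℝ) < 1 + τ := by positivity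
  rw [normConst_rpow hS, kap, sub_eq_add_neg, Real.exp_add, Real.rpow_add h1, one_div, mul_inv,
    mul_assoc, Real.rpow_def_of_pos h1, ← Real.exp_neg]
  congr 2
  · congr 1; ring
  · norm_num

lemma kap_sq_eq (hS : (Sig θ).PosDef) {τ : ℝ} (hτ : 0 ≤ τ) :
    kap m τ (Sig θ).det ^ 2 * ((1 + τ) ^ 2)⁻¹ =
      normConst Sig θ ^ (2 * τ) * (1 / (1 + τ) ^ ((m : ℝ) + 2)) := by
  have h1 : (0 : ℝ) < 1 + τ := by positivity
  rw [normConst_rpow hS, kap, sq, ← Real.exp_add, Real.rpow_add h1, one_div, mul_inv,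
    ← mul_assoc, Real.rpow_def_of_pos h1 (m : ℝ), ← Real.exp_neg, ← Real.exp_add]
  congr 2
  · ring
  · norm_num

/-- As a positive multiple of a Gram matrix of scores, J is seen to be positive semidefinite and can
be matched with the expected Hessian. -/
lemma matJ_apply (hmu : ContDiffAt ℝ 1 mu θ)
    (hSig : ∀ a b, ContDiffAt ℝ 1 (fun t => Sig t a b) θ) (hpd : ∀ᶠ t in 𝓝 θ, (Sig t).PosDef)
    {τ : ℝ} (hτ : 0 ≤ τ) (i j : Fin d) :
    matJ τ mu Sig θ i j = kap m τ (Sig θ).det *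
      ∫ y, suff y (fderiv ℝ (natParam mu Sig) θ (EuclideanSpace.single i 1)) *
        suff y (fderiv ℝ (natParam mu Sig) θ (EuclideanSpace.single j 1))
      ∂(multivariateGaussian (mu θ) ((1 + τ)⁻¹ • Sig θ)) := by
  rw [integral_score_mul_score hmu hSig hpd hτ, ← mul_assoc, kap_eq hpd.self_of_nhds hτ]
  rfl

/-- Squaring the weight φ^τ gives the law with covariance Σ/(1 + 2τ), and centring subtracts the
product of means, which is the negative Δ Δ term. K is thus the covariance of the gradient with its
factor 1 + τ removed. -/
lemma matK_apply (hmu : ContDiffAt ℝ 1 mu θ)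
    (hSig : ∀ a b, ContDiffAt ℝ 1 (fun t => Sig t a b) θ) (hpd : ∀ᶠ t in 𝓝 θ, (Sig t).PosDef)
    {τ : ℝ} (hτ : 0 ≤ τ) (i j : Fin d) :
    matK τ mu Sig θ i j =
      ∫ y, natGrad τ suff (natParam mu Sig θ) y
          (fderiv ℝ (natParam mu Sig) θ (EuclideanSpace.single i 1)) *
        natGrad τ suff (natParam mu Sig θ) y
          (fderiv ℝ (natParam mu Sig) θ (EuclideanSpace.single j 1))
      ∂(multivariateGaussian (mu θ) (Sig θ)) := by
  have hS := hpd.self_of_nhds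
  rw [integral_natGrad_mul_natGrad hS hτ continuous_suff norm_suff_le (suff_natParam mu Sig θ),
    integral_score_mul_score hmu hSig hpd (by positivity), ← mul_assoc,
    kap_eq hS (by positivity),
    partGrad_apply hS hτ continuous_suff norm_suff_le (suff_natParam mu Sig θ),
    partGrad_apply hS hτ continuous_suff norm_suff_le (suff_natParam mu Sig θ),
    integral_score hmu hSig hpd hτ, integral_score hmu hSig hpd hτ]
  have h2 : kap m τ (Sig θ).det * -((1 + τ)⁻¹ * Delta τ Sig θ i) *
      (kap m τ (Sig θ).det * -((1 + τ)⁻¹ * Delta τ Sig θ j)) =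
      kap m τ (Sig θ).det ^ 2 * ((1 + τ) ^ 2)⁻¹ * (Delta τ Sig θ i * Delta τ Sig θ j) := by
    rw [← inv_pow]; ring
  rw [h2, kap_sq_eq hS hτ, matK, Matrix.of_apply]
  ring

end Information

/-! ### Linear algebra of the matrices Q and P* -/

section LinearAlgebra

variable {d r : ℕ}

lemma clm_apply_eq_dotProduct {W : Type*} [NormedAddCommGroup W] [NormedSpace ℝ W]
    (l : EuclideanSpace ℝ (Fin d) →L[ℝ] W) (x : EuclideanSpace ℝ (Fin d)) :
    l x = ∑ i, x i • l (EuclideanSpace.single i 1) := by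
  conv_lhs => rw [← (EuclideanSpace.basisFun (Fin d) ℝ).sum_repr x, map_sum]
  simp

/-- The quadratic form of a matrix of second moments of a random linear form. -/
lemma dotProduct_mulVec_eq_integral {α : Type*} [MeasurableSpace α] {μ : Measure α}
    {L : α → EuclideanSpace ℝ (Fin d) →L[ℝ] ℝ} {M : Matrix (Fin d) (Fin d) ℝ}
    (hM : ∀ i j, M i j = ∫ y, L y (EuclideanSpace.single i 1) * L y (EuclideanSpace.single j 1) ∂μ)
    (hint : ∀ i j, Integrable
      (fun y => L y (EuclideanSpace.single i 1) * L y (EuclideanSpace.single j 1)) μ)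
    (h k : EuclideanSpace ℝ (Fin d)) :
    h.ofLp ⬝ᵥ M *ᵥ k.ofLp = ∫ y, L y h * L y k ∂μ := by
  have e : ∀ y, L y h * L y k = ∑ i, ∑ j, h i * k j *
      (L y (EuclideanSpace.single i 1) * L y (EuclideanSpace.single j 1)) := fun y => by
    rw [clm_apply_eq_dotProduct (L y) h, clm_apply_eq_dotProduct (L y) k, Finset.sum_mul_sum]
    refine Finset.sum_congr rfl fun i _ => Finset.sum_congr rfl fun j _ => ?_
    simp only [smul_eq_mul]; ring
  simp_rw [e]
  rw [integral_finsetSum _ fun i _ => integrable_finsetSum _ fun j _ => (hint i j).const_mul _]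
  simp only [dotProduct, Matrix.mulVec, Finset.mul_sum]
  refine Finset.sum_congr rfl fun i _ => ?_
  rw [integral_finsetSum _ fun j _ => (hint i j).const_mul _]
  refine Finset.sum_congr rfl fun j _ => ?_
  rw [integral_const_mul, hM]; ring

lemma posSemidef_of_eq_integral {α : Type*} [MeasurableSpace α] {μ : Measure α}
    {L : α → EuclideanSpace ℝ (Fin d) →L[ℝ] ℝ} {M : Matrix (Fin d) (Fin d) ℝ}
    (hM : ∀ i j, M i j = ∫ y, L y (EuclideanSpace.single i 1) * L y (EuclideanSpace.single j 1) ∂μ)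
    (hint : ∀ i j, Integrable
      (fun y => L y (EuclideanSpace.single i 1) * L y (EuclideanSpace.single j 1)) μ) :
    M.PosSemidef := by
  refine Matrix.PosSemidef.of_dotProduct_mulVec_nonneg ?_ fun x => ?_
  · ext i j
    rw [Matrix.conjTranspose_apply, star_trivial, hM, hM]
    simp_rw [mul_comm]
  · have := dotProduct_mulVec_eq_integral hM hint (WithLp.toLp 2 x) (WithLp.toLp 2 x)
    rw [star_trivial, this]
    exact integral_nonneg fun y => mul_self_nonneg _

lemma mulVec_injective_of_rank_eq {G : Matrix (Fin d) (Fin r) ℝ} (hG : G.rank = r) :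
    Function.Injective G.mulVec := by
  have h1 := LinearMap.finrank_range_add_finrank_ker G.mulVecLin
  have h2 : Module.finrank ℝ (LinearMap.range G.mulVecLin) = r := hG
  rw [h2, Module.finrank_fin_fun] at h1
  have h3 : Module.finrank ℝ (LinearMap.ker G.mulVecLin) = 0 := by omega
  exact LinearMap.ker_eq_bot.1 (Submodule.finrank_eq_zero.1 h3)

/-- Full column rank makes `G` injective, so the form of J⁻¹ pulled back along `G` remains positive
definite. -/
lemma isUnit_det_transpose_mul_inv_mul {J : Matrix (Fin d) (Fin d) ℝ} (hJ : J.PosDef)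
    {G : Matrix (Fin d) (Fin r) ℝ} (hG : G.rank = r) : IsUnit (Gᵀ * J⁻¹ * G).det := by
  have := hJ.inv.conjTranspose_mul_mul_same (mulVec_injective_of_rank_eq hG)
  rw [Matrix.conjTranspose_eq_transpose_of_trivial] at this
  exact this.det_pos.ne'.isUnit

variable {J : Matrix (Fin d) (Fin d) ℝ} {G : Matrix (Fin d) (Fin r) ℝ}

/-- P* and Q are the upper blocks of the inverse of the bordered matrix with blocks J, G, Gᵀ, 0.
This identity and the next two become the hypotheses `hPA`, `hPD`, `hDQ` of the constrained theorem.
-/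
lemma matP_mul (hJ : IsUnit J.det) : matP J G * J = 1 - matQ J G * Gᵀ := by
  rw [matP, Matrix.sub_mul, Matrix.nonsing_inv_mul _ hJ, Matrix.mul_assoc _ J⁻¹,
    Matrix.nonsing_inv_mul _ hJ, Matrix.mul_one]

lemma matP_mul_eq_zero (hG : IsUnit (Gᵀ * J⁻¹ * G).det) : matP J G * G = 0 := by
  rw [matP, Matrix.sub_mul, Matrix.mul_assoc (matQ J G), Matrix.mul_assoc (matQ J G), matQ,
    Matrix.mul_assoc (J⁻¹ * G), Matrix.nonsing_inv_mul _ hG, Matrix.mul_one, sub_self]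

lemma transpose_mul_matQ (hG : IsUnit (Gᵀ * J⁻¹ * G).det) : Gᵀ * matQ J G = 1 := by
  rw [matQ, ← Matrix.mul_assoc, ← Matrix.mul_assoc, Matrix.mul_nonsing_inv _ hG]

lemma ofLp_fderiv_eq (g : EuclideanSpace ℝ (Fin d) → EuclideanSpace ℝ (Fin r))
    (θ h : EuclideanSpace ℝ (Fin d)) : (fderiv ℝ g θ h).ofLp = (matG g θ)ᵀ *ᵥ h.ofLp := by
  ext k
  rw [clm_apply_eq_dotProduct]
  simp only [WithLp.ofLp_sum, Finset.sum_apply, WithLp.ofLp_smul, Pi.smul_apply, smul_eq_mul,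
    Matrix.mulVec, dotProduct, Matrix.transpose_apply, matG, Matrix.of_apply]
  exact Finset.sum_congr rfl fun i _ => mul_comm _ _

/-- The vector `c • M l`, for a linear form `l`. -/
def mulDual (c : ℝ) (M : Matrix (Fin d) (Fin d) ℝ) :
    (EuclideanSpace ℝ (Fin d) →L[ℝ] ℝ) →L[ℝ] EuclideanSpace ℝ (Fin d) :=
  LinearMap.toContinuousLinearMap
    { toFun := fun l => c • WithLp.toLp 2 (M *ᵥ fun i => l (EuclideanSpace.single i 1))
      map_add' := fun l l' => by
        rw [← smul_add, ← WithLp.toLp_add, ← Matrix.mulVec_add]; rfl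
      map_smul' := fun a l => by
        have : (fun i => (a • l) (EuclideanSpace.single i 1)) =
            a • fun i => l (EuclideanSpace.single i 1) := rfl
        rw [RingHom.id_apply, this, Matrix.mulVec_smul, WithLp.toLp_smul, smul_comm] }

lemma mulDual_apply (c : ℝ) (M : Matrix (Fin d) (Fin d) ℝ)
    (l : EuclideanSpace ℝ (Fin d) →L[ℝ] ℝ) :
    mulDual c M l = c • WithLp.toLp 2 (M *ᵥ fun i => l (EuclideanSpace.single i 1)) := rfl

/-- Multiplication by a rectangular matrix. -/
def mulRect (M : Matrix (Fin d) (Fin r) ℝ) :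
    EuclideanSpace ℝ (Fin r) →L[ℝ] EuclideanSpace ℝ (Fin d) :=
  LinearMap.toContinuousLinearMap
    { toFun := fun x => WithLp.toLp 2 (M *ᵥ x.ofLp)
      map_add' := fun x y => by rw [WithLp.ofLp_add, Matrix.mulVec_add, WithLp.toLp_add]
      map_smul' := fun a x => by
        rw [RingHom.id_apply, WithLp.ofLp_smul, Matrix.mulVec_smul, WithLp.toLp_smul] }

lemma mulRect_apply (M : Matrix (Fin d) (Fin r) ℝ) (x : EuclideanSpace ℝ (Fin r)) :
    mulRect M x = WithLp.toLp 2 (M *ᵥ x.ofLp) := rfl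

lemma mulDual_eq_sub {c : ℝ} (hc : c ≠ 0) (hJ : IsUnit J.det) (hJs : Jᵀ = J)
    {g : EuclideanSpace ℝ (Fin d) → EuclideanSpace ℝ (Fin r)} {θ : EuclideanSpace ℝ (Fin d)}
    (hG : matG g θ = G) {A : EuclideanSpace ℝ (Fin d) →L[ℝ] EuclideanSpace ℝ (Fin d) →L[ℝ] ℝ}
    (hA : ∀ h k, A h k = c * (h.ofLp ⬝ᵥ J *ᵥ k.ofLp)) (h : EuclideanSpace ℝ (Fin d)) :
    mulDual c⁻¹ (matP J G) (A h) = h - mulRect (matQ J G) (fderiv ℝ g θ h) := by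
  have h1 : (fun i => A h (EuclideanSpace.single i 1)) = c • (J *ᵥ h.ofLp) := by
    ext i
    rw [hA, Matrix.dotProduct_mulVec, ← Matrix.mulVec_transpose, hJs]
    simp
  rw [mulDual_apply, h1, Matrix.mulVec_smul, WithLp.toLp_smul, smul_smul, inv_mul_cancel₀ hc,
    one_smul, Matrix.mulVec_mulVec, matP_mul hJ, Matrix.sub_mulVec, Matrix.one_mulVec,
    mulRect_apply, ofLp_fderiv_eq, hG, Matrix.mulVec_mulVec]
  rfl

lemma mulDual_comp_eq_zero (c : ℝ) (hGu : IsUnit (Gᵀ * J⁻¹ * G).det)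
    {g : EuclideanSpace ℝ (Fin d) → EuclideanSpace ℝ (Fin r)} {θ : EuclideanSpace ℝ (Fin d)}
    (hG : matG g θ = G) (l : EuclideanSpace ℝ (Fin r) →L[ℝ] ℝ) :
    mulDual c (matP J G) (l.comp (fderiv ℝ g θ)) = 0 := by
  have h1 : (fun i => l.comp (fderiv ℝ g θ) (EuclideanSpace.single i 1)) =
      G *ᵥ fun k => l (EuclideanSpace.single k 1) := by
    ext i
    rw [ContinuousLinearMap.comp_apply, clm_apply_eq_dotProduct]
    simp [Matrix.mulVec, dotProduct, ← hG, matG]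
  rw [mulDual_apply, h1, Matrix.mulVec_mulVec, matP_mul_eq_zero hGu, Matrix.zero_mulVec]
  simp

lemma fderiv_mulRect (hGu : IsUnit (Gᵀ * J⁻¹ * G).det)
    {g : EuclideanSpace ℝ (Fin d) → EuclideanSpace ℝ (Fin r)} {θ : EuclideanSpace ℝ (Fin d)}
    (hG : matG g θ = G) (x : EuclideanSpace ℝ (Fin r)) :
    fderiv ℝ g θ (mulRect (matQ J G) x) = x := by
  have := ofLp_fderiv_eq g θ (mulRect (matQ J G) x)
  rw [mulRect_apply, hG, Matrix.mulVec_mulVec, transpose_mul_matQ hGu, Matrix.one_mulVec] at this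
  exact (WithLp.ofLp_injective 2) this

lemma inner_mulDual (c : ℝ) (M : Matrix (Fin d) (Fin d) ℝ) (l : EuclideanSpace ℝ (Fin d) →L[ℝ] ℝ)
    (x : EuclideanSpace ℝ (Fin d)) :
    inner ℝ (mulDual c M l) x = c * l (WithLp.toLp 2 (Mᵀ *ᵥ x.ofLp)) := by
  rw [mulDual_apply, inner_smul_left, clm_apply_eq_dotProduct l]
  simp only [PiLp.inner_apply, conj_trivial, smul_eq_mul]
  congr 1
  have : ∀ u : Fin d → ℝ, x.ofLp ⬝ᵥ M *ᵥ u = (Mᵀ *ᵥ x.ofLp) ⬝ᵥ u := fun u => by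
    rw [Matrix.dotProduct_mulVec, Matrix.mulVec_transpose]
  have h := this fun i => l (EuclideanSpace.single i 1)
  simp only [dotProduct] at h
  rw [← h]
  rfl

end LinearAlgebra

/-! ### Asymptotic normality of a consistent restricted estimator -/

section AsymptoticNormality

variable {m d r : ℕ} {mu : EuclideanSpace ℝ (Fin d) → EuclideanSpace ℝ (Fin m)}
  {Sig : EuclideanSpace ℝ (Fin d) → Matrix (Fin m) (Fin m) ℝ} {θ : EuclideanSpace ℝ (Fin d)}

/-- A Gaussian density is at most its value at the mode, which depends only on log det Σ(t). The `-
1` leaves room for that continuous function to vary near θ. -/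
lemma eventually_exp_mul_suff_le (hSig : ∀ a b, ContDiffAt ℝ 1 (fun t => Sig t a b) θ)
    (hpd : ∀ᶠ t in 𝓝 θ, (Sig t).PosDef) {τ : ℝ} (hτ : 0 ≤ τ) :
    ∃ c, ∀ᶠ t in 𝓝 θ, ∀ y, Real.exp (τ * suff y (natParam mu Sig t)) ≤ c := by
  have hlog : ContinuousAt (fun t => Real.log (Sig t).det) θ :=
    ((ContDiffAt.matrix_det hSig).log hpd.self_of_nhds.det_pos.ne').continuousAt
  refine ⟨Real.exp (τ * (-((m : ℝ) / 2) * Real.log (2 * Real.pi) -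
    1 / 2 * (Real.log (Sig θ).det - 1))), ?_⟩
  filter_upwards [hpd, hlog.eventually_const_lt (sub_one_lt _)] with t ht hl y
  refine (exp_mul_apply_le ht hτ (suff_natParam mu Sig t) y).trans (Real.exp_le_exp.2 ?_)
  gcongr

lemma continuous_natGrad_suff (τ : ℝ) (v : NatParam m) : Continuous (natGrad τ suff v) := by
  have h1 : Continuous fun y : EuclideanSpace ℝ (Fin m) => Real.exp (τ * suff y v) := by
    have := continuous_suff.clm_apply (continuous_const (y := v))
    fun_prop
  exact (h1.smul continuous_suff).sub continuous_const

lemma exists_norm_natGrad_suff_le (hS : (Sig θ).PosDef) {τ : ℝ} (hτ : 0 ≤ τ) :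
    ∃ C, ∀ y, ‖natGrad τ suff (natParam mu Sig θ) y‖ ≤ C * (1 + ‖y‖ ^ 2) :=
  ⟨_, fun y => norm_natGrad_le (norm_suff_le y)
    (exp_mul_apply_le hS hτ (suff_natParam mu Sig θ) y) le_rfl⟩

lemma integrable_natGrad_mul_natGrad (hS : (Sig θ).PosDef) {τ : ℝ} (hτ : 0 ≤ τ)
    (a b : NatParam m) :
    Integrable (fun y => natGrad τ suff (natParam mu Sig θ) y a *
      natGrad τ suff (natParam mu Sig θ) y b) (multivariateGaussian (mu θ) (Sig θ)) := by
  obtain ⟨C, hC⟩ := exists_norm_natGrad_suff_le (mu := mu) hS hτ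
  exact integrable_apply_mul_apply (continuous_natGrad_suff τ _) hC _ a b

/-- The information matrix as a bilinear form. -/
lemma dotProduct_matJ_mulVec (hmu : ContDiffAt ℝ 1 mu θ)
    (hSig : ∀ a b, ContDiffAt ℝ 1 (fun t => Sig t a b) θ) (hpd : ∀ᶠ t in 𝓝 θ, (Sig t).PosDef)
    {τ : ℝ} (hτ : 0 ≤ τ) (h k : EuclideanSpace ℝ (Fin d)) :
    h.ofLp ⬝ᵥ matJ τ mu Sig θ *ᵥ k.ofLp = kap m τ (Sig θ).det *
      ∫ y, suff y (fderiv ℝ (natParam mu Sig) θ h) * suff y (fderiv ℝ (natParam mu Sig) θ k)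
      ∂(multivariateGaussian (mu θ) ((1 + τ)⁻¹ • Sig θ)) := by
  have hk : kap m τ (Sig θ).det ≠ 0 := (Real.exp_pos _).ne'
  have := dotProduct_mulVec_eq_integral
    (μ := multivariateGaussian (mu θ) ((1 + τ)⁻¹ • Sig θ))
    (L := fun y => (suff y).comp (fderiv ℝ (natParam mu Sig) θ))
    (M := (kap m τ (Sig θ).det)⁻¹ • matJ τ mu Sig θ)
    (fun i j => by
      rw [Matrix.smul_apply, matJ_apply hmu hSig hpd hτ, smul_eq_mul, inv_mul_cancel_left₀ hk]
      rfl)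
    (fun i j => integrable_apply_mul_apply continuous_suff norm_suff_le _ _ _) h k
  simp only [ContinuousLinearMap.comp_apply] at this
  rw [← this, Matrix.smul_mulVec, dotProduct_smul, smul_eq_mul, mul_inv_cancel_left₀ hk]

lemma posSemidef_matJ (hmu : ContDiffAt ℝ 1 mu θ)
    (hSig : ∀ a b, ContDiffAt ℝ 1 (fun t => Sig t a b) θ) (hpd : ∀ᶠ t in 𝓝 θ, (Sig t).PosDef)
    {τ : ℝ} (hτ : 0 ≤ τ) : (matJ τ mu Sig θ).PosSemidef := by
  refine Matrix.PosSemidef.of_dotProduct_mulVec_nonneg ?_ fun x => ?_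
  · ext i j
    rw [Matrix.conjTranspose_apply, star_trivial, matJ_apply hmu hSig hpd hτ,
      matJ_apply hmu hSig hpd hτ]
    simp_rw [mul_comm]
  · have := dotProduct_matJ_mulVec hmu hSig hpd hτ (WithLp.toLp 2 x) (WithLp.toLp 2 x)
    rw [star_trivial, this]
    exact mul_nonneg (Real.exp_pos _).le (integral_nonneg fun y => mul_self_nonneg _)

lemma dotProduct_matK_mulVec (hmu : ContDiffAt ℝ 1 mu θ)
    (hSig : ∀ a b, ContDiffAt ℝ 1 (fun t => Sig t a b) θ) (hpd : ∀ᶠ t in 𝓝 θ, (Sig t).PosDef)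
    {τ : ℝ} (hτ : 0 ≤ τ) (h k : EuclideanSpace ℝ (Fin d)) :
    h.ofLp ⬝ᵥ matK τ mu Sig θ *ᵥ k.ofLp =
      ∫ y, natGrad τ suff (natParam mu Sig θ) y (fderiv ℝ (natParam mu Sig) θ h) *
        natGrad τ suff (natParam mu Sig θ) y (fderiv ℝ (natParam mu Sig) θ k)
      ∂(multivariateGaussian (mu θ) (Sig θ)) :=
  dotProduct_mulVec_eq_integral
    (L := fun y => (natGrad τ suff (natParam mu Sig θ) y).comp (fderiv ℝ (natParam mu Sig) θ))
    (matK_apply hmu hSig hpd hτ)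
    (fun _ _ => integrable_natGrad_mul_natGrad hpd.self_of_nhds hτ _ _) h k

lemma posSemidef_matK (hmu : ContDiffAt ℝ 1 mu θ)
    (hSig : ∀ a b, ContDiffAt ℝ 1 (fun t => Sig t a b) θ) (hpd : ∀ᶠ t in 𝓝 θ, (Sig t).PosDef)
    {τ : ℝ} (hτ : 0 ≤ τ) : (matK τ mu Sig θ).PosSemidef :=
  posSemidef_of_eq_integral
    (L := fun y => (natGrad τ suff (natParam mu Sig θ) y).comp (fderiv ℝ (natParam mu Sig) θ))
    (matK_apply hmu hSig hpd hτ)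
    (fun _ _ => integrable_natGrad_mul_natGrad hpd.self_of_nhds hτ _ _)

lemma posSemidef_matM {g : EuclideanSpace ℝ (Fin d) → EuclideanSpace ℝ (Fin r)}
    (hmu : ContDiffAt ℝ 1 mu θ)
    (hSig : ∀ a b, ContDiffAt ℝ 1 (fun t => Sig t a b) θ) (hpd : ∀ᶠ t in 𝓝 θ, (Sig t).PosDef)
    {τ : ℝ} (hτ : 0 ≤ τ) : (matM τ mu Sig g θ).PosSemidef := by
  have := (posSemidef_matK hmu hSig hpd hτ).mul_mul_conjTranspose_same
    (matP (matJ τ mu Sig θ) (matG g θ))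
  rwa [Matrix.conjTranspose_eq_transpose_of_trivial] at this

/-- The term with the second derivative of the natural parameter is paired with `natGrad`, which has
mean zero. Hence only first derivatives of μ and Σ enter J. -/
lemma integral_dpdHess_apply (hmu : ContDiffAt ℝ 1 mu θ)
    (hSig : ∀ a b, ContDiffAt ℝ 1 (fun t => Sig t a b) θ) (hpd : ∀ᶠ t in 𝓝 θ, (Sig t).PosDef)
    {τ : ℝ} (hτ : 0 ≤ τ) (h k : EuclideanSpace ℝ (Fin d)) :
    ∫ y, dpdHess τ suff (natParam mu Sig) θ y h k ∂(multivariateGaussian (mu θ) (Sig θ)) =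
      -((1 + τ) * (h.ofLp ⬝ᵥ matJ τ mu Sig θ *ᵥ k.ofLp)) := by
  have hS := hpd.self_of_nhds
  simp only [dpdHess_apply]
  rw [integral_const_mul, integral_add
    (integrable_natGrad_apply hS hτ continuous_suff norm_suff_le (suff_natParam mu Sig θ) _)
    (integrable_natHess_apply hS hτ continuous_suff norm_suff_le (suff_natParam mu Sig θ) _ _),
    integral_natGrad_apply hS hτ continuous_suff norm_suff_le (suff_natParam mu Sig θ),
    integral_natHess_apply hS hτ continuous_suff norm_suff_le (suff_natParam mu Sig θ),
    dotProduct_matJ_mulVec hmu hSig hpd hτ]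
  ring

lemma dpdGrad_apply (τ : ℝ) (η : EuclideanSpace ℝ (Fin d) → NatParam m)
    (t : EuclideanSpace ℝ (Fin d)) (y : EuclideanSpace ℝ (Fin m)) (h : EuclideanSpace ℝ (Fin d)) :
    dpdGrad τ suff η t y h = (1 + τ) * natGrad τ suff (η t) y (fderiv ℝ η t h) := rfl

lemma continuous_dpdGrad_suff (τ : ℝ) (η : EuclideanSpace ℝ (Fin d) → NatParam m)
    (t : EuclideanSpace ℝ (Fin d)) : Continuous (dpdGrad τ suff η t) :=
  ((continuous_natGrad_suff τ (η t)).clm_comp continuous_const).const_smul (1 + τ)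

lemma exists_norm_dpdGrad_suff_le (hS : (Sig θ).PosDef) {τ : ℝ} (hτ : 0 ≤ τ) :
    ∃ C, ∀ y, ‖dpdGrad τ suff (natParam mu Sig) θ y‖ ≤ C * (1 + ‖y‖ ^ 2) := by
  obtain ⟨C, hC⟩ := exists_norm_natGrad_suff_le (mu := mu) hS hτ
  refine ⟨(1 + τ) * (C * ‖fderiv ℝ (natParam mu Sig) θ‖), fun y => ?_⟩
  rw [dpdGrad, norm_smul, Real.norm_of_nonneg (by positivity), mul_assoc]
  refine mul_le_mul_of_nonneg_left ?_ (by positivity)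
  calc _ ≤ ‖natGrad τ suff (natParam mu Sig θ) y‖ * ‖fderiv ℝ (natParam mu Sig) θ‖ :=
        ContinuousLinearMap.opNorm_comp_le _ _
    _ ≤ C * (1 + ‖y‖ ^ 2) * ‖fderiv ℝ (natParam mu Sig) θ‖ := by gcongr; exact hC y
    _ = _ := by ring

lemma memLp_two_of_norm_le {H B : Type*} [NormedAddCommGroup H] [NormedSpace ℝ H]
    [FiniteDimensional ℝ H] [MeasurableSpace H] [BorelSpace H] [NormedAddCommGroup B]
    (μ : Measure H) [IsGaussian μ] {f : H → B} (hf : AEStronglyMeasurable f μ) {C : ℝ}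
    (h : ∀ y, ‖f y‖ ≤ C * (1 + ‖y‖ ^ 2)) : MemLp f 2 μ := by
  rw [memLp_two_iff_integrable_sq_norm hf]
  refine integrable_of_norm_le_pow μ (hf.norm.pow 2) (C ^ 2) 2 fun y => ?_
  rw [Real.norm_of_nonneg (by positivity), ← mul_pow]
  exact pow_le_pow_left₀ (norm_nonneg _) (h y) 2

lemma integral_dpdGrad_suff (hpd : (Sig θ).PosDef) {τ : ℝ} (hτ : 0 ≤ τ) :
    ∫ y, dpdGrad τ suff (natParam mu Sig) θ y ∂(multivariateGaussian (mu θ) (Sig θ)) = 0 := by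
  obtain ⟨C, hC⟩ := exists_norm_dpdGrad_suff_le (mu := mu) hpd hτ
  have hint := (memLp_two_of_norm_le (multivariateGaussian (mu θ) (Sig θ))
    (continuous_dpdGrad_suff τ _ θ).aestronglyMeasurable hC).integrable one_le_two
  ext h
  rw [ContinuousLinearMap.integral_apply hint]
  simp only [dpdGrad_apply]
  rw [integral_const_mul,
    integral_natGrad_apply hpd hτ continuous_suff norm_suff_le (suff_natParam mu Sig θ)]
  simp

variable {Ω : Type*} [MeasurableSpace Ω] {P : Measure Ω} [IsProbabilityMeasure P]

/-- Asymptotic normality of a consistent constrained estimator. -/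
theorem tendstoInDistribution_of_consistent {τ : ℝ} (hτ : 0 ≤ τ)
    {g : EuclideanSpace ℝ (Fin d) → EuclideanSpace ℝ (Fin r)}
    {Θ : Set (EuclideanSpace ℝ (Fin d))} (hΘ : Θ ∈ 𝓝 θ) (hgθ : g θ = 0)
    (hpd : ∀ᶠ t in 𝓝 θ, (Sig t).PosDef)
    (hmu : ContDiffAt ℝ 2 mu θ) (hSig : ∀ a b, ContDiffAt ℝ 2 (fun t => Sig t a b) θ)
    (hg : ContDiffAt ℝ 1 g θ) (hJ : IsUnit (matJ τ mu Sig θ).det)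
    (hGJ : IsUnit ((matG g θ)ᵀ * (matJ τ mu Sig θ)⁻¹ * matG g θ).det)
    {Y : ℕ → Ω → EuclideanSpace ℝ (Fin m)} (hindep : iIndepFun Y P)
    (hlaw : ∀ i, HasLaw (Y i) (multivariateGaussian (mu θ) (Sig θ)) P)
    {est : ℕ → Ω → EuclideanSpace ℝ (Fin d)} (hmeas : ∀ n, AEMeasurable (est n) P)
    (hcons : ∀ ε > 0, HoldsWHP P (fun n ω => ‖est n ω - θ‖ < ε))
    (hmax : HoldsWHP P (fun n ω => g (est n ω) = 0 ∧
      IsMaxOn (fun t => (n : ℝ)⁻¹ *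
          ∑ i ∈ Finset.range n, dpd τ suff (natParam mu Sig) t (Y i ω))
        {t | t ∈ Θ ∧ g t = 0} (est n ω))) :
    TendstoInDistribution (fun (n : ℕ) ω => Real.sqrt n • (est n ω - θ)) atTop
      (id : EuclideanSpace ℝ (Fin d) → EuclideanSpace ℝ (Fin d)) (fun _ => P)
      (multivariateGaussian 0 (matM τ mu Sig g θ)) := by
  have hS := hpd.self_of_nhds
  have hmu1 := hmu.of_le (one_le_two)
  have hSig1 : ∀ a b, ContDiffAt ℝ 1 (fun t => Sig t a b) θ := fun a b =>
    (hSig a b).of_le one_le_two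
  have hη := contDiffAt_natParam hmu hSig hS.det_pos.ne'
  obtain ⟨δ₀, hδ₀, hpart⟩ := exists_hasFDerivAt_part_suff (mu := mu) hS hτ
  obtain ⟨c, hc⟩ := eventually_exp_mul_suff_le (mu := mu) hSig1 hpd hτ
  obtain ⟨ρ, hρ, hd1, hd2, hcont, C, hC⟩ := exists_ball_dpd hτ continuous_suff norm_suff_le hη
    hδ₀ hpart hc
  set N := multivariateGaussian (mu θ) (Sig θ) with hN
  have hb : Integrable (fun y => C * (1 + ‖y‖ ^ 2) ^ 2) N := by
    have h1 : Integrable (fun y : EuclideanSpace ℝ (Fin m) => (1 + ‖y‖ ^ 2) ^ 2) N :=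
      integrable_of_norm_le_pow _ (Continuous.aestronglyMeasurable (by fun_prop)) 1 2 fun y => by
        rw [Real.norm_of_nonneg (by positivity), one_mul]
    exact h1.const_mul C
  obtain ⟨CG, hCG⟩ := exists_norm_dpdGrad_suff_le (mu := mu) hS hτ
  have hg2 : MemLp (dpdGrad τ suff (natParam mu Sig) θ) 2 N :=
    memLp_two_of_norm_le N (continuous_dpdGrad_suff τ _ θ).aestronglyMeasurable hCG
  have hg0 := integral_dpdGrad_suff (mu := mu) hS hτ
  have hHc : Continuous (dpdHess τ suff (natParam mu Sig) θ) := by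
    refine hcont.comp_continuous (f := fun y : EuclideanSpace ℝ (Fin m) => (y, θ)) (by fun_prop)
      fun y => ⟨trivial, Metric.mem_ball_self hρ⟩
  have hA : ∀ h k, (-∫ y, dpdHess τ suff (natParam mu Sig) θ y ∂N) h k =
      (1 + τ) * (h.ofLp ⬝ᵥ matJ τ mu Sig θ *ᵥ k.ofLp) := fun h k => by
    rw [neg_apply, neg_apply, integral_apply_apply_of_norm_le hHc.aestronglyMeasurable hb
      (fun y => hC θ (Metric.mem_ball_self hρ) y), integral_dpdHess_apply hmu1 hSig1 hpd hτ,
      neg_neg]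
  have hnn : ∫ y, dpdHess τ suff (natParam mu Sig) θ y ∂N =
      -(-∫ y, dpdHess τ suff (natParam mu Sig) θ y ∂N) := by
    ext h k
    simp only [neg_apply, neg_neg]
  have hτ1 : (1 + τ) ≠ 0 := by positivity
  have hJs : (matJ τ mu Sig θ)ᵀ = matJ τ mu Sig θ := by
    have := (posSemidef_matJ hmu1 hSig1 hpd hτ).isHermitian
    rwa [Matrix.IsHermitian, Matrix.conjTranspose_eq_transpose_of_trivial] at this
  -- The factor (1 + τ)⁻¹ compensates the Hessian -(1 + τ) J. The gradient carries the factor 1 + τ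
  -- as well, so the limit covariance is exactly P* K P*ᵀ.
  set Pm := mulDual (1 + τ)⁻¹ (matP (matJ τ mu Sig θ) (matG g θ)) with hPm
  have hlin := fun (δ : ℝ) (hδ : 0 < δ) => holdsWHP_constrained_asymptotically_linear hindep hlaw
    hρ (dpd τ suff (natParam mu Sig)) (dpdGrad τ suff (natParam mu Sig))
    (dpdHess τ suff (natParam mu Sig)) hd1 hd2 hcont _ hb hC (continuous_dpdGrad_suff τ _ θ)
    hg2 hg0 (-∫ y, dpdHess τ suff (natParam mu Sig) θ y ∂N) hnn g hg hgθ Pm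
    (mulRect (matQ (matJ τ mu Sig θ) (matG g θ))) (mulDual_eq_sub hτ1 hJ hJs rfl hA)
    (mulDual_comp_eq_zero _ hGJ rfl) (fderiv_mulRect hGJ rfl) Θ hΘ est hcons hmax hδ
  have hclt := tendstoInDistribution_normalizedSum hindep hlaw
    (f := fun y => Pm (dpdGrad τ suff (natParam mu Sig) θ y))
    (Pm.continuous.comp (continuous_dpdGrad_suff τ _ θ)) (Pm.comp_memLp' hg2)
    (by rw [Pm.integral_comp_comm (hg2.integrable one_le_two), hg0, map_zero])
    (matM τ mu Sig g θ) (posSemidef_matM hmu1 hSig1 hpd hτ) (fun x => by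
      simp only [hPm, inner_mulDual, dpdGrad_apply, inv_mul_cancel_left₀ hτ1]
      have := dotProduct_matK_mulVec hmu1 hSig1 hpd hτ
        (WithLp.toLp 2 ((matP (matJ τ mu Sig θ) (matG g θ))ᵀ *ᵥ x.ofLp))
        (WithLp.toLp 2 ((matP (matJ τ mu Sig θ) (matG g θ))ᵀ *ᵥ x.ofLp))
      simp only [sq]
      rw [← this, matM, ← Matrix.mulVec_mulVec, ← Matrix.mulVec_mulVec,
        Matrix.dotProduct_mulVec x.ofLp, ← Matrix.mulVec_transpose])
  -- Slutsky: the difference from the linearized statistic tends to zero in probability.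
  refine tendstoInDistribution_of_tendstoInMeasure_sub _ _ hclt ?_ fun n =>
    ((hmeas n).sub_const θ).const_smul (Real.sqrt n)
  rw [tendstoInMeasure_iff_norm]
  intro ε hε
  refine tendsto_of_tendsto_of_tendsto_of_le_of_le tendsto_const_nhds (hlin ε hε)
    (fun _ => zero_le) fun n => measure_mono fun ω hω => ?_
  simp only [Set.mem_ofPred_eq, Pi.sub_apply, Pi.zero_apply, sub_zero, map_smul, map_sum] at hω ⊢
  exact not_lt.2 hω

end AsymptoticNormality

/-! ### The objective as a sample mean -/

section Objective

variable {m d r : ℕ} {mu : EuclideanSpace ℝ (Fin d) → EuclideanSpace ℝ (Fin m)}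
  {Sig : EuclideanSpace ℝ (Fin d) → Matrix (Fin m) (Fin m) ℝ}

lemma dpd_suff {τ : ℝ} (hτ : 0 ≤ τ) {t : EuclideanSpace ℝ (Fin d)} (ht : (Sig t).PosDef)
    (y : EuclideanSpace ℝ (Fin m)) :
    dpd τ suff (natParam mu Sig) t y =
      powLink τ (logDens (mu t) (Sig t) y) - kap m τ (Sig t).det := by
  rw [dpd, suff_natParam, part_suff_natParam ht hτ]

/-- At τ = 0 the partition function subtracted in `dpd` equals 1, while the log-likelihood has no
such term. The correction does not depend on the parameter, so maximizers are unaffected. -/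
lemma objective_eq {τ : ℝ} (hτ : 0 ≤ τ) {t : EuclideanSpace ℝ (Fin d)} (ht : (Sig t).PosDef)
    {n : ℕ} (hn : n ≠ 0) (y : ℕ → EuclideanSpace ℝ (Fin m)) :
    objective τ mu Sig n y t = (n : ℝ)⁻¹ *
      ∑ i ∈ Finset.range n, dpd τ suff (natParam mu Sig) t (y i) + if τ = 0 then 1 else 0 := by
  have hn' : (n : ℝ) ≠ 0 := Nat.cast_ne_zero.2 hn
  have hd := ht.det_pos
  simp only [dpd_suff hτ ht]
  rw [objective]
  split_ifs with h0
  · subst h0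
    have hk : kap m 0 (Sig t).det = 1 := by simp [kap]
    simp only [powLink, if_true, hk, logDens, Finset.sum_sub_distrib, Finset.sum_const,
      Finset.card_range, nsmul_eq_mul, ← Finset.mul_sum]
    field_simp
    ring
  · have hτ' : 0 < τ := lt_of_le_of_ne hτ (Ne.symm h0)
    have h1 : (0 : ℝ) < 1 + τ := by positivity
    have hp : (0 : ℝ) < 2 * Real.pi := by positivity
    set K := Real.exp (-((m : ℝ) * τ / 2) * Real.log (2 * Real.pi) - τ / 2 * Real.log (Sig t).det)
      with hK
    have e1 : ∀ i, Real.exp (τ * logDens (mu t) (Sig t) (y i)) =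
        K * Real.exp (-(τ / 2) * mahalanobisSq (mu t) (Sig t) (y i)) := fun i => by
      rw [hK, ← Real.exp_add, logDens]; congr 1; ring
    have e2 : kap m τ (Sig t).det = K * ((1 + τ) ^ ((m : ℝ) / 2))⁻¹ := by
      rw [kap, hK, Real.rpow_def_of_pos h1, ← Real.exp_neg, ← Real.exp_add]; congr 1; ring
    have e3 : ((2 * Real.pi) ^ ((m : ℝ) * τ / 2))⁻¹ * (Sig t).det ^ (-(τ / 2)) = K := by
      rw [Real.rpow_def_of_pos hp, Real.rpow_def_of_pos hd, hK, ← Real.exp_neg, ← Real.exp_add]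
      congr 1; ring
    have e4 : (1 + τ) ^ ((m : ℝ) / 2 + 1) = (1 + τ) ^ ((m : ℝ) / 2) * (1 + τ) := by
      rw [Real.rpow_add h1, Real.rpow_one]
    have h2 : (1 + τ) ^ ((m : ℝ) / 2) ≠ 0 := (Real.rpow_pos_of_pos h1 _).ne'
    simp only [powLink, h0, if_false, e1, e2, Finset.sum_sub_distrib, Finset.sum_const,
      Finset.card_range, nsmul_eq_mul, ← Finset.mul_sum, e4]
    rw [div_mul_eq_div_div, div_eq_mul_inv ((τ + 1) / τ), mul_assoc ((τ + 1) / τ), e3]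
    field_simp
    ring

end Objective

/-! ### Gaussian laws parametrized by standardizing affine maps -/

section Rows

variable {m : ℕ}

/-- A square matrix and a vector, given by rows. They stand for the Gaussian law for which the
corresponding affine map is a standardization. -/
abbrev Rows (m : ℕ) : Type := Fin m → EuclideanSpace ℝ (Fin m) × ℝ

/-- The matrix part of `Rows`. -/
def rowMat (p : Rows m) : Matrix (Fin m) (Fin m) ℝ := Matrix.of fun k j => (p k).1 j

/-- The mean of the Gaussian law standardized by `p`. -/
def rowMean (p : Rows m) : EuclideanSpace ℝ (Fin m) :=
  WithLp.toLp 2 ((rowMat p)⁻¹ *ᵥ fun k => (p k).2)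

/-- The covariance of the Gaussian law standardized by `p`. -/
def rowCov (p : Rows m) : Matrix (Fin m) (Fin m) ℝ := ((rowMat p)ᵀ * rowMat p)⁻¹

/-- The squared norm of the standardized observation. -/
def resid (p : Rows m) (y : EuclideanSpace ℝ (Fin m)) : ℝ :=
  ∑ k, (inner ℝ (p k).1 y - (p k).2) ^ 2

/-- The log-density of the Gaussian law standardized by `p`. -/
def rowLogDens (p : Rows m) (y : EuclideanSpace ℝ (Fin m)) : ℝ :=
  -((m : ℝ) / 2) * Real.log (2 * Real.pi) + Real.log |(rowMat p).det| - 1 / 2 * resid p y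

/-- `∫ φ^(1+τ)` for the density `φ` of the Gaussian law standardized by `p`. -/
def rowKap (τ : ℝ) (p : Rows m) : ℝ :=
  Real.exp (-((m : ℝ) * τ / 2) * Real.log (2 * Real.pi) + τ * Real.log |(rowMat p).det|
    - (m : ℝ) / 2 * Real.log (1 + τ))

/-- Take for the matrix `B` a symmetric square root of S⁻¹ and for the vector `B ν`. The choice is
not unique, since rotating the rows gives the same law; only the recovered mean and covariance
matter. -/
lemma exists_rows {S : Matrix (Fin m) (Fin m) ℝ} (hS : S.PosDef) (ν : EuclideanSpace ℝ (Fin m)) :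
    ∃ p : Rows m, (rowMat p).det ≠ 0 ∧ rowMean p = ν ∧ rowCov p = S := by
  obtain ⟨B, hB', hBB, -, -⟩ := exists_sqrt_multivariateGaussian hS.inv ν
  have hB : S⁻¹ = Bᵀ * B := by rw [hB', hBB]
  have hd : B.det ≠ 0 := fun h => by
    have := hS.inv.det_pos
    rw [hB, Matrix.det_mul, h, mul_zero] at this
    exact lt_irrefl _ this
  have hm : rowMat (fun k => (WithLp.toLp 2 (B k), (B *ᵥ ν.ofLp) k) : Rows m) = B := rfl
  refine ⟨fun k => (WithLp.toLp 2 (B k), (B *ᵥ ν.ofLp) k), by rwa [hm], ?_, ?_⟩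
  · rw [rowMean, hm]
    change WithLp.toLp 2 (B⁻¹ *ᵥ (B *ᵥ ν.ofLp)) = ν
    rw [Matrix.mulVec_mulVec, Matrix.nonsing_inv_mul _ hd.isUnit, Matrix.one_mulVec]
  · rw [rowCov, hm, ← hB, Matrix.nonsing_inv_nonsing_inv _ hS.det_pos.ne'.isUnit]

lemma posDef_rowCov {p : Rows m} (hp : (rowMat p).det ≠ 0) : (rowCov p).PosDef := by
  have h := Matrix.PosDef.one.conjTranspose_mul_mul_same (R := ℝ)
    (Matrix.mulVec_injective_of_det_ne_zero hp)
  rw [Matrix.mul_one, Matrix.conjTranspose_eq_transpose_of_trivial] at h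
  exact h.inv

lemma det_rowCov (p : Rows m) : (rowCov p).det = ((rowMat p).det ^ 2)⁻¹ := by
  rw [rowCov, Matrix.det_nonsing_inv, Matrix.det_mul, Matrix.det_transpose, Ring.inverse_eq_inv',
    sq]

lemma log_det_rowCov (p : Rows m) : Real.log (rowCov p).det = -2 * Real.log |(rowMat p).det| := by
  rw [det_rowCov, Real.log_inv, Real.log_pow, Real.log_abs]
  push_cast
  ring

lemma mahalanobisSq_row {p : Rows m} (hp : (rowMat p).det ≠ 0) (y : EuclideanSpace ℝ (Fin m)) :
    mahalanobisSq (rowMean p) (rowCov p) y = resid p y := by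
  have hu : IsUnit ((rowMat p)ᵀ * rowMat p).det := by
    rw [Matrix.det_mul, Matrix.det_transpose]; exact (mul_ne_zero hp hp).isUnit
  have h1 : rowMat p *ᵥ (y - rowMean p).ofLp = fun k => inner ℝ (p k).1 y - (p k).2 := by
    rw [WithLp.ofLp_sub, Matrix.mulVec_sub, rowMean, Matrix.mulVec_mulVec,
      Matrix.mul_nonsing_inv _ hp.isUnit, Matrix.one_mulVec]
    ext k
    simp only [Pi.sub_apply, Matrix.mulVec, dotProduct, rowMat, Matrix.of_apply, PiLp.inner_apply]
    congr 1
    exact Finset.sum_congr rfl fun j _ => mul_comm _ _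
  rw [mahalanobisSq, rowCov, Matrix.nonsing_inv_nonsing_inv _ hu, ← Matrix.mulVec_mulVec,
    Matrix.dotProduct_mulVec, ← Matrix.mulVec_transpose, Matrix.transpose_transpose, h1, resid]
  simp only [dotProduct, sq]

lemma logDens_row {p : Rows m} (hp : (rowMat p).det ≠ 0) (y : EuclideanSpace ℝ (Fin m)) :
    logDens (rowMean p) (rowCov p) y = rowLogDens p y := by
  rw [logDens, mahalanobisSq_row hp, log_det_rowCov, rowLogDens]; ring

lemma kap_row (τ : ℝ) (p : Rows m) : kap m τ (rowCov p).det = rowKap τ p := by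
  rw [kap, log_det_rowCov, rowKap]; congr 1; ring

lemma resid_nonneg (p : Rows m) (y : EuclideanSpace ℝ (Fin m)) : 0 ≤ resid p y :=
  Finset.sum_nonneg fun _ _ => sq_nonneg _

lemma continuous_rowMat_apply (k j : Fin m) : Continuous fun p : Rows m => rowMat p k j := by
  simp only [rowMat, Matrix.of_apply]
  fun_prop

lemma continuous_det_rowMat : Continuous fun p : Rows m => (rowMat p).det := by
  simp only [Matrix.det_apply]
  exact continuous_finsetSum _ fun σ _ =>
    (continuous_finsetProd _ fun i _ => continuous_rowMat_apply _ _).const_smul _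

lemma continuous_resid : Continuous fun x : EuclideanSpace ℝ (Fin m) × Rows m => resid x.2 x.1 := by
  unfold resid
  fun_prop

lemma resid_le (p : Rows m) (y : EuclideanSpace ℝ (Fin m)) :
    resid p y ≤ 2 * m * ‖p‖ ^ 2 * (1 + ‖y‖ ^ 2) := by
  have h : ∀ k, (inner ℝ (p k).1 y - (p k).2) ^ 2 ≤ 2 * ‖p‖ ^ 2 * (1 + ‖y‖ ^ 2) := fun k => by
    have h1 : ‖(p k).1‖ ≤ ‖p‖ := (norm_fst_le (p k)).trans (norm_le_pi_norm p k)
    have h2 : |(p k).2| ≤ ‖p‖ := (norm_snd_le (p k)).trans (norm_le_pi_norm p k)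
    have h3 : |inner ℝ (p k).1 y| ≤ ‖p‖ * ‖y‖ := (abs_real_inner_le_norm _ _).trans (by gcongr)
    have h4 := sq_le_sq' (abs_le.1 h3).1 (abs_le.1 h3).2
    have h5 := sq_le_sq' (abs_le.1 h2).1 (abs_le.1 h2).2
    nlinarith [sq_nonneg (inner ℝ (p k).1 y + (p k).2)]
  calc resid p y ≤ ∑ _k : Fin m, 2 * ‖p‖ ^ 2 * (1 + ‖y‖ ^ 2) := Finset.sum_le_sum fun k _ => h k
    _ = _ := by simp; ring

lemma continuousAt_rowCov_apply {p : Rows m} (hp : (rowMat p).det ≠ 0) (a b : Fin m) :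
    ContinuousAt (fun p => rowCov p a b) p := by
  have hc : ∀ k j, ContDiffAt ℝ 0 (fun p : Rows m => rowMat p k j) p := fun k j =>
    (contDiff_zero.2 (continuous_rowMat_apply k j)).contDiffAt
  refine (ContDiffAt.matrix_inv_apply (n := 0) (fun k j => ?_) ?_ a b).continuousAt
  · simp only [Matrix.mul_apply, Matrix.transpose_apply]
    exact ContDiffAt.sum fun i _ => (hc _ _).mul (hc _ _)
  · rw [Matrix.det_mul, Matrix.det_transpose]; exact mul_ne_zero hp hp

lemma continuousAt_rowMean {p : Rows m} (hp : (rowMat p).det ≠ 0) : ContinuousAt rowMean p := by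
  have hc : ∀ k j, ContDiffAt ℝ 0 (fun p : Rows m => rowMat p k j) p := fun k j =>
    (contDiff_zero.2 (continuous_rowMat_apply k j)).contDiffAt
  have h1 : ContinuousAt (fun p : Rows m => (rowMat p)⁻¹ *ᵥ fun k => (p k).2) p := by
    refine continuousAt_pi.2 fun a => ?_
    simp only [Matrix.mulVec, dotProduct]
    refine tendsto_finsetSum _ fun b _ => ?_
    refine Tendsto.mul (ContDiffAt.matrix_inv_apply (n := 0) hc hp a b).continuousAt ?_
    have : Continuous fun p : Rows m => (p b).2 := by fun_prop
    exact this.tendsto p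
  exact (PiLp.continuous_toLp 2 _).continuousAt.comp h1

end Rows

/-! ### The expected objective has a unique maximizer -/

section Uniqueness

variable {m : ℕ}

/-- The pointwise density power divergence, as a function of the log-densities. -/
def gap (τ u v : ℝ) : ℝ :=
  Real.exp u * (powLink τ u - powLink τ v) - Real.exp ((1 + τ) * u) + Real.exp ((1 + τ) * v)

/-- Strict convexity: for τ = 0 it is x + 1 < exp x at x = v - u, and for τ > 0 Bernoulli's
inequality with exponent 1 + τ at exp(u - v) - 1. -/
lemma gap_pos {τ : ℝ} (hτ : 0 ≤ τ) {u v : ℝ} (huv : u ≠ v) : 0 < gap τ u v := by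
  rw [gap]
  by_cases h0 : τ = 0
  · subst h0
    have h1 : v - u + 1 < Real.exp (v - u) := Real.add_one_lt_exp (sub_ne_zero.2 huv.symm)
    have h2 : Real.exp v = Real.exp u * Real.exp (v - u) := by
      rw [← Real.exp_add]; congr 1; ring
    simp only [powLink, if_true, add_zero, one_mul]
    rw [h2]
    nlinarith [Real.exp_pos u]
  · have hτ' : 0 < τ := lt_of_le_of_ne hτ (Ne.symm h0)
    have hs : Real.exp (u - v) - 1 ≠ 0 := by
      rw [sub_ne_zero, Ne, Real.exp_eq_one_iff, sub_eq_zero]; exact huv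
    have h1 := one_add_mul_self_lt_rpow_one_add (s := Real.exp (u - v) - 1)
      (by linarith [Real.exp_pos (u - v)]) hs (p := 1 + τ) (by linarith)
    rw [add_sub_cancel, ← Real.exp_mul] at h1
    have e1 : Real.exp ((1 + τ) * u) = Real.exp ((1 + τ) * v) * Real.exp ((u - v) * (1 + τ)) := by
      rw [← Real.exp_add]; congr 1; ring
    have e2 : Real.exp u * Real.exp (τ * v) = Real.exp ((1 + τ) * v) * Real.exp (u - v) := by
      rw [← Real.exp_add, ← Real.exp_add]; congr 1; ring
    have e3 : Real.exp u * Real.exp (τ * u) = Real.exp ((1 + τ) * u) := by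
      rw [← Real.exp_add]; congr 1; ring
    have e4 : Real.exp u * (powLink τ u - powLink τ v) - Real.exp ((1 + τ) * u) +
        Real.exp ((1 + τ) * v) = Real.exp ((1 + τ) * v) * τ⁻¹ *
          (Real.exp ((u - v) * (1 + τ)) - (1 + (1 + τ) * (Real.exp (u - v) - 1))) := by
      have : Real.exp u * (powLink τ u - powLink τ v) = (1 + 1 / τ) *
          (Real.exp u * Real.exp (τ * u)) - (1 + 1 / τ) * (Real.exp u * Real.exp (τ * v)) := by
        simp only [powLink, h0, if_false]; ring
      rw [this, e3, e2, e1]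
      field_simp
      ring
    rw [e4]
    have := Real.exp_pos ((1 + τ) * v)
    have h3 := sub_pos.2 h1
    positivity

lemma gap_nonneg {τ : ℝ} (hτ : 0 ≤ τ) (u v : ℝ) : 0 ≤ gap τ u v := by
  by_cases h : u = v
  · subst h; simp [gap]
  · exact (gap_pos hτ h).le

lemma exists_abs_powLink_le {τ : ℝ} (hτ : 0 ≤ τ) (M : ℝ) :
    ∃ C, 0 ≤ C ∧ ∀ x ≤ M, |powLink τ x| ≤ C * (1 + |x|) := by
  by_cases h0 : τ = 0
  · exact ⟨1, zero_le_one, fun x _ => by simp [powLink, h0]⟩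
  · have hτ' : 0 < τ := lt_of_le_of_ne hτ (Ne.symm h0)
    refine ⟨(1 + 1 / τ) * Real.exp (τ * M) + 1 / τ, by positivity, fun x hx => ?_⟩
    simp only [powLink, h0, if_false]
    have h1 : (1 + 1 / τ) * Real.exp (τ * x) ≤ (1 + 1 / τ) * Real.exp (τ * M) := by gcongr
    have h2 : 0 < (1 + 1 / τ) * Real.exp (τ * x) := by positivity
    have h3 : 0 < 1 / τ := by positivity
    have h4 : |(1 + 1 / τ) * Real.exp (τ * x) - 1 / τ| ≤
        (1 + 1 / τ) * Real.exp (τ * M) + 1 / τ := by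
      rw [abs_le]; constructor <;> linarith
    refine h4.trans (le_mul_of_one_le_right (by positivity) ?_)
    linarith [abs_nonneg x]

lemma continuous_powLink (τ : ℝ) : Continuous (powLink τ) :=
  continuous_iff_continuousAt.2 fun x => (hasDerivAt_powLink τ x).continuousAt

/-- Quadratic growth in the observation, locally uniformly in the parameter. -/
lemma exists_abs_powLink_row_le {τ : ℝ} (hτ : 0 ≤ τ) (R B : ℝ) :
    ∃ C, 0 ≤ C ∧ ∀ (p : Rows m) (y : EuclideanSpace ℝ (Fin m)), ‖p‖ ≤ R →
      |Real.log (|(rowMat p).det|)| ≤ B → |powLink τ (rowLogDens p y)| ≤ C * (1 + ‖y‖ ^ 2) := by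
  set A := |-((m : ℝ) / 2) * Real.log (2 * Real.pi)|
  obtain ⟨C, hC, hCb⟩ := exists_abs_powLink_le hτ (A + B)
  refine ⟨C * (1 + A + |B| + m * R ^ 2), by positivity, fun p y hp hB => ?_⟩
  have h0 := resid_nonneg p y
  have hr : resid p y ≤ 2 * m * R ^ 2 * (1 + ‖y‖ ^ 2) := (resid_le p y).trans (by gcongr)
  have hA : -((m : ℝ) / 2) * Real.log (2 * Real.pi) ≤ A := le_abs_self _
  have hA' : -A ≤ -((m : ℝ) / 2) * Real.log (2 * Real.pi) := neg_abs_le _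
  have hB' := abs_le.1 hB
  have hBB := le_abs_self B
  have hA0 : 0 ≤ A := abs_nonneg _
  have hB0 : 0 ≤ |B| := abs_nonneg _
  refine (hCb _ (by rw [rowLogDens]; linarith)).trans ?_
  rw [mul_assoc]
  refine mul_le_mul_of_nonneg_left ?_ hC
  have h1 : |rowLogDens p y| ≤ A + |B| + m * R ^ 2 * (1 + ‖y‖ ^ 2) := by
    rw [rowLogDens, abs_le]; constructor <;> linarith
  have h2 : 0 ≤ (A + |B|) * ‖y‖ ^ 2 := by positivity
  have h3 : 0 ≤ ‖y‖ ^ 2 := by positivity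
  nlinarith

lemma continuous_rowLogDens (p : Rows m) : Continuous (rowLogDens p) := by
  have : Continuous (resid p) := by unfold resid; fun_prop
  unfold rowLogDens
  fun_prop

lemma integrable_powLink_row {τ : ℝ} (hτ : 0 ≤ τ) (p : Rows m)
    (μ : Measure (EuclideanSpace ℝ (Fin m))) [IsGaussian μ] :
    Integrable (fun y => powLink τ (rowLogDens p y)) μ := by
  obtain ⟨C, -, hC⟩ := exists_abs_powLink_row_le (m := m) hτ ‖p‖ |Real.log (|(rowMat p).det|)|
  exact integrable_of_norm_le_pow μ
    ((continuous_powLink τ).comp (continuous_rowLogDens p)).aestronglyMeasurable C 1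
    fun y => by rw [pow_one]; exact hC p y le_rfl le_rfl

lemma multivariateGaussian_injective {ν ν' : EuclideanSpace ℝ (Fin m)}
    {S S' : Matrix (Fin m) (Fin m) ℝ} (hS : S.PosSemidef) (hS' : S'.PosSemidef)
    (h : multivariateGaussian ν S = multivariateGaussian ν' S') : ν = ν' ∧ S = S' := by
  constructor
  · rw [← integral_id_multivariateGaussian (μ := ν) (S := S), h, integral_id_multivariateGaussian]
  · ext i j
    rw [← covariance_eval_multivariateGaussian (μ := ν) hS, h,
      covariance_eval_multivariateGaussian hS']

lemma integral_exp_rowLogDens {τ : ℝ} (hτ : 0 ≤ τ) {p : Rows m} (hp : (rowMat p).det ≠ 0) :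
    Integrable (fun y => Real.exp ((1 + τ) * rowLogDens p y)) ∧
      ∫ y, Real.exp ((1 + τ) * rowLogDens p y) = rowKap τ p := by
  have h1 := integrable_exp_mul_logDens_smul (posDef_rowCov hp) hτ (rowMean p)
    (integrable_const (1 : ℝ))
  have h2 := integral_exp_mul_logDens (posDef_rowCov hp) hτ (rowMean p)
  simp only [logDens_row hp, smul_eq_mul, mul_one, kap_row] at h1 h2
  exact ⟨h1, h2⟩

/-- The expected objective is uniquely maximized by the true mean and covariance. -/
lemma integral_powLink_row_lt {τ : ℝ} (hτ : 0 ≤ τ) {p p₀ : Rows m} (hp : (rowMat p).det ≠ 0)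
    (hp₀ : (rowMat p₀).det ≠ 0) (hne : ¬ (rowMean p = rowMean p₀ ∧ rowCov p = rowCov p₀)) :
    ∫ y, powLink τ (rowLogDens p y) ∂(multivariateGaussian (rowMean p₀) (rowCov p₀)) - rowKap τ p <
      ∫ y, powLink τ (rowLogDens p₀ y) ∂(multivariateGaussian (rowMean p₀) (rowCov p₀)) -
        rowKap τ p₀ := by
  have hS := posDef_rowCov hp
  have hS₀ := posDef_rowCov hp₀
  have hi : ∀ q : Rows m, Integrable fun y =>
      Real.exp (rowLogDens p₀ y) * powLink τ (rowLogDens q y) := fun q => by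
    have := (integrable_multivariateGaussian_iff hS₀ (rowMean p₀) _).1
      (integrable_powLink_row hτ q (multivariateGaussian (rowMean p₀) (rowCov p₀)))
    simpa only [logDens_row hp₀, smul_eq_mul] using this
  have he : ∀ q : Rows m,
      ∫ y, powLink τ (rowLogDens q y) ∂(multivariateGaussian (rowMean p₀) (rowCov p₀)) =
        ∫ y, Real.exp (rowLogDens p₀ y) * powLink τ (rowLogDens q y) := fun q => by
    rw [integral_multivariateGaussian_eq hS₀]
    simp only [logDens_row hp₀, smul_eq_mul]
  obtain ⟨hk, hke⟩ := integral_exp_rowLogDens hτ hp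
  obtain ⟨hk₀, hke₀⟩ := integral_exp_rowLogDens hτ hp₀
  -- Equal densities everywhere would give equal laws, hence equal mean and covariance. One point of
  -- difference suffices, because `gap` of the log-densities is continuous and nonnegative.
  obtain ⟨y₀, hy₀⟩ : ∃ y, rowLogDens p₀ y ≠ rowLogDens p y := by
    by_contra! hall
    refine hne (multivariateGaussian_injective hS.posSemidef hS₀.posSemidef ?_)
    rw [multivariateGaussian_eq_withDensity hS, multivariateGaussian_eq_withDensity hS₀]
    simp only [logDens_row hp, logDens_row hp₀, hall]
  have hc := continuous_rowLogDens p
  have hc₀ := continuous_rowLogDens p₀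
  have hpl := continuous_powLink τ
  have hgeq : ∀ y, gap τ (rowLogDens p₀ y) (rowLogDens p y) =
      Real.exp (rowLogDens p₀ y) * powLink τ (rowLogDens p₀ y) -
        Real.exp (rowLogDens p₀ y) * powLink τ (rowLogDens p y) -
        Real.exp ((1 + τ) * rowLogDens p₀ y) + Real.exp ((1 + τ) * rowLogDens p y) := fun y => by
    rw [gap]; ring
  have i1 : Integrable fun y => Real.exp (rowLogDens p₀ y) * powLink τ (rowLogDens p₀ y) -
        Real.exp (rowLogDens p₀ y) * powLink τ (rowLogDens p y) := (hi p₀).sub (hi p)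
  have i2 : Integrable fun y => Real.exp (rowLogDens p₀ y) * powLink τ (rowLogDens p₀ y) -
        Real.exp (rowLogDens p₀ y) * powLink τ (rowLogDens p y) -
        Real.exp ((1 + τ) * rowLogDens p₀ y) := i1.sub hk₀
  have hint : Integrable fun y => gap τ (rowLogDens p₀ y) (rowLogDens p y) := by
    simp only [hgeq]
    exact i2.add hk
  have hpos : 0 < ∫ y, gap τ (rowLogDens p₀ y) (rowLogDens p y) := by
    refine integral_pos_of_integrable_nonneg_nonzero (x := y₀) ?_ hint
      (fun y => gap_nonneg hτ _ _) (gap_pos hτ hy₀).ne'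
    simp only [gap]
    fun_prop
  simp only [hgeq] at hpos
  rw [integral_add i2 hk, integral_sub i1 hk₀, integral_sub (hi p₀) (hi p), hke, hke₀] at hpos
  rw [he, he]
  linarith

end Uniqueness

/-! ### No hyperplane attracts much of the sample -/

section RowBounds

variable {m : ℕ}

/-- The squared residual of one row. -/
def rowSq (x : EuclideanSpace ℝ (Fin m) × ℝ) (y : EuclideanSpace ℝ (Fin m)) : ℝ :=
  (inner ℝ x.1 y - x.2) ^ 2

lemma rowSq_nonneg (x : EuclideanSpace ℝ (Fin m) × ℝ) (y : EuclideanSpace ℝ (Fin m)) :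
    0 ≤ rowSq x y := sq_nonneg _

lemma rowSq_smul (c : ℝ) (x : EuclideanSpace ℝ (Fin m) × ℝ) (y : EuclideanSpace ℝ (Fin m)) :
    rowSq (c • x) y = c ^ 2 * rowSq x y := by
  simp only [rowSq, Prod.smul_fst, Prod.smul_snd, inner_smul_left, conj_trivial, smul_eq_mul]
  ring

lemma rowSq_le_resid (p : Rows m) (k : Fin m) (y : EuclideanSpace ℝ (Fin m)) :
    rowSq (p k) y ≤ resid p y :=
  Finset.single_le_sum (f := fun k => (inner ℝ (p k).1 y - (p k).2) ^ 2)
    (fun _ _ => sq_nonneg _) (Finset.mem_univ k)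

lemma rowSq_le (x : EuclideanSpace ℝ (Fin m) × ℝ) (hx : ‖x‖ ≤ 1) (y : EuclideanSpace ℝ (Fin m)) :
    rowSq x y ≤ 2 * (1 + ‖y‖ ^ 2) := by
  have h1 : ‖x.1‖ ≤ 1 := (norm_fst_le x).trans hx
  have h2 : |x.2| ≤ 1 := (norm_snd_le x).trans hx
  have h3 : |inner ℝ x.1 y| ≤ ‖y‖ := (abs_real_inner_le_norm _ _).trans
    (mul_le_of_le_one_left (norm_nonneg _) h1)
  have h4 := sq_le_sq' (abs_le.1 h3).1 (abs_le.1 h3).2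
  have h5 := sq_le_sq' (abs_le.1 h2).1 (abs_le.1 h2).2
  rw [rowSq]
  nlinarith [sq_nonneg (inner ℝ x.1 y + x.2)]

/-- The zero set is a proper affine hyperplane, which is a null set, if the normal `x.1` is nonzero;
otherwise `x.2` is nonzero and the zero set is empty. -/
lemma ae_rowSq_pos {S : Matrix (Fin m) (Fin m) ℝ} (hS : S.PosDef) (ν : EuclideanSpace ℝ (Fin m))
    {x : EuclideanSpace ℝ (Fin m) × ℝ} (hx : x ≠ 0) :
    ∀ᵐ y ∂(multivariateGaussian ν S), 0 < rowSq x y := by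
  suffices h : ∀ᵐ y ∂(volume : Measure (EuclideanSpace ℝ (Fin m))), 0 < rowSq x y by
    rw [multivariateGaussian_eq_withDensity hS]
    exact (withDensity_absolutelyContinuous _ _).ae_le h
  by_cases h1 : x.1 = 0
  · have h2 : x.2 ≠ 0 := fun h2 => hx (Prod.ext h1 h2)
    refine Eventually.of_forall fun y => ?_
    simp only [rowSq, h1, inner_zero_left, zero_sub, neg_sq]
    positivity
  · set y₀ : EuclideanSpace ℝ (Fin m) := (x.2 / ‖x.1‖ ^ 2) • x.1
    have hy₀ : inner ℝ x.1 y₀ = x.2 := by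
      rw [inner_smul_right, real_inner_self_eq_norm_sq]
      have : ‖x.1‖ ≠ 0 := norm_ne_zero_iff.2 h1
      field_simp
    set s := AffineSubspace.mk' y₀ (LinearMap.ker (innerSL ℝ x.1).toLinearMap)
    have hs : s ≠ ⊤ := fun h => by
      have h3 : x.1 + y₀ ∈ s := by rw [h]; exact AffineSubspace.mem_top _ _ _
      rw [AffineSubspace.mem_mk', LinearMap.mem_ker] at h3
      simp only [vsub_eq_sub, add_sub_cancel_right] at h3
      exact h1 (inner_self_eq_zero.1 h3)
    have h4 := Measure.addHaar_affineSubspace (volume : Measure (EuclideanSpace ℝ (Fin m))) s hs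
    rw [ae_iff]
    refine measure_mono_null (fun y hy => ?_) h4
    have h5 : inner ℝ x.1 y - x.2 = 0 := by
      by_contra h6
      exact hy (by rw [rowSq]; positivity)
    change y ∈ s
    rw [AffineSubspace.mem_mk', LinearMap.mem_ker]
    change inner ℝ x.1 (y - y₀) = 0
    rw [inner_sub_right, hy₀, h5]

/-- Homogeneity of degree two reduces bounds over all rows to the compact unit sphere. -/
lemma exists_unit_rowSq {x : EuclideanSpace ℝ (Fin m) × ℝ} (hx : x ≠ 0) :
    ∃ u ∈ Metric.sphere (0 : EuclideanSpace ℝ (Fin m) × ℝ) 1,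
      ∀ y, rowSq x y = ‖x‖ ^ 2 * rowSq u y := by
  have hx' : ‖x‖ ≠ 0 := norm_ne_zero_iff.2 hx
  refine ⟨‖x‖⁻¹ • x, ?_, fun y => ?_⟩
  · rw [mem_sphere_zero_iff_norm, norm_smul, norm_inv, norm_norm, inv_mul_cancel₀ hx']
  · rw [← rowSq_smul, smul_smul, mul_inv_cancel₀ hx', one_smul]

lemma integrable_rowSq (μ : Measure (EuclideanSpace ℝ (Fin m))) [IsGaussian μ]
    {x : EuclideanSpace ℝ (Fin m) × ℝ} (hx : ‖x‖ ≤ 1) : Integrable (rowSq x) μ := by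
  refine integrable_of_norm_le_pow μ (Continuous.aestronglyMeasurable ?_) 2 1 fun y => ?_
  · unfold rowSq; fun_prop
  · rw [Real.norm_of_nonneg (rowSq_nonneg _ _), pow_one]
    exact rowSq_le x hx y

lemma integral_rowSq_pos {S : Matrix (Fin m) (Fin m) ℝ} (hS : S.PosDef)
    (ν : EuclideanSpace ℝ (Fin m)) {x : EuclideanSpace ℝ (Fin m) × ℝ} (hx : ‖x‖ = 1) :
    0 < ∫ y, rowSq x y ∂(multivariateGaussian ν S) := by
  have hx0 : x ≠ 0 := norm_ne_zero_iff.1 (by rw [hx]; exact one_ne_zero)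
  refine lt_of_le_of_ne (integral_nonneg fun y => rowSq_nonneg _ _) fun h => ?_
  rw [eq_comm, integral_eq_zero_iff_of_nonneg (fun y => rowSq_nonneg _ _)
    (integrable_rowSq _ hx.le)] at h
  obtain ⟨y, hy, hy'⟩ := (h.and (ae_rowSq_pos hS ν hx0)).exists
  exact hy'.ne' hy

lemma isCompact_unitSphere : IsCompact (Metric.sphere (0 : EuclideanSpace ℝ (Fin m) × ℝ) 1) :=
  isCompact_sphere _ _

lemma continuous_integral_exp_rowSq (μ : Measure (EuclideanSpace ℝ (Fin m)))
    [IsProbabilityMeasure μ] {s : ℝ} (hs : 0 ≤ s) :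
    Continuous fun x => ∫ y, Real.exp (-s * rowSq x y) ∂μ := by
  refine continuous_of_dominated (bound := fun _ => 1) (fun x => ?_) (fun x => ?_)
    (integrable_const _) (Eventually.of_forall fun y => ?_)
  · refine Continuous.aestronglyMeasurable ?_
    unfold rowSq; fun_prop
  · refine Eventually.of_forall fun y => ?_
    rw [Real.norm_of_nonneg (Real.exp_pos _).le, Real.exp_le_one_iff]
    have := rowSq_nonneg x y
    nlinarith
  · unfold rowSq; fun_prop

/-- A Dini argument: for fixed `x` the integral decreases to zero by dominated convergence, so the
open sets where it is below `b` increase with `N` and cover the compact sphere. -/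
lemma exists_integral_exp_rowSq_lt {S : Matrix (Fin m) (Fin m) ℝ} (hS : S.PosDef)
    (ν : EuclideanSpace ℝ (Fin m)) {b : ℝ} (hb : 0 < b) :
    ∃ N : ℕ, ∀ x ∈ Metric.sphere (0 : EuclideanSpace ℝ (Fin m) × ℝ) 1,
      ∫ y, Real.exp (-(N : ℝ) * rowSq x y) ∂(multivariateGaussian ν S) < b := by
  set μ := multivariateGaussian ν S
  have hint : ∀ (N : ℕ) x, Integrable (fun y => Real.exp (-(N : ℝ) * rowSq x y)) μ := fun N x => by
    refine (integrable_const (1 : ℝ)).mono' (Continuous.aestronglyMeasurable ?_)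
      (Eventually.of_forall fun y => ?_)
    · unfold rowSq; fun_prop
    · rw [Real.norm_of_nonneg (Real.exp_pos _).le, Real.exp_le_one_iff]
      have := rowSq_nonneg x y
      have : (0 : ℝ) ≤ N := Nat.cast_nonneg N
      nlinarith
  refine isCompact_unitSphere.elim_directed_cover
    (fun N : ℕ => {x | ∫ y, Real.exp (-(N : ℝ) * rowSq x y) ∂μ < b}) (fun N => ?_)
    (fun x hx => ?_) ?_
  · exact isOpen_lt (continuous_integral_exp_rowSq μ (Nat.cast_nonneg N)) continuous_const
  · have hx0 : x ≠ 0 := fun h => by simp [h] at hx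
    have h1 : Tendsto (fun N : ℕ => ∫ y, Real.exp (-(N : ℝ) * rowSq x y) ∂μ) atTop
        (𝓝 (∫ _, (0 : ℝ) ∂μ)) := by
      refine tendsto_integral_of_dominated_convergence (fun _ => 1)
        (fun N => (hint N x).aestronglyMeasurable) (integrable_const _) (fun N => ?_) ?_
      · refine Eventually.of_forall fun y => ?_
        rw [Real.norm_of_nonneg (Real.exp_pos _).le, Real.exp_le_one_iff]
        have := rowSq_nonneg x y
        have : (0 : ℝ) ≤ N := Nat.cast_nonneg N
        nlinarith
      · filter_upwards [ae_rowSq_pos hS ν hx0] with y hy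
        refine Real.tendsto_exp_atBot.comp ?_
        simp only [neg_mul]
        exact tendsto_neg_atTop_atBot.comp (tendsto_natCast_atTop_atTop.atTop_mul_const hy)
    rw [integral_zero] at h1
    obtain ⟨N, hN⟩ := (h1.eventually_lt_const hb).exists
    exact Set.mem_iUnion.2 ⟨N, hN⟩
  · refine Monotone.directed_le fun N N' hNN x hx => ?_
    refine lt_of_le_of_lt (integral_mono (hint N' x) (hint N x) fun y => ?_) hx
    have := rowSq_nonneg x y
    have h3 : (N : ℝ) ≤ N' := Nat.cast_le.2 hNN
    refine Real.exp_le_exp.2 ?_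
    nlinarith

variable {Ω : Type*} [MeasurableSpace Ω] {P : Measure Ω} [IsProbabilityMeasure P]
  {Y : ℕ → Ω → EuclideanSpace ℝ (Fin m)}

/-- With high probability, no hyperplane attracts a large proportion of the sample. -/
lemma exists_holdsWHP_mean_exp_rowSq_lt {S : Matrix (Fin m) (Fin m) ℝ} (hS : S.PosDef)
    {ν : EuclideanSpace ℝ (Fin m)} (hindep : iIndepFun Y P)
    (hlaw : ∀ i, HasLaw (Y i) (multivariateGaussian ν S) P) {b : ℝ} (hb : 0 < b) :
    ∃ N : ℕ, HoldsWHP P (fun n ω => ∀ (x : EuclideanSpace ℝ (Fin m) × ℝ) (s : ℝ), x ≠ 0 →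
      N ≤ s * ‖x‖ ^ 2 →
      (n : ℝ)⁻¹ * ∑ i ∈ Finset.range n, Real.exp (-s * rowSq x (Y i ω)) < b) := by
  obtain ⟨N, hN⟩ := exists_integral_exp_rowSq_lt hS ν (half_pos hb)
  have hK : CompactSpace (Metric.sphere (0 : EuclideanSpace ℝ (Fin m) × ℝ) 1) :=
    isCompact_iff_compactSpace.1 isCompact_unitSphere
  obtain ⟨φ, hφ, hlim⟩ := exists_continuousMap_holdsWHP_mean_close (P := P) (Y := Y)
    (K := Metric.sphere (0 : EuclideanSpace ℝ (Fin m) × ℝ) 1) hindep hlaw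
    (fun x y => Real.exp (-(N : ℝ) * rowSq x y))
    (by unfold rowSq; fun_prop) (fun _ => 1) (integrable_const _)
    (fun x y => by
      rw [Real.norm_of_nonneg (Real.exp_pos _).le, Real.exp_le_one_iff]
      have := rowSq_nonneg x.1 y
      have : (0 : ℝ) ≤ N := Nat.cast_nonneg N
      nlinarith)
  refine ⟨N, (hlim (b / 2) (half_pos hb)).mono (Eventually.of_forall fun n ω h x s hx hs => ?_)⟩
  obtain ⟨u, hus, hxu⟩ := exists_unit_rowSq hx
  have h1 := h ⟨u, hus⟩
  rw [hφ, smul_eq_mul, Real.norm_eq_abs, abs_lt] at h1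
  have h2 := hN u hus
  refine lt_of_le_of_lt (b := (n : ℝ)⁻¹ * ∑ i ∈ Finset.range n,
    Real.exp (-(N : ℝ) * rowSq u (Y i ω))) ?_ (by linarith [h1.2])
  refine mul_le_mul_of_nonneg_left (Finset.sum_le_sum fun i _ => Real.exp_le_exp.2 ?_)
    (by positivity)
  have := rowSq_nonneg u (Y i ω)
  rw [hxu]
  nlinarith

/-- With high probability, the sample has uniformly positive spread in every direction. -/
lemma exists_holdsWHP_le_mean_rowSq {S : Matrix (Fin m) (Fin m) ℝ} (hS : S.PosDef)
    {ν : EuclideanSpace ℝ (Fin m)} (hindep : iIndepFun Y P)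
    (hlaw : ∀ i, HasLaw (Y i) (multivariateGaussian ν S) P) :
    ∃ c > 0, HoldsWHP P (fun n ω => ∀ x : EuclideanSpace ℝ (Fin m) × ℝ,
      c * ‖x‖ ^ 2 ≤ (n : ℝ)⁻¹ * ∑ i ∈ Finset.range n, rowSq x (Y i ω)) := by
  have hK : CompactSpace (Metric.sphere (0 : EuclideanSpace ℝ (Fin m) × ℝ) 1) :=
    isCompact_iff_compactSpace.1 isCompact_unitSphere
  have hb : Integrable (fun y : EuclideanSpace ℝ (Fin m) => 2 * (1 + ‖y‖ ^ 2)) (multivariateGaussian ν S) :=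
    integrable_of_norm_le_pow _ (Continuous.aestronglyMeasurable (by fun_prop)) 2 1 fun y => by
      rw [Real.norm_of_nonneg (by positivity), pow_one]
  have hbd : ∀ (x : Metric.sphere (0 : EuclideanSpace ℝ (Fin m) × ℝ) 1)
      (y : EuclideanSpace ℝ (Fin m)), ‖rowSq x.1 y‖ ≤ 2 * (1 + ‖y‖ ^ 2) := fun x y => by
    rw [Real.norm_of_nonneg (rowSq_nonneg _ _)]
    exact rowSq_le x.1 (mem_sphere_zero_iff_norm.1 x.2).le y
  obtain ⟨φ, hφ, hlim⟩ := exists_continuousMap_holdsWHP_mean_close (P := P) (Y := Y)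
    (K := Metric.sphere (0 : EuclideanSpace ℝ (Fin m) × ℝ) 1) hindep hlaw
    (fun x y => rowSq x.1 y) (by unfold rowSq; fun_prop) (fun y => 2 * (1 + ‖y‖ ^ 2)) hb hbd
  have hpos : ∀ x, 0 < φ x := fun x => by
    rw [hφ]
    exact integral_rowSq_pos hS ν (mem_sphere_zero_iff_norm.1 x.2)
  -- The point (0, 1) is on the sphere even when `m = 0`.
  have hne : (Set.univ : Set (Metric.sphere (0 : EuclideanSpace ℝ (Fin m) × ℝ) 1)).Nonempty :=
    ⟨⟨(0, 1), mem_sphere_zero_iff_norm.2 (by rw [Prod.norm_def]; simp)⟩, Set.mem_univ _⟩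
  obtain ⟨x₀, -, hx₀⟩ := isCompact_univ.exists_isMinOn hne φ.continuous.continuousOn
  refine ⟨φ x₀ / 2, half_pos (hpos x₀), (hlim _ (half_pos (hpos x₀))).mono
    (Eventually.of_forall fun n ω h x => ?_)⟩
  by_cases hx : x = 0
  · subst hx; simp [rowSq]
  obtain ⟨u, hus, hxu⟩ := exists_unit_rowSq hx
  have h1 := h ⟨u, hus⟩
  rw [smul_eq_mul, Real.norm_eq_abs, abs_lt] at h1
  have h2 : φ x₀ ≤ φ ⟨u, hus⟩ := hx₀ (Set.mem_univ _)
  have h3 : ∑ i ∈ Finset.range n, rowSq x (Y i ω) =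
      ‖x‖ ^ 2 * ∑ i ∈ Finset.range n, rowSq u (Y i ω) := by
    simp only [hxu, Finset.mul_sum]
  rw [h3, mul_left_comm, mul_comm]
  refine mul_le_mul_of_nonneg_left ?_ (sq_nonneg _)
  linarith [h1.1]

end RowBounds

/-! ### Competitive laws stay in a bounded region -/

section CandidateBounds

variable {m : ℕ}

/-- The contribution of one observation to the objective, for the Gaussian law standardized by
`p`. -/
def rowObj (τ : ℝ) (p : Rows m) (y : EuclideanSpace ℝ (Fin m)) : ℝ :=
  powLink τ (rowLogDens p y) - rowKap τ p

lemma continuous_rowObj (τ : ℝ) (p : Rows m) : Continuous (rowObj τ p) :=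
  ((continuous_powLink τ).comp (continuous_rowLogDens p)).sub continuous_const

lemma integrable_rowObj {τ : ℝ} (hτ : 0 ≤ τ) (p : Rows m)
    (μ : Measure (EuclideanSpace ℝ (Fin m))) [IsGaussian μ] : Integrable (rowObj τ p) μ :=
  (integrable_powLink_row hτ p μ).sub (integrable_const _)

/-- The determinant enters only through a positive factor, so a law beats the level -1/τ only if the
bracket, which depends on residuals alone, is positive. -/
lemma mean_rowObj_of_pos {τ : ℝ} (hτ : 0 < τ) (p : Rows m) {n : ℕ} (hn : n ≠ 0)
    (y : ℕ → EuclideanSpace ℝ (Fin m)) :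
    (n : ℝ)⁻¹ * ∑ i ∈ Finset.range n, rowObj τ p (y i) =
      Real.exp (τ * (-((m : ℝ) / 2) * Real.log (2 * Real.pi) + Real.log |(rowMat p).det|)) *
        ((1 + 1 / τ) * ((n : ℝ)⁻¹ * ∑ i ∈ Finset.range n, Real.exp (-(τ / 2) * resid p (y i))) -
          Real.exp (-((m : ℝ) / 2 * Real.log (1 + τ)))) - 1 / τ := by
  have hn' : (n : ℝ) ≠ 0 := Nat.cast_ne_zero.2 hn
  set K := Real.exp (τ * (-((m : ℝ) / 2) * Real.log (2 * Real.pi) + Real.log |(rowMat p).det|))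
    with hK
  set β := Real.exp (-((m : ℝ) / 2 * Real.log (1 + τ))) with hβ
  have e1 : ∀ i, Real.exp (τ * rowLogDens p (y i)) = K * Real.exp (-(τ / 2) * resid p (y i)) :=
    fun i => by rw [hK, ← Real.exp_add, rowLogDens]; congr 1; ring
  have e2 : rowKap τ p = K * β := by
    rw [rowKap, hK, hβ, ← Real.exp_add]; congr 1; ring
  simp only [rowObj, powLink, hτ.ne', if_false, e1, e2, Finset.sum_sub_distrib, Finset.sum_const,
    Finset.card_range, nsmul_eq_mul, ← Finset.mul_sum]
  field_simp
  ring

lemma mean_rowObj_zero (p : Rows m) {n : ℕ} (hn : n ≠ 0) (y : ℕ → EuclideanSpace ℝ (Fin m)) :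
    (n : ℝ)⁻¹ * ∑ i ∈ Finset.range n, rowObj 0 p (y i) =
      -((m : ℝ) / 2) * Real.log (2 * Real.pi) + Real.log |(rowMat p).det| -
        1 / 2 * ((n : ℝ)⁻¹ * ∑ i ∈ Finset.range n, resid p (y i)) - 1 := by
  have hn' : (n : ℝ) ≠ 0 := Nat.cast_ne_zero.2 hn
  have hk : rowKap 0 p = 1 := by simp [rowKap]
  simp only [rowObj, powLink, if_true, hk, rowLogDens, Finset.sum_sub_distrib, Finset.sum_const,
    Finset.card_range, nsmul_eq_mul, ← Finset.mul_sum]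
  field_simp

/-- The true law exceeds the level -1/τ by the fixed margin `rowKap τ p / τ`, which every competitor
must nearly match. -/
lemma integral_rowObj_of_pos {τ : ℝ} (hτ : 0 < τ) {p : Rows m} (hp : (rowMat p).det ≠ 0) :
    ∫ y, rowObj τ p y ∂(multivariateGaussian (rowMean p) (rowCov p)) =
      rowKap τ p / τ - 1 / τ := by
  have hS := posDef_rowCov hp
  have h1 : ∫ y, Real.exp (τ * rowLogDens p y) ∂(multivariateGaussian (rowMean p) (rowCov p)) =
      rowKap τ p := by
    rw [integral_multivariateGaussian_eq hS, ← (integral_exp_rowLogDens hτ.le hp).2]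
    refine integral_congr_ae (Eventually.of_forall fun y => ?_)
    simp only [logDens_row hp, smul_eq_mul, ← Real.exp_add]
    congr 1; ring
  have h2 : Integrable (fun y => Real.exp (τ * rowLogDens p y))
      (multivariateGaussian (rowMean p) (rowCov p)) := by
    by_contra h
    rw [integral_undef h] at h1
    exact (Real.exp_pos _).ne h1
  have e : ∀ y, rowObj τ p y = (1 + 1 / τ) * Real.exp (τ * rowLogDens p y) -
      (1 / τ + rowKap τ p) := fun y => by
    simp only [rowObj, powLink, hτ.ne', if_false]; ring
  simp only [e]
  rw [integral_sub (h2.const_mul _) (integrable_const _), integral_const_mul, h1]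
  simp
  ring

/-- Leibniz' formula bounds the determinant by m! ‖p‖^m; replacing ‖p‖ by its exponential makes the
logarithm of the bound linear in ‖p‖. -/
lemma abs_det_rowMat_le (p : Rows m) : |(rowMat p).det| ≤ m.factorial * Real.exp (m * ‖p‖) := by
  have h := Matrix.det_le (A := rowMat p) (abv := AbsoluteValue.abs) (x := ‖p‖) fun k j =>
    ((PiLp.norm_apply_le (p k).1 j).trans (norm_fst_le (p k))).trans (norm_le_pi_norm p k)
  rw [Fintype.card_fin, nsmul_eq_mul] at h
  refine (show |(rowMat p).det| ≤ _ from h).trans ?_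
  gcongr
  rw [Real.exp_nat_mul]
  gcongr
  linarith [Real.add_one_le_exp ‖p‖]

variable {Ω : Type*} [MeasurableSpace Ω] {P : Measure Ω} [IsProbabilityMeasure P]
  {Y : ℕ → Ω → EuclideanSpace ℝ (Fin m)}

/-- To match the true law, the sample mean of exp(-τ/2 · resid) must exceed β/(1 + 1/τ). A single
row of large norm already prevents this, so the rows are bounded; as that mean is at most 1, the
prefactor, and with it |det B|, is bounded below. -/
lemma exists_holdsWHP_candidate_bounds_of_pos {τ : ℝ} (hτ : 0 < τ) {p₀ : Rows m}
    (hp₀ : (rowMat p₀).det ≠ 0) (hindep : iIndepFun Y P)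
    (hlaw : ∀ i, HasLaw (Y i) (multivariateGaussian (rowMean p₀) (rowCov p₀)) P) :
    ∃ R l : ℝ, HoldsWHP P (fun n ω => ∀ p : Rows m,
      (n : ℝ)⁻¹ * ∑ i ∈ Finset.range n, rowObj τ p₀ (Y i ω) ≤
        (n : ℝ)⁻¹ * ∑ i ∈ Finset.range n, rowObj τ p (Y i ω) →
      ‖p‖ ≤ R ∧ l ≤ Real.log |(rowMat p).det|) := by
  set κ := rowKap τ p₀
  have hκ : 0 < κ := Real.exp_pos _
  set β := Real.exp (-((m : ℝ) / 2 * Real.log (1 + τ)))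
  have hβ : 0 < β := Real.exp_pos _
  have hc : 0 < 1 + 1 / τ := by positivity
  obtain ⟨N, hN⟩ := exists_holdsWHP_mean_exp_rowSq_lt (posDef_rowCov hp₀) hindep hlaw
    (b := β / (1 + 1 / τ)) (by positivity)
  have hmean := holdsWHP_mean_close (P := P) (Y := Y) hindep hlaw (continuous_rowObj τ p₀)
    (integrable_rowObj hτ.le p₀ _) (ε := κ / τ / 2) (by positivity)
  -- Beyond this radius a row satisfies (τ/2) ‖p k‖² ≥ N, the threshold for the hyperplane bound.
  -- The second constant solves κ/(2τ) ≤ K (1 + 1/τ) for log |det B|.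
  refine ⟨Real.sqrt (2 * N / τ), Real.log (κ / τ / 2 / (1 + 1 / τ)) / τ +
    (m : ℝ) / 2 * Real.log (2 * Real.pi), (hN.and hmean).mono ?_⟩
  filter_upwards [eventually_ne_atTop 0] with n hn ω ⟨h1, h2⟩ p hp
  rw [smul_eq_mul, integral_rowObj_of_pos hτ hp₀, Real.norm_eq_abs, abs_lt] at h2
  rw [mean_rowObj_of_pos hτ p hn] at hp
  set K := Real.exp (τ * (-((m : ℝ) / 2) * Real.log (2 * Real.pi) + Real.log |(rowMat p).det|))
    with hK
  have hK0 : 0 < K := Real.exp_pos _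
  set M := (n : ℝ)⁻¹ * ∑ i ∈ Finset.range n, Real.exp (-(τ / 2) * resid p (Y i ω)) with hM
  have h3 : κ / τ / 2 < K * ((1 + 1 / τ) * M - β) := by
    have := h2.1
    linarith
  have h4 : 0 < (1 + 1 / τ) * M - β := by
    have : 0 < K * ((1 + 1 / τ) * M - β) := lt_trans (by positivity) h3
    exact (pos_iff_pos_of_mul_pos this).1 hK0
  have hM1 : M ≤ 1 := by
    have hn' : (0 : ℝ) < n := by positivity
    have : ∑ i ∈ Finset.range n, Real.exp (-(τ / 2) * resid p (Y i ω)) ≤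
        ∑ _i ∈ Finset.range n, (1 : ℝ) := Finset.sum_le_sum fun i _ => by
      rw [Real.exp_le_one_iff]
      have := resid_nonneg p (Y i ω)
      nlinarith
    simp only [Finset.sum_const, Finset.card_range, nsmul_eq_mul, mul_one] at this
    rw [hM, inv_mul_le_iff₀ hn', mul_one]
    exact this
  constructor
  · refine (pi_norm_le_iff_of_nonneg (Real.sqrt_nonneg _)).2 fun k => ?_
    by_contra! hk
    have hk2 : 2 * N / τ < ‖p k‖ ^ 2 := (Real.sqrt_lt' (lt_of_le_of_lt (Real.sqrt_nonneg _) hk)).1 hk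
    have hk0 : p k ≠ 0 := norm_ne_zero_iff.1 (lt_of_le_of_lt (Real.sqrt_nonneg _) hk).ne'
    have h5 := h1 (p k) (τ / 2) hk0 (by rw [div_lt_iff₀ hτ] at hk2; linarith)
    have h6 : M ≤ (n : ℝ)⁻¹ * ∑ i ∈ Finset.range n, Real.exp (-(τ / 2) * rowSq (p k) (Y i ω)) := by
      refine mul_le_mul_of_nonneg_left (Finset.sum_le_sum fun i _ => Real.exp_le_exp.2 ?_)
        (by positivity)
      have := rowSq_le_resid p k (Y i ω)
      nlinarith
    rw [lt_div_iff₀ hc] at h5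
    nlinarith
  · have h5 : κ / τ / 2 / (1 + 1 / τ) ≤ K := by
      rw [div_le_iff₀ hc]
      have : K * ((1 + 1 / τ) * M - β) ≤ K * (1 + 1 / τ) := by
        refine mul_le_mul_of_nonneg_left ?_ hK0.le
        nlinarith
      linarith
    have h6 := Real.log_le_log (by positivity) h5
    rw [hK, Real.log_exp] at h6
    have h7 : Real.log (κ / τ / 2 / (1 + 1 / τ)) / τ ≤
        -((m : ℝ) / 2) * Real.log (2 * Real.pi) + Real.log |(rowMat p).det| := by
      rw [div_le_iff₀ hτ]; linarith
    linarith

/-- The spread of the sample makes the mean residual at least c ‖p‖², whereas log |det B| grows at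
most linearly in ‖p‖. A large ‖p‖ therefore loses against the true law, and nonnegativity of the
residual bounds log |det B| below. -/
lemma exists_holdsWHP_candidate_bounds_zero {p₀ : Rows m}
    (hp₀ : (rowMat p₀).det ≠ 0) (hindep : iIndepFun Y P)
    (hlaw : ∀ i, HasLaw (Y i) (multivariateGaussian (rowMean p₀) (rowCov p₀)) P) :
    ∃ R l : ℝ, HoldsWHP P (fun n ω => ∀ p : Rows m, (rowMat p).det ≠ 0 →
      (n : ℝ)⁻¹ * ∑ i ∈ Finset.range n, rowObj 0 p₀ (Y i ω) ≤
        (n : ℝ)⁻¹ * ∑ i ∈ Finset.range n, rowObj 0 p (Y i ω) →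
      ‖p‖ ≤ R ∧ l ≤ Real.log |(rowMat p).det|) := by
  obtain ⟨c, hc, hspread⟩ := exists_holdsWHP_le_mean_rowSq (posDef_rowCov hp₀) hindep hlaw
  have hmean := holdsWHP_mean_close (P := P) (Y := Y) hindep hlaw (continuous_rowObj 0 p₀)
    (integrable_rowObj le_rfl p₀ _) one_pos
  set I := ∫ y, rowObj 0 p₀ y ∂(multivariateGaussian (rowMean p₀) (rowCov p₀))
  set l := I + (m : ℝ) / 2 * Real.log (2 * Real.pi) with hl
  set D := Real.log m.factorial - l with hD
  -- The radius is chosen so that (c/2) x² ≤ D + m x fails beyond it; the `1` allows |D| ≤ |D| x.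
  refine ⟨1 + 2 * (m + |D|) / c, l, (hspread.and hmean).mono ?_⟩
  filter_upwards [eventually_ne_atTop 0] with n hn ω ⟨h1, h2⟩ p hp hle
  rw [smul_eq_mul, Real.norm_eq_abs, abs_lt] at h2
  rw [mean_rowObj_zero p hn] at hle
  set r := (n : ℝ)⁻¹ * ∑ i ∈ Finset.range n, resid p (Y i ω) with hr
  have hr0 : 0 ≤ r := mul_nonneg (by positivity)
    (Finset.sum_nonneg fun i _ => resid_nonneg p (Y i ω))
  have h3 : l ≤ Real.log |(rowMat p).det| - 1 / 2 * r := by linarith [h2.1]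
  refine ⟨?_, by linarith⟩
  have h4 : ‖p‖ ≤ Real.sqrt (r / c) := by
    refine (pi_norm_le_iff_of_nonneg (Real.sqrt_nonneg _)).2 fun k => Real.le_sqrt_of_sq_le ?_
    rw [le_div_iff₀ hc, mul_comm]
    refine (h1 (p k)).trans (mul_le_mul_of_nonneg_left (Finset.sum_le_sum fun i _ => ?_)
      (by positivity))
    exact rowSq_le_resid p k (Y i ω)
  have h5 : c * ‖p‖ ^ 2 ≤ r := by
    have := pow_le_pow_left₀ (norm_nonneg p) h4 2
    rw [Real.sq_sqrt (by positivity), le_div_iff₀ hc] at this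
    linarith
  have h6 : Real.log |(rowMat p).det| ≤ Real.log m.factorial + m * ‖p‖ := by
    have := Real.log_le_log (abs_pos.2 hp) (abs_det_rowMat_le p)
    rwa [Real.log_mul (by positivity) (Real.exp_pos _).ne', Real.log_exp] at this
  have h7 : c / 2 * ‖p‖ ^ 2 ≤ D + m * ‖p‖ := by linarith
  by_contra! hx
  have hD' := le_abs_self D
  have h8 : 0 ≤ 2 * (m + |D|) / c := by positivity
  have h9 : 2 * (m + |D|) < c * ‖p‖ := by
    have : 2 * (m + |D|) / c < ‖p‖ := by linarith
    rw [div_lt_iff₀ hc] at this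
    linarith
  have h10 : 1 < ‖p‖ := by linarith
  nlinarith [abs_nonneg D]

lemma exists_holdsWHP_candidate_bounds {τ : ℝ} (hτ : 0 ≤ τ) {p₀ : Rows m}
    (hp₀ : (rowMat p₀).det ≠ 0) (hindep : iIndepFun Y P)
    (hlaw : ∀ i, HasLaw (Y i) (multivariateGaussian (rowMean p₀) (rowCov p₀)) P) :
    ∃ R l : ℝ, HoldsWHP P (fun n ω => ∀ p : Rows m, (rowMat p).det ≠ 0 →
      (n : ℝ)⁻¹ * ∑ i ∈ Finset.range n, rowObj τ p₀ (Y i ω) ≤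
        (n : ℝ)⁻¹ * ∑ i ∈ Finset.range n, rowObj τ p (Y i ω) →
      ‖p‖ ≤ R ∧ l ≤ Real.log |(rowMat p).det|) := by
  rcases hτ.eq_or_lt with rfl | hτ'
  · exact exists_holdsWHP_candidate_bounds_zero hp₀ hindep hlaw
  · obtain ⟨R, l, h⟩ := exists_holdsWHP_candidate_bounds_of_pos hτ' hp₀ hindep hlaw
    exact ⟨R, l, h.mono (Eventually.of_forall fun n ω h p _ => h p)⟩

end CandidateBounds

/-! ### Consistency of the restricted estimator -/

section Consistency

variable {m : ℕ} {Ω : Type*} [MeasurableSpace Ω] {P : Measure Ω} [IsProbabilityMeasure P]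
  {Y : ℕ → Ω → EuclideanSpace ℝ (Fin m)}

lemma isCompact_rows (R c : ℝ) :
    IsCompact {p : Rows m | ‖p‖ ≤ R ∧ c ≤ |(rowMat p).det|} := by
  have h1 : IsCompact {p : Rows m | ‖p‖ ≤ R} := by
    have := isCompact_closedBall (0 : Rows m) R
    rwa [show Metric.closedBall (0 : Rows m) R = {p : Rows m | ‖p‖ ≤ R} by
      ext p; simp] at this
  exact h1.inter_right (isClosed_le continuous_const continuous_det_rowMat.abs)

lemma continuous_rowObj_subtype (τ : ℝ) {C : Set (Rows m)}
    (hC : ∀ p ∈ C, (rowMat p).det ≠ 0) :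
    Continuous fun x : EuclideanSpace ℝ (Fin m) × C => rowObj τ x.2.1 x.1 := by
  have h1 : Continuous fun x : EuclideanSpace ℝ (Fin m) × C => Real.log |(rowMat x.2.1).det| :=
    Continuous.log (continuous_det_rowMat.comp (continuous_subtype_val.comp continuous_snd)).abs
      fun x => abs_ne_zero.2 (hC _ x.2.2)
  have h2 : Continuous fun x : EuclideanSpace ℝ (Fin m) × C => resid x.2.1 x.1 :=
    continuous_resid.comp (f := fun x : EuclideanSpace ℝ (Fin m) × C => (x.1, x.2.1))
      (by fun_prop)
  have h3 : Continuous fun x : EuclideanSpace ℝ (Fin m) × C => rowLogDens x.2.1 x.1 := by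
    unfold rowLogDens; fun_prop
  have h4 : Continuous fun x : EuclideanSpace ℝ (Fin m) × C => rowKap τ x.2.1 := by
    unfold rowKap; fun_prop
  exact ((continuous_powLink τ).comp h3).sub h4

lemma exists_abs_rowObj_le {τ : ℝ} (hτ : 0 ≤ τ) {C : Set (Rows m)} (hCc : IsCompact C)
    (hC : ∀ p ∈ C, (rowMat p).det ≠ 0) :
    ∃ B, ∀ p ∈ C, ∀ y, ‖rowObj τ p y‖ ≤ B * (1 + ‖y‖ ^ 2) := by
  have hlog : ContinuousOn (fun p : Rows m => Real.log |(rowMat p).det|) C :=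
    ContinuousOn.log continuous_det_rowMat.abs.continuousOn fun p hp => abs_ne_zero.2 (hC p hp)
  obtain ⟨B₁, hB₁⟩ := hCc.exists_bound_of_continuousOn hlog
  obtain ⟨R, hR⟩ := hCc.exists_bound_of_continuousOn (f := fun p : Rows m => p) continuousOn_id
  obtain ⟨B₂, hB₂⟩ := hCc.exists_bound_of_continuousOn (f := rowKap τ)
    (by unfold rowKap; fun_prop)
  obtain ⟨B₃, hB₃0, hB₃⟩ := exists_abs_powLink_row_le (m := m) hτ R B₁
  refine ⟨B₃ + B₂, fun p hp y => ?_⟩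
  have h1 := hB₃ p y (hR p hp) (hB₁ p hp)
  have h2 : |rowKap τ p| ≤ B₂ := hB₂ p hp
  have h3 : 0 ≤ B₂ := (abs_nonneg _).trans h2
  rw [rowObj]
  refine (norm_sub_le _ _).trans ?_
  rw [Real.norm_eq_abs, Real.norm_eq_abs]
  nlinarith [mul_nonneg h3 (sq_nonneg ‖y‖)]

/-- Parameters at which the objective is at least its value at the true parameter have, with high
probability, mean and covariance close to the true ones. -/
theorem holdsWHP_mean_cov_close {τ : ℝ} (hτ : 0 ≤ τ) {p₀ : Rows m} (hp₀ : (rowMat p₀).det ≠ 0)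
    (hindep : iIndepFun Y P)
    (hlaw : ∀ i, HasLaw (Y i) (multivariateGaussian (rowMean p₀) (rowCov p₀)) P)
    {δ : ℝ} (hδ : 0 < δ) :
    HoldsWHP P (fun n ω => ∀ p : Rows m, (rowMat p).det ≠ 0 →
      (n : ℝ)⁻¹ * ∑ i ∈ Finset.range n, rowObj τ p₀ (Y i ω) ≤
        (n : ℝ)⁻¹ * ∑ i ∈ Finset.range n, rowObj τ p (Y i ω) →
      ‖rowMean p - rowMean p₀‖ < δ ∧ ∀ a b, |rowCov p a b - rowCov p₀ a b| < δ) := by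
  obtain ⟨R, l, hRl⟩ := exists_holdsWHP_candidate_bounds hτ hp₀ hindep hlaw
  -- The maximum and minimum also place `p₀` in the compact set, so that one uniform law covers both
  -- the candidates and the true law.
  set C : Set (Rows m) := {p | ‖p‖ ≤ max R ‖p₀‖ ∧
    min (Real.exp l) |(rowMat p₀).det| ≤ |(rowMat p).det|} with hCdef
  have hCc : IsCompact C := isCompact_rows _ _
  have hCd : ∀ p ∈ C, (rowMat p).det ≠ 0 := fun p hp => abs_pos.1
    (lt_of_lt_of_le (lt_min (Real.exp_pos _) (abs_pos.2 hp₀)) hp.2)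
  have hp₀C : p₀ ∈ C := ⟨le_max_right _ _, min_le_right _ _⟩
  have hK : CompactSpace C := isCompact_iff_compactSpace.1 hCc
  obtain ⟨B, hB⟩ := exists_abs_rowObj_le hτ hCc hCd
  have hBint : Integrable (fun y : EuclideanSpace ℝ (Fin m) => B * (1 + ‖y‖ ^ 2))
      (multivariateGaussian (rowMean p₀) (rowCov p₀)) := by
    have h1 : Integrable (fun y : EuclideanSpace ℝ (Fin m) => 1 + ‖y‖ ^ 2)
        (multivariateGaussian (rowMean p₀) (rowCov p₀)) :=
      integrable_of_norm_le_pow _ (Continuous.aestronglyMeasurable (by fun_prop)) 1 1 fun y => by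
        rw [Real.norm_of_nonneg (by positivity), one_mul, pow_one]
    exact h1.const_mul B
  obtain ⟨φ, hφ, hlim⟩ := exists_continuousMap_holdsWHP_mean_close (P := P) (Y := Y) (K := C)
    hindep hlaw (fun p y => rowObj τ p.1 y) (continuous_rowObj_subtype τ hCd)
    (fun y => B * (1 + ‖y‖ ^ 2)) hBint (fun p y => hB p.1 p.2 y)
  have hφe : ∀ p : C, φ p = ∫ y, powLink τ (rowLogDens p.1 y)
      ∂(multivariateGaussian (rowMean p₀) (rowCov p₀)) - rowKap τ p.1 := fun p => by
    rw [hφ]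
    simp only [rowObj]
    rw [integral_sub (integrable_powLink_row hτ _ _) (integrable_const _)]
    simp
  -- Being far is measured by mean and covariance, not by distance to `p₀`, because many rows
  -- represent the true law.
  set F : Set C := {p | δ ≤ ‖rowMean p.1 - rowMean p₀‖} ∪
    ⋃ a, ⋃ b, {p | δ ≤ |rowCov p.1 a b - rowCov p₀ a b|} with hF
  have hFc : IsClosed F := by
    have h1 : Continuous fun p : C => rowMean p.1 := continuous_iff_continuousAt.2 fun p =>
      ContinuousAt.comp (g := rowMean) (continuousAt_rowMean (hCd p.1 p.2))
        continuous_subtype_val.continuousAt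
    have h2 : ∀ a b, Continuous fun p : C => rowCov p.1 a b := fun a b =>
      continuous_iff_continuousAt.2 fun p => ContinuousAt.comp (g := fun p => rowCov p a b)
        (continuousAt_rowCov_apply (hCd p.1 p.2) a b) continuous_subtype_val.continuousAt
    refine (isClosed_le continuous_const (h1.sub continuous_const).norm).union ?_
    refine isClosed_iUnion_of_finite fun a => isClosed_iUnion_of_finite fun b => ?_
    exact isClosed_le continuous_const ((h2 a b).sub continuous_const).abs
  have hlt : ∀ p ∈ F, φ p < φ ⟨p₀, hp₀C⟩ := fun p hp => by
    rw [hφe, hφe]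
    refine integral_powLink_row_lt hτ (hCd p.1 p.2) hp₀ fun heq => ?_
    rcases hp with h | h
    · have h' : δ ≤ ‖rowMean p.1 - rowMean p₀‖ := h
      rw [heq.1, sub_self, norm_zero] at h'
      linarith
    · obtain ⟨a, b, h'⟩ : ∃ a b, δ ≤ |rowCov p.1 a b - rowCov p₀ a b| := by
        simpa only [Set.mem_iUnion, Set.mem_ofPred_eq] using h
      rw [heq.2, sub_self, abs_zero] at h'
      linarith
  obtain ⟨γ, hγ, hγF⟩ : ∃ γ > 0, ∀ p ∈ F, φ p + γ ≤ φ ⟨p₀, hp₀C⟩ := by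
    rcases F.eq_empty_or_nonempty with h | h
    · exact ⟨1, one_pos, fun p hp => by rw [h] at hp; exact hp.elim⟩
    · obtain ⟨q, hq, hmax⟩ := hFc.isCompact.exists_isMaxOn h φ.continuous.continuousOn
      refine ⟨φ ⟨p₀, hp₀C⟩ - φ q, sub_pos.2 (hlt q hq), fun p hp => ?_⟩
      have : φ p ≤ φ q := hmax hp
      linarith
  -- On `F` the limit falls short by at least `γ`; errors below γ/2 at the candidate and at `p₀`
  -- cannot make up for it.
  refine (hRl.and (hlim (γ / 2) (half_pos hγ))).mono
    (Eventually.of_forall fun n ω ⟨h1, h2⟩ p hp hle => ?_)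
  obtain ⟨hpR, hpl⟩ := h1 p hp hle
  have hpC : p ∈ C := by
    refine ⟨hpR.trans (le_max_left _ _), (min_le_left _ _).trans ?_⟩
    have := Real.exp_le_exp.2 hpl
    rwa [Real.exp_log (abs_pos.2 hp)] at this
  have hpF : (⟨p, hpC⟩ : C) ∉ F := fun hmem => by
    have e1 := h2 ⟨p, hpC⟩
    have e2 := h2 ⟨p₀, hp₀C⟩
    have e3 := hγF _ hmem
    rw [smul_eq_mul, Real.norm_eq_abs, abs_lt] at e1 e2
    linarith [e1.2, e2.1]
  constructor
  · by_contra! h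
    exact hpF (Or.inl h)
  · intro a b
    by_contra! h
    exact hpF (Or.inr (Set.mem_iUnion.2 ⟨a, Set.mem_iUnion.2 ⟨b, h⟩⟩))

/-- Consistency of the restricted estimator. -/
theorem holdsWHP_norm_sub_lt {d r : ℕ} {τ : ℝ} (hτ : 0 ≤ τ)
    {mu : EuclideanSpace ℝ (Fin d) → EuclideanSpace ℝ (Fin m)}
    {Sig : EuclideanSpace ℝ (Fin d) → Matrix (Fin m) (Fin m) ℝ}
    {g : EuclideanSpace ℝ (Fin d) → EuclideanSpace ℝ (Fin r)}
    {Θ : Set (EuclideanSpace ℝ (Fin d))} {θ : EuclideanSpace ℝ (Fin d)}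
    (hθ : θ ∈ restrictedSpace Θ g) (hSig : ∀ t ∈ Θ, (Sig t).PosDef)
    (hid : IdentifiedAt mu Sig (restrictedSpace Θ g) θ) (hindep : iIndepFun Y P)
    (hlaw : ∀ i, HasLaw (Y i) (multivariateGaussian (mu θ) (Sig θ)) P)
    {est : ℕ → Ω → EuclideanSpace ℝ (Fin d)}
    (hest : HoldsWHP P fun n ω => est n ω ∈ restrictedSpace Θ g ∧
      (n : ℝ)⁻¹ * ∑ i ∈ Finset.range n, dpd τ suff (natParam mu Sig) θ (Y i ω) ≤
        (n : ℝ)⁻¹ * ∑ i ∈ Finset.range n, dpd τ suff (natParam mu Sig) (est n ω) (Y i ω))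
    {ε : ℝ} (hε : 0 < ε) : HoldsWHP P (fun n ω => ‖est n ω - θ‖ < ε) := by
  obtain ⟨δ, hδ, hclose⟩ := hid ε hε
  have hrow : ∀ t ∈ Θ, ∃ p : Rows m, (rowMat p).det ≠ 0 ∧ rowMean p = mu t ∧ rowCov p = Sig t ∧
      ∀ y, dpd τ suff (natParam mu Sig) t y = rowObj τ p y := fun t ht => by
    obtain ⟨p, hp, h1, h2⟩ := exists_rows (hSig t ht) (mu t)
    refine ⟨p, hp, h1, h2, fun y => ?_⟩
    rw [dpd_suff hτ (hSig t ht), ← h1, ← h2, logDens_row hp, kap_row, rowObj]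
  obtain ⟨p₀, hp₀, hm₀, hc₀, ho₀⟩ := hrow θ hθ.1
  refine (hest.and (holdsWHP_mean_cov_close (P := P) (Y := Y) hτ hp₀ hindep
    (by rwa [hm₀, hc₀]) hδ)).mono (Eventually.of_forall fun n ω ⟨⟨h1, h2⟩, h3⟩ => ?_)
  obtain ⟨p, hp, hm, hc, ho⟩ := hrow _ h1.1
  simp only [ho₀, ho] at h2
  have h4 := h3 p hp h2
  rw [hm, hm₀, hc, hc₀] at h4
  exact hclose _ h1 h4.1 h4.2

end Consistency

end

end GaussianDPD

/-! ### The theorem -/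

theorem mainTheorem1 {Ω : Type*} [MeasurableSpace Ω] (P : Measure Ω) [IsProbabilityMeasure P]
    {m d r : ℕ} (τ : ℝ) (hτ : 0 ≤ τ)
    (mu : EuclideanSpace ℝ (Fin d) → EuclideanSpace ℝ (Fin m))
    (Sig : EuclideanSpace ℝ (Fin d) → Matrix (Fin m) (Fin m) ℝ)
    (g : EuclideanSpace ℝ (Fin d) → EuclideanSpace ℝ (Fin r))
    (Θ : Set (EuclideanSpace ℝ (Fin d))) (θ : EuclideanSpace ℝ (Fin d))
    -- the true parameter: an interior point of `Θ` which satisfies the constraints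
    (hθ : θ ∈ interior Θ) (hθ₀ : θ ∈ GaussianDPD.restrictedSpace Θ g)
    -- regularity of the model and of the constraints
    (hSig : ∀ t ∈ Θ, (Sig t).PosDef)
    (hmu2 : ContDiffAt ℝ 2 mu θ) (hSig2 : ∀ a b, ContDiffAt ℝ 2 (fun t => Sig t a b) θ)
    (hg : ContDiffAt ℝ 1 g θ) (hG : (GaussianDPD.matG g θ).rank = r)
    (hJ : IsUnit (GaussianDPD.matJ τ mu Sig θ).det)
    (hid : GaussianDPD.IdentifiedAt mu Sig (GaussianDPD.restrictedSpace Θ g) θ)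
    -- independent observations whose common law is the member `θ` of the Gaussian model
    (Y : ℕ → Ω → EuclideanSpace ℝ (Fin m)) (hindep : iIndepFun Y P)
    (hlaw : ∀ i, HasLaw (Y i) (multivariateGaussian (mu θ) (Sig θ)) P)
    -- the estimator: a maximizer over `Θ₀`, with probability tending to one
    (est : ℕ → Ω → EuclideanSpace ℝ (Fin d)) (hmeas : ∀ n, AEMeasurable (est n) P)
    (hest : Tendsto (fun n : ℕ =>
        P {ω | ¬ GaussianDPD.IsRMDPDGE τ mu Sig Θ g n (fun i => Y i ω) (est n ω)})
      atTop (𝓝 0)) :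
    -- the limit law is well defined, and it is the limit in distribution
    IsUnit ((GaussianDPD.matG g θ)ᵀ * (GaussianDPD.matJ τ mu Sig θ)⁻¹ *
        GaussianDPD.matG g θ).det ∧
      (GaussianDPD.matM τ mu Sig g θ).PosSemidef ∧
      TendstoInDistribution (fun (n : ℕ) ω => Real.sqrt n • (est n ω - θ)) atTop
        (id : EuclideanSpace ℝ (Fin d) → EuclideanSpace ℝ (Fin d)) (fun _ => P)
        (multivariateGaussian 0 (GaussianDPD.matM τ mu Sig g θ)) := by
  have hΘ : Θ ∈ 𝓝 θ := mem_interior_iff_mem_nhds.1 hθ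
  have hpd : ∀ᶠ t in 𝓝 θ, (Sig t).PosDef := Filter.mem_of_superset hΘ hSig
  have hmu1 := hmu2.of_le one_le_two
  have hSig1 : ∀ a b, ContDiffAt ℝ 1 (fun t => Sig t a b) θ := fun a b =>
    (hSig2 a b).of_le one_le_two
  -- J is always positive semidefinite, so nonsingularity makes it positive definite.
  have hJpd : (GaussianDPD.matJ τ mu Sig θ).PosDef :=
    (GaussianDPD.posSemidef_matJ hmu1 hSig1 hpd hτ).posDef_iff_det_ne_zero.2 hJ.ne_zero
  have hGJ := GaussianDPD.isUnit_det_transpose_mul_inv_mul hJpd hG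
  have hmax : GaussianDPD.HoldsWHP P (fun n ω =>
      est n ω ∈ GaussianDPD.restrictedSpace Θ g ∧
      IsMaxOn (fun t => (n : ℝ)⁻¹ * ∑ i ∈ Finset.range n,
          GaussianDPD.dpd τ GaussianDPD.suff (GaussianDPD.natParam mu Sig) t (Y i ω))
        {t | t ∈ Θ ∧ g t = 0} (est n ω)) := by
    refine GaussianDPD.HoldsWHP.mono (p := fun n ω =>
      GaussianDPD.IsRMDPDGE τ mu Sig Θ g n (fun i => Y i ω) (est n ω)) hest ?_
    filter_upwards [eventually_ne_atTop 0] with n hn ω hω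
    refine ⟨hω.1, fun t ht => ?_⟩
    have h := hω.2 ht
    simp only [Set.mem_ofPred_eq] at h ⊢
    -- Both parameters lie in `Θ`, where Σ is positive definite, and the additive constant of
    -- `objective_eq` cancels in the comparison.
    rw [GaussianDPD.objective_eq hτ (hSig t ht.1) hn,
      GaussianDPD.objective_eq hτ (hSig _ hω.1.1) hn] at h
    linarith
  refine ⟨hGJ, GaussianDPD.posSemidef_matM hmu1 hSig1 hpd hτ,
    GaussianDPD.tendstoInDistribution_of_consistent hτ hΘ hθ₀.2 hpd hmu2 hSig2 hg hJ hGJ hindep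
      hlaw hmeas (fun ε hε => GaussianDPD.holdsWHP_norm_sub_lt hτ hθ₀ hSig hid hindep hlaw
        (hmax.mono (Eventually.of_forall fun n ω h => ⟨h.1, h.2 hθ₀⟩)) hε)
      (hmax.mono (Eventually.of_forall fun n ω h => ⟨h.1.2, h.2⟩))⟩
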